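/- Let $M$ be a compact smooth manifold with (possibly empty) boundary $\partial M$, of dimension $n\ge 1$, with a smooth Riemannian metric $g$. Let $\Omega^k(M)$ be the space of smooth $k$-forms and $\hat\Omega^k(M)$ the space of smooth outer-oriented $k$-forms (pseudo-forms, i.e. forms that change sign with the local orientation of $M$); hats mark pseudo-forms. (If $M$ is oriented, pseudo-forms may be identified with forms.) The product of a form and a pseudo-form is a pseudo-form, and pseudo-forms of top degree can be integrated over $M$; $\partial M$ is treated likewise, an orientation of $\partial M$ corresponding to the orientation of $M$ given by an outward vector followed by the orientation of $\partial M$. Let $\operatorname{tr}$ be the pullback to $\partial M$, and put $\langle\alpha|\beta\rangle_M=\int_M\alpha\wedge\beta$, $\langle\alpha|\beta\rangle_{\partial M}=\int_{\partial M}\alpha\wedge\beta$. The Hodge star exchanges $k$-forms and $(n-k)$-pseudo-forms, and $k$-pseudo-forms and $(n-k)$-forms; it is defined by $\alpha\wedge\star\beta=(\alpha,\beta)_g\,\mathrm{vol}$. The codifferential on (pseudo-)forms of degree $k$ is $\mathrm d^*=(-1)^{nk+n+1}\star\mathrm d\star$. Let $0\le p,q\le n$ with $p+q=n+1$ and put $r=pq+1$.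 The canonical Stokes–Dirac structure consists of the tuples of $\hat f_1^p,\ f_2^q$, $e_1^{n-p}\in\Omega^{n-p}(M)$, $\hat e_2^{n-q}\in\hat\Omega^{n-q}(M)$, $f_\partial^{n-p},\ \hat e_\partial^{n-q}$ with $$\hat f_1^p=(-1)^r\,\mathrm d\hat e_2^{n-q},\quad f_2^q=\mathrm d e_1^{n-p},\quad f_\partial^{n-p}=\operatorname{tr}e_1^{n-p},\quad \hat e_\partial^{n-q}=(-1)^p\operatorname{tr}\hat e_2^{n-q}.$$ The adjoint Stokes–Dirac structure is its image under the transformation of flows and efforts induced by the Hodge-star diffeomorphism $\Phi=\operatorname{diag}(\star^{-1},\star)$, that is, the set of tuples $(f_1^{n-p},\hat f_2^{n-q},\hat e_1^{p},e_2^{q},f_\partial^{n-p},\hat e_\partial^{n-q})$, with $\hat e_1^p\in\hat\Omega^p(M)$ and $e_2^q\in\Omega^q(M)$, for which there is a tuple of the canonical structure, with the same boundary variables, such that $$f_1^{n-p}=\star^{-1}\hat f_1^p,\qquad \hat f_2^{n-q}=\star f_2^q,\qquad e_1^{n-p}=\star\hat e_1^p,\qquad \hat e_2^{n-q}=\star^{-1}e_2^q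 .$$ (a) The adjoint Stokes–Dirac structure is expressed by codifferentials: a tuple belongs to it if and only if $\hat e_1^p$ and $e_2^q$ are smooth and $$f_1^{n-p}=(-1)^{a_0}\,\mathrm d^*e_2^q,\quad \hat f_2^{n-q}=(-1)^{a_1}\,\mathrm d^*\hat e_1^p,\quad f_\partial^{n-p}=\operatorname{tr}\star\hat e_1^p,\quad \hat e_\partial^{n-q}=(-1)^{p+q(n-q)}\operatorname{tr}\star e_2^q,$$ where $a_0=r+p(n-p)+q(n-q)+n(q+1)+1$ and $a_1=n(p+1)+1$. (b) Every tuple of the adjoint Stokes–Dirac structure satisfies the power balance $$\langle \hat e_1^p\,|\,f_1^{n-p}\rangle_M+\langle e_2^q\,|\,\hat f_2^{n-q}\rangle_M+\langle \hat e_\partial^{n-q}\,|\,f_\partial^{n-p}\rangle_{\partial M}=0 .$$ -/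

import Mathlib

open Set Topology MeasureTheory
open scoped Manifold ContDiff

noncomputable section

namespace DualField

/-! ### Exterior algebra of a single vector space -/

section Pointwise

variable {V : Type*} [AddCommGroup V] [Module ℝ V] [TopologicalSpace V]

/-- Reindexing of the degree of an alternating form along an equality of degrees. -/
def castDeg {k l : ℕ} (h : k = l) (α : V [⋀^Fin k]→L[ℝ] ℝ) : V [⋀^Fin l]→L[ℝ] ℝ := h ▸ α

/-- The wedge product
`(α ∧ β)(v₁, …, vₖ₊ₗ) = ∑ sign σ • α (v_σ(1), …, v_σ(k)) * β (v_σ(k+1), …, v_σ(k+l))`,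
the sum being over all `(k, l)`-shuffles `σ`. The degree `n = k + l` is a free variable. -/
def wedge {k l n : ℕ} (h : k + l = n)
    (α : V [⋀^Fin k]→L[ℝ] ℝ) (β : V [⋀^Fin l]→L[ℝ] ℝ) : V [⋀^Fin n]→L[ℝ] ℝ :=
  castDeg h
    { ((LinearMap.mul' ℝ ℝ).compAlternatingMap
        (α.toAlternatingMap.domCoprod β.toAlternatingMap)).domDomCongr finSumFinEquiv with
      cont := by
        change Continuous fun v : Fin (k + l) → V =>
          (LinearMap.mul' ℝ ℝ) ((α.toAlternatingMap.domCoprod β.toAlternatingMap)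
            (v ∘ finSumFinEquiv))
        simp only [AlternatingMap.domCoprod_apply, sum_apply, map_sum]
        refine continuous_finsetSum _ fun σ _ => ?_
        induction σ using Quotient.inductionOn' with
        | h σ =>
          simp only [AlternatingMap.domCoprod.summand_mk'', Function.comp_def]
          simp only [smul_apply, MultilinearMap.domDomCongr_apply,
            MultilinearMap.domCoprod_apply, LinearMap.map_smul_of_tower, LinearMap.mul'_apply]
          refine Continuous.const_smul (Continuous.mul ?_ ?_) _
          · exact α.cont.comp (continuous_pi fun i => continuous_apply _)
          · exact β.cont.comp (continuous_pi fun i => continuous_apply _) }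

/-- The pointwise inner product of `k`-forms induced by an inner product `G` on `V`,
`⟨α, β⟩ = (1 / k!) ∑ g^{i₁ j₁} ⋯ g^{iₖ jₖ} α_{i₁ … iₖ} β_{j₁ … jₖ}`,
where `α_{i₁ … iₖ}` are the components with respect to the basis `b` and `g^{i j}` is the inverse
of the Gram matrix of `b`. The indices run over all values, hence the factor `1 / k!`: each
increasing multi-index counts once, and the wedge monomials of an orthonormal coframe are
orthonormal. -/
def formInner {n k : ℕ} (G : V →L[ℝ] V →L[ℝ] ℝ) (b : Fin n → V)
    (α β : V [⋀^Fin k]→L[ℝ] ℝ) : ℝ :=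
  ((k.factorial : ℝ))⁻¹ * ∑ i : Fin k → Fin n, ∑ j : Fin k → Fin n,
    (∏ s, (Matrix.of fun a c => G (b a) (b c))⁻¹ (i s) (j s)) * α (b ∘ i) * β (b ∘ j)

/-- The volume form of the inner product `G` relative to the orientation of the frame `e`,
`vol (v₁, …, vₙ) = det (G (eᵢ, vⱼ)) / √(det (G (eᵢ, eⱼ)))`; for a basis `e` with dual basis
`eⁱ` it equals `√(det (G (eᵢ, eⱼ))) e¹ ∧ … ∧ eⁿ`. It is zero if `e` is linearly dependent. -/
def volForm {n : ℕ} (G : V →L[ℝ] V →L[ℝ] ℝ) (e : Fin n → V) : V [⋀^Fin n]→L[ℝ] ℝ :=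
  (√(Matrix.of fun i j => G (e i) (e j)).det)⁻¹ •
    { (Matrix.detRowAlternating (R := ℝ) (n := Fin n)).compLinearMap
        (LinearMap.pi fun i => (G (e i) : V →ₗ[ℝ] ℝ)) with
      cont := by
        change Continuous fun v : Fin n → V => (Matrix.of fun j i => G (e i) (v j)).det
        refine Continuous.matrix_det (continuous_matrix fun j i => ?_)
        exact (G (e i)).continuous.comp (continuous_apply j) }

/-- The Hodge star of a form on `V`, relative to the orientation of the frame `e`: the form
`⋆β` characterised by `α ∧ ⋆β = ⟨α, β⟩ vol` for all `α`. -/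
def hodge {n k l : ℕ} (h : k + l = n) (G : V →L[ℝ] V →L[ℝ] ℝ) (b e : Fin n → V)
    (β : V [⋀^Fin k]→L[ℝ] ℝ) : V [⋀^Fin l]→L[ℝ] ℝ :=
  Classical.epsilon fun γ : V [⋀^Fin l]→L[ℝ] ℝ =>
    ∀ α : V [⋀^Fin k]→L[ℝ] ℝ, wedge h α γ = formInner G b α β • volForm G e

end Pointwise

/-! ### Smooth manifolds with boundary

`M` is a manifold with boundary of dimension `m + 1`, modelled on the half space `{y | 0 ≤ y 0}` of
`ℝ^(m+1)`. Its preferred charts `φ_c` are indexed by the points `c` of `M`. -/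

/-- The coordinate space of an `n`-dimensional manifold. -/
abbrev Coord (n : ℕ) := EuclideanSpace ℝ (Fin n)

/-- The `i`-th standard basis vector of the coordinate space. -/
def stdVec {n : ℕ} (i : Fin n) : Coord n := EuclideanSpace.single i (1 : ℝ)

/-- The inclusion `z ↦ (0, z)` of the bounding hyperplane of the half space. -/
def hyperplane {m : ℕ} (z : Coord m) : Coord (m + 1) :=
  WithLp.toLp 2 (Fin.cons (0 : ℝ) fun i => z i)

section Manifold

variable {m : ℕ} {M : Type*} [TopologicalSpace M] [ChartedSpace (EuclideanHalfSpace (m + 1)) M]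

variable (m) in
/-- The tangent space of `M` at `x`. -/
abbrev Tan (x : M) := TangentSpace (𝓡∂ (m + 1)) x

variable (m M) in
/-- The boundary `∂M`. -/
abbrev Bdry := ((𝓡∂ (m + 1)).boundary M : Set M)

section Charts

variable [IsManifold (𝓡∂ (m + 1)) ∞ M]

/-- The differential `Dφ_c : T_x M → ℝ^(m+1)` at `x` of the chart `φ_c`. -/
def chartD (c x : M) : Tan m x →L[ℝ] Coord (m + 1) :=
  (trivializationAt (Coord (m + 1)) (TangentSpace (𝓡∂ (m + 1))) c).continuousLinearMapAt ℝ x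

/-- The differential of `φ_c⁻¹` at `φ_c x`, as a map `ℝ^(m+1) → T_x M`: the inverse of `Dφ_c`. It
maps the standard basis to the coordinate vectors `∂₀, …, ∂ₘ` of the chart `φ_c`. -/
def chartInvD (c x : M) : Coord (m + 1) →L[ℝ] Tan m x :=
  (trivializationAt (Coord (m + 1)) (TangentSpace (𝓡∂ (m + 1))) c).symmL ℝ x

/-- The coordinate frame `∂₀, …, ∂ₘ` at `x` of the chart `φ_c`. -/
def coordFrame (c x : M) : Fin (m + 1) → Tan m x := fun i => chartInvD c x (stdVec i)

/-- The tangent space `T_x ∂M` of the boundary, the hyperplane of `T_x M` on which the differential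
of the boundary coordinate `φ⁰` vanishes. -/
def bdryTan (x : M) : Submodule ℝ (Tan m x) :=
  LinearMap.ker ((EuclideanSpace.proj (𝕜 := ℝ) (0 : Fin (m + 1)) ∘L chartD x x :
    Tan m x →L[ℝ] ℝ) : Tan m x →ₗ[ℝ] ℝ)

/-- An outward pointing tangent vector at a boundary point `x`. -/
def outward (x : M) : Tan m x := chartInvD x x (-stdVec 0)

/-- The point with coordinates `(0, z)` in any chart is a boundary point. -/
theorem mem_bdry (c : M) (z : Coord m) (h : hyperplane z ∈ (extChartAt (𝓡∂ (m + 1)) c).target) :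
    (extChartAt (𝓡∂ (m + 1)) c).symm (hyperplane z) ∈ Bdry m M := by
  have hs := (extChartAt (𝓡∂ (m + 1)) c).map_target h
  refine ((𝓡∂ (m + 1)).isBoundaryPoint_iff_of_mem_atlas (n := ∞) (by simp)
    (chart_mem_atlas _ c) (by rwa [extChartAt_source] at hs)).2 ?_
  change (extChartAt (𝓡∂ (m + 1)) c) ((extChartAt (𝓡∂ (m + 1)) c).symm (hyperplane z)) ∈
    frontier (extChartAt (𝓡∂ (m + 1)) c).target
  rw [(extChartAt (𝓡∂ (m + 1)) c).right_inv h]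
  refine ⟨subset_closure h, fun hi => ?_⟩
  have := interior_mono (extChartAt_target_subset_range c) hi
  rw [interior_range_modelWithCornersEuclideanHalfSpace] at this
  simp [hyperplane] at this

/-- In any chart, the coordinate vectors `∂₁, …, ∂ₘ` at a boundary point are tangent to `∂M`. -/
theorem coordFrame_mem_bdryTan (c x : M) (hx : x ∈ Bdry m M)
    (hc : x ∈ (extChartAt (𝓡∂ (m + 1)) c).source) (i : Fin m) :
    coordFrame c x i.succ ∈ bdryTan x := by
  have hc' : x ∈ (chartAt (EuclideanHalfSpace (m + 1)) c).source := by
    rwa [extChartAt_source] at hc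
  have hxx : x ∈ (chartAt (EuclideanHalfSpace (m + 1)) x).source := mem_chart_source _ x
  set F : Coord (m + 1) → Coord (m + 1) :=
    extChartAt (𝓡∂ (m + 1)) x ∘ (extChartAt (𝓡∂ (m + 1)) c).symm with hF
  have hd : HasFDerivWithinAt F (tangentCoordChange (𝓡∂ (m + 1)) c x x) (range (𝓡∂ (m + 1)))
      (extChartAt (𝓡∂ (m + 1)) c x) :=
    hasFDerivWithinAt_tangentCoordChange ⟨hc, mem_extChartAt_source x⟩
  -- the curve `t ↦ φ_c x + t e_i` stays in the half space
  set γ : ℝ → Coord (m + 1) := fun t => extChartAt (𝓡∂ (m + 1)) c x + t • stdVec i.succ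
  have hγ : ∀ t, γ t ∈ range (𝓡∂ (m + 1)) := by
    intro t
    have h0 := extChartAt_target_subset_range c ((extChartAt (𝓡∂ (m + 1)) c).map_source hc)
    rw [range_modelWithCornersEuclideanHalfSpace] at h0 ⊢
    have h1 : γ t 0 = extChartAt (𝓡∂ (m + 1)) c x 0 := by simp [γ, stdVec]
    exact (show (0 : ℝ) ≤ γ t 0 from h1 ▸ h0)
  have hγd : HasDerivAt γ (stdVec i.succ) 0 := by
    simpa [γ] using ((hasDerivAt_id (0 : ℝ)).smul_const (stdVec i.succ)).const_add
      (extChartAt (𝓡∂ (m + 1)) c x)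
  have hγ0 : γ 0 = extChartAt (𝓡∂ (m + 1)) c x := by simp [γ]
  have hcomp : HasDerivAt (fun t => F (γ t))
      (tangentCoordChange (𝓡∂ (m + 1)) c x x (stdVec i.succ)) 0 := by
    rw [← hasDerivWithinAt_univ]
    rw [← hγ0] at hd
    exact hd.comp_hasDerivWithinAt 0 hγd.hasDerivWithinAt (fun t _ => hγ t)
  have h0 : HasDerivAt (fun t => F (γ t) 0)
      ((tangentCoordChange (𝓡∂ (m + 1)) c x x (stdVec i.succ)) 0) 0 :=
    (EuclideanSpace.proj (𝕜 := ℝ) (0 : Fin (m + 1))).hasFDerivAt.comp_hasDerivAt 0 hcomp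
  have hmin : IsLocalMin (fun t => F (γ t) 0) 0 := by
    refine Filter.Eventually.of_forall fun t => ?_
    have h1 : F (γ 0) 0 = 0 := by
      rw [hγ0, hF, Function.comp_apply, (extChartAt (𝓡∂ (m + 1)) c).left_inv hc]
      have := (𝓡∂ (m + 1)).isBoundaryPoint_iff.1 hx
      rw [frontier_range_modelWithCornersEuclideanHalfSpace] at this
      exact this.symm
    have h2 : F (γ t) ∈ range (𝓡∂ (m + 1)) := ⟨_, rfl⟩
    rw [range_modelWithCornersEuclideanHalfSpace] at h2
    change F (γ 0) 0 ≤ F (γ t) 0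
    rw [h1]
    exact h2
  have hz := hmin.hasDerivAt_eq_zero h0
  rw [bdryTan, LinearMap.mem_ker]
  change (chartD x x (chartInvD c x (stdVec i.succ)) : Coord (m + 1)) 0 = 0
  rw [chartD, chartInvD, TangentBundle.symmL_trivializationAt_eq_core hc',
    TangentBundle.continuousLinearMapAt_trivializationAt_eq_core hxx]
  have := tangentCoordChange_self (I := 𝓡∂ (m + 1)) (x := x) (z := x)
    (v := tangentCoordChange (𝓡∂ (m + 1)) c x x (stdVec i.succ)) (mem_extChartAt_source x)
  rw [← this] at hz
  exact hz

end Charts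

/-! ### Forms and pseudo-forms -/

variable (m M) in
/-- Sections of the bundle of `k`-forms on `M` (no regularity is imposed here). -/
abbrev Form (k : ℕ) := ∀ x : M, Tan m x [⋀^Fin k]→L[ℝ] ℝ

variable (m M) in
/-- Outer-oriented `k`-forms: at each point, a `k`-form that depends on an orientation of the
tangent space, the latter being given by a frame. See `IsPseudo`. -/
abbrev PseudoForm (k : ℕ) := ∀ x : M, (Fin (m + 1) → Tan m x) → Tan m x [⋀^Fin k]→L[ℝ] ℝ

/-- `τ` is a pseudo-form: it depends on the frame through the orientation only, and changes sign
with the orientation (and is zero on linearly dependent families). -/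
def IsPseudo {k : ℕ} (τ : PseudoForm m M k) : Prop :=
  ∀ (x : M) (A : Tan m x →ₗ[ℝ] Tan m x) (e : Fin (m + 1) → Tan m x),
    τ x (fun i => A (e i)) = Real.sign (LinearMap.det A) • τ x e

/-- `α ∧ τ` of a form and a pseudo-form. -/
def Form.wedgePseudo {k l n : ℕ} (h : k + l = n) (α : Form m M k) (τ : PseudoForm m M l) :
    PseudoForm m M n := fun x e => wedge h (α x) (τ x e)

/-- `τ ∧ α` of a pseudo-form and a form. -/
def PseudoForm.wedgeForm {k l n : ℕ} (h : k + l = n) (τ : PseudoForm m M k) (α : Form m M l) :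
    PseudoForm m M n := fun x e => wedge h (τ x e) (α x)

section Smooth

variable [IsManifold (𝓡∂ (m + 1)) ∞ M]

/-- The local representation of a form in the chart `φ_c`, i.e. its pullback by `φ_c⁻¹`. -/
def Form.rep {k : ℕ} (c : M) (α : Form m M k) (y : Coord (m + 1)) :
    Coord (m + 1) [⋀^Fin k]→L[ℝ] ℝ :=
  (α ((extChartAt (𝓡∂ (m + 1)) c).symm y)).compContinuousLinearMap
    (chartInvD c ((extChartAt (𝓡∂ (m + 1)) c).symm y))

/-- The form on the domain of the chart `φ_c` which represents the pseudo-form `τ` relative to the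
locally constant orientation given by the frame with the constant coordinates `B`. -/
def PseudoForm.orient {k : ℕ} (c : M) (B : Fin (m + 1) → Coord (m + 1))
    (τ : PseudoForm m M k) : Form m M k :=
  fun x => τ x fun i => chartInvD c x (B i)

/-- `α ∈ Ω^k(M)`: `α` is a smooth `k`-form. -/
def Form.IsSmooth {k : ℕ} (α : Form m M k) : Prop :=
  ∀ c : M, ContDiffOn ℝ ∞ (Form.rep c α) (extChartAt (𝓡∂ (m + 1)) c).target

/-- `τ` is a smooth pseudo-form of degree `k`. -/
def PseudoForm.IsSmooth {k : ℕ} (τ : PseudoForm m M k) : Prop :=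
  IsPseudo τ ∧
    ∀ c : M, ContDiffOn ℝ ∞ (Form.rep c (PseudoForm.orient c stdVec τ)) (extChartAt (𝓡∂ (m + 1)) c).target

/-- The exterior derivative, computed at `x` in the chart at `x`. The degree `l = k + 1` of the
result is a free variable. -/
def Form.d {k l : ℕ} (h : k + 1 = l) (α : Form m M k) : Form m M l := fun x =>
  castDeg h ((extDerivWithin (Form.rep x α) (range (𝓡∂ (m + 1)))
    (extChartAt (𝓡∂ (m + 1)) x x)).compContinuousLinearMap (chartD x x))

/-- The exterior derivative of a pseudo-form, with respect to a locally constant orientation. -/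
def PseudoForm.d {k l : ℕ} (h : k + 1 = l) (τ : PseudoForm m M k) : PseudoForm m M l := fun x e =>
  Form.d h (PseudoForm.orient x (fun i => chartD x x (e i)) τ) x

/-! ### Traces -/

variable (m M) in
/-- Sections over `∂M` of the bundle of `k`-forms on `∂M`. -/
abbrev BdryForm (k : ℕ) := ∀ x : Bdry m M, bdryTan (m := m) x.1 [⋀^Fin k]→L[ℝ] ℝ

variable (m M) in
/-- Outer-oriented `k`-forms on `∂M`. -/
abbrev BdryPseudoForm (k : ℕ) :=
  ∀ x : Bdry m M, (Fin m → bdryTan (m := m) x.1) → bdryTan (m := m) x.1 [⋀^Fin k]→L[ℝ] ℝ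

/-- The trace, i.e. the pullback by the inclusion `∂M → M`. -/
def Form.tr {k : ℕ} (α : Form m M k) : BdryForm m M k := fun x =>
  (α x.1).compContinuousLinearMap (bdryTan (m := m) x.1).subtypeL

/-- The trace of a pseudo-form. An orientation of `∂M` corresponds to the orientation of `M`
given by an outward vector followed by an oriented frame of `∂M`. -/
def PseudoForm.tr {k : ℕ} (τ : PseudoForm m M k) : BdryPseudoForm m M k := fun x e =>
  (τ x.1 (Fin.cons (outward x.1) fun i => (e i : Tan m x.1))).compContinuousLinearMap
    (bdryTan (m := m) x.1).subtypeL

/-- `τ ∧ α` of a pseudo-form and a form on the boundary. -/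
def BdryPseudoForm.wedgeForm {k l n : ℕ} (h : k + l = n) (τ : BdryPseudoForm m M k)
    (α : BdryForm m M l) : BdryPseudoForm m M n := fun x e => wedge h (τ x e) (α x)

/-! ### Integration -/

section Integral

variable [T2Space M] [CompactSpace M]

variable (m M) in
/-- A smooth partition of unity `(ρ_c)` on `M`, the support of `ρ_c` being contained in the domain
of the chart `φ_c`. -/
def partition : SmoothPartitionOfUnity M (𝓡∂ (m + 1)) M univ :=
  (SmoothPartitionOfUnity.exists_isSubordinate_chartAt_source (𝓡∂ (m + 1)) M).choose

/-- The integral over `M` of a pseudo-form `τ` of top degree: the sum over `c` of the integrals of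
`ρ_c τ(∂₀, …, ∂ₘ)` in the coordinates of `φ_c`, where `τ` is taken relative to the orientation
of the coordinates. -/
def PseudoForm.integral (τ : PseudoForm m M (m + 1)) : ℝ :=
  ∑ᶠ c : M, ∫ y in (extChartAt (𝓡∂ (m + 1)) c).target,
    partition m M c ((extChartAt (𝓡∂ (m + 1)) c).symm y) * 
      Form.rep c (PseudoForm.orient c stdVec τ) y stdVec

open Classical in
/-- The integral over `∂M` of a pseudo-form `σ` of top degree on `∂M`: the sum over `c` of the
integrals of `ρ_c σ(∂₁, …, ∂ₘ)` over the bounding hyperplane in the coordinates of `φ_c`, where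
`σ` is taken relative to the orientation of the coordinates `y¹, …, yᵐ` of `∂M`. -/
def BdryPseudoForm.integral (σ : BdryPseudoForm m M m) : ℝ :=
  ∑ᶠ c : M, ∫ z : Coord m,
    if h : hyperplane z ∈ (extChartAt (𝓡∂ (m + 1)) c).target then
      let x : Bdry m M := ⟨(extChartAt (𝓡∂ (m + 1)) c).symm (hyperplane z), mem_bdry c z h⟩
      let e : Fin m → bdryTan (m := m) x.1 := fun i => ⟨coordFrame c x.1 i.succ,
        coordFrame_mem_bdryTan c x.1 x.2
          ((extChartAt (𝓡∂ (m + 1)) c).map_target h) i⟩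
      partition m M c x.1 * σ x e e
    else 0

/-- The duality product `⟨τ | α⟩_M = ∫_M τ ∧ α`. -/
def dualPseudoForm {k l : ℕ} (h : k + l = m + 1) (τ : PseudoForm m M k) (α : Form m M l) : ℝ :=
  PseudoForm.integral (PseudoForm.wedgeForm h τ α)

/-- The duality product `⟨α | τ⟩_M = ∫_M α ∧ τ`. -/
def dualFormPseudo {k l : ℕ} (h : k + l = m + 1) (α : Form m M k) (τ : PseudoForm m M l) : ℝ :=
  PseudoForm.integral (Form.wedgePseudo h α τ)

/-- The duality product `⟨τ | α⟩_∂M = ∫_∂M τ ∧ α`. -/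
def dualBdry {k l : ℕ} (h : k + l = m) (τ : BdryPseudoForm m M k) (α : BdryForm m M l) : ℝ :=
  BdryPseudoForm.integral (BdryPseudoForm.wedgeForm h τ α)

end Integral

/-! ### Hodge star and codifferential of a Riemannian metric -/

variable (m M) in
/-- Smooth Riemannian metrics on `M`. -/
abbrev Metric := Bundle.ContMDiffRiemannianMetric (𝓡∂ (m + 1)) ∞ (Coord (m + 1))
  (fun x : M => TangentSpace (𝓡∂ (m + 1)) x)

variable (g : Metric m M)

/-- The Hodge star `Ω^k(M) → Ω̂^(n-k)(M)` of a form is a pseudo-form. -/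
def starForm {k l : ℕ} (h : k + l = m + 1) (α : Form m M k) : PseudoForm m M l := fun x e =>
  hodge h (g.inner x) (coordFrame x x) e (α x)

/-- The Hodge star `Ω̂^k(M) → Ω^(n-k)(M)` of a pseudo-form is a form: both the form and the volume
form change sign with the orientation, so that any orientation may be used. -/
def starPseudo {k l : ℕ} (h : k + l = m + 1) (τ : PseudoForm m M k) : Form m M l := fun x =>
  hodge h (g.inner x) (coordFrame x x) (coordFrame x x) (τ x (coordFrame x x))

/-- The codifferential `d* = (-1)^(nk+n+1) ⋆ d ⋆` on `k`-forms, `n = m + 1`. Here `k' = n - k` and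
`l = k - 1`. -/
def codiffForm {k k' l : ℕ} (hk : k + k' = m + 1) (hl : l + 1 = k) (α : Form m M k) :
    Form m M l :=
  (-1 : ℝ) ^ ((m + 1) * k + (m + 1) + 1) •
    starPseudo g (show (k' + 1) + l = m + 1 by omega) (PseudoForm.d rfl (starForm g hk α))

/-- The codifferential `d* = (-1)^(nk+n+1) ⋆ d ⋆` on pseudo-forms of degree `k`. -/
def codiffPseudo {k k' l : ℕ} (hk : k + k' = m + 1) (hl : l + 1 = k) (τ : PseudoForm m M k) :
    PseudoForm m M l :=
  (-1 : ℝ) ^ ((m + 1) * k + (m + 1) + 1) •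
    starForm g (show (k' + 1) + l = m + 1 by omega) (Form.d rfl (starPseudo g hk τ))

/-! ### The Stokes–Dirac structures

Throughout `n = m + 1`, `p' = n - p`, `q' = n - q` and `p + q = n + 1`. Variables with a hat are
pseudo-forms. -/

variable {p p' q q' : ℕ}

/-- The canonical Stokes–Dirac structure, with `r = pq + 1`:
`f̂₁ = (-1)^r d ê₂`, `f₂ = d e₁`, `f_∂ = tr e₁`, `ê_∂ = (-1)^p tr ê₂`. -/
structure StokesDirac (hp : p + p' = m + 1) (hq : q + q' = m + 1) (hpq : p + q = m + 2)
    (fHat₁ : PseudoForm m M p) (f₂ : Form m M q) (e₁ : Form m M p') (eHat₂ : PseudoForm m M q')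
    (fBdry : BdryForm m M p') (eHatBdry : BdryPseudoForm m M q') : Prop where
  smooth_e₁ : Form.IsSmooth e₁
  smooth_eHat₂ : PseudoForm.IsSmooth eHat₂
  flow₁ : fHat₁ = (-1 : ℝ) ^ (p * q + 1) • PseudoForm.d (by omega) eHat₂
  flow₂ : f₂ = Form.d (by omega) e₁
  port_f : fBdry = Form.tr e₁
  port_e : eHatBdry = (-1 : ℝ) ^ p • PseudoForm.tr eHat₂

/-- The adjoint Stokes–Dirac structure, i.e. the image of the canonical one under the transformation
`(f₁, f̂₂) = Φ_* (f̂₁, f₂) = (⋆⁻¹ f̂₁, ⋆ f₂)`, `(e₁, ê₂) = Φ^* (ê₁, e₂) = (⋆ ê₁, ⋆⁻¹ e₂)` of flows and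
efforts induced by `Φ = diag (⋆⁻¹, ⋆)`; the boundary variables are unchanged. The relations
`f₁ = ⋆⁻¹ f̂₁` and `ê₂ = ⋆⁻¹ e₂` are written as `⋆ f₁ = f̂₁` and `⋆ ê₂ = e₂`. -/
def AdjointStokesDirac (hp : p + p' = m + 1) (hq : q + q' = m + 1) (hpq : p + q = m + 2)
    (f₁ : Form m M p') (fHat₂ : PseudoForm m M q') (eHat₁ : PseudoForm m M p) (e₂ : Form m M q)
    (fBdry : BdryForm m M p') (eHatBdry : BdryPseudoForm m M q') : Prop :=
  PseudoForm.IsSmooth eHat₁ ∧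
  ∃ (fHat₁ : PseudoForm m M p) (f₂ : Form m M q) (e₁ : Form m M p') (eHat₂ : PseudoForm m M q'),
    StokesDirac hp hq hpq fHat₁ f₂ e₁ eHat₂ fBdry eHatBdry ∧
    starForm g (by omega) f₁ = fHat₁ ∧ fHat₂ = starForm g hq f₂ ∧
    e₁ = starPseudo g hp eHat₁ ∧ starPseudo g (by omega) eHat₂ = e₂

/-- The equations of the adjoint Stokes–Dirac structure in terms of the codifferential,
`f₁ = (-1)^a₀ d* e₂`, `f̂₂ = (-1)^a₁ d* ê₁`, `f_∂ = tr ⋆ ê₁`, `ê_∂ = (-1)^(p + q(n-q)) tr ⋆ e₂`, where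
`a₀ = r + p(n-p) + q(n-q) + n(q+1) + 1`, `r = pq + 1`, `a₁ = n(p+1) + 1`. -/
structure CodiffStokesDirac (hp : p + p' = m + 1) (hq : q + q' = m + 1) (hpq : p + q = m + 2)
    (f₁ : Form m M p') (fHat₂ : PseudoForm m M q') (eHat₁ : PseudoForm m M p) (e₂ : Form m M q)
    (fBdry : BdryForm m M p') (eHatBdry : BdryPseudoForm m M q') : Prop where
  smooth_eHat₁ : PseudoForm.IsSmooth eHat₁
  smooth_e₂ : Form.IsSmooth e₂
  flow₁ : f₁ = (-1 : ℝ) ^ ((p * q + 1) + p * p' + q * q' + (m + 1) * (q + 1) + 1) •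
    codiffForm g hq (by omega) e₂
  flow₂ : fHat₂ = (-1 : ℝ) ^ ((m + 1) * (p + 1) + 1) • codiffPseudo g hp (by omega) eHat₁
  port_f : fBdry = Form.tr (starPseudo g hp eHat₁)
  port_e : eHatBdry = (-1 : ℝ) ^ (p + q * q') • PseudoForm.tr (starForm g hq e₂)

end Smooth

end Manifold

end DualField

end

open DualField
open scoped Manifold ContDiff

open Set Topology MeasureTheory
open scoped Manifold ContDiff

namespace DualField

set_option linter.unusedSectionVars false

/-! ### Shuffle algebra of the wedge product and the algebraic Leibniz rule. -/

section WedgeAlgebra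

variable {V : Type*} [AddCommGroup V] [Module ℝ V] [TopologicalSpace V]

/-! Part (a) is algebra once three facts about the Hodge star are known: `⋆⋆ = (-1)^(k(n-k))` on
forms and on pseudo-forms, `⋆` turns forms into pseudo-forms and back, and `⋆` preserves smoothness.
Applying `⋆` to the canonical relations then turns every `d` into `⋆d⋆`, and the exponents `a₀`,
`a₁` collect exactly the signs of the double stars, of `(-1)^r` and of the normalisation of `d*`.

The star is only given by its characterising property. Existence comes from an explicit component
formula (`starAux`), uniqueness from nondegeneracy of the wedge (`wedge_right_injective`); together
they give `IsInner.hodge_eq`. The double star follows from `α ∧ γ = ⟨γ, ⋆α⟩ vol`, an expansion over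
reciprocal frames. Smoothness is read off the component formula, whose entries are rational in the
Gram matrix up to one square root of a positive determinant.

For part (b), symmetry of `α ∧ ⋆β` shows that `⋆` preserves the pairing of complementary degrees
(`dualPseudoForm_star`). The balance therefore reduces to that of the canonical structure, which is
integration by parts: the Leibniz rule for `d(ê₂ ∧ e₁)` and Stokes' theorem.

Stokes' theorem `PseudoForm.integral_d` is proved from the divergence theorem on a box. In each
chart it is applied to `ρ_c η`, which yields `ρ_c dη + dρ_c ∧ η`. The second terms add up to zero
(`sum_integral_gradWedge`), because integrals of `dρ_c ∧ η` may be moved between charts and `∑ dρ_c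
= d1 = 0`. The minus sign of the lower face of the half space matches the outward vector, which
points against `∂₀`. -/

/-- The inclusion of the first `k` of `n = k + l` indices. -/
def idxL {k l n : ℕ} (h : k + l = n) (i : Fin k) : Fin n := Fin.cast h (Fin.castAdd l i)

/-- The inclusion of the last `l` of `n = k + l` indices. -/
def idxR {k l n : ℕ} (h : k + l = n) (i : Fin l) : Fin n := Fin.cast h (Fin.natAdd k i)

theorem castDeg_rfl {k : ℕ} (α : V [⋀^Fin k]→L[ℝ] ℝ) : castDeg rfl α = α := rfl

/-- Each shuffle is a coset of the block permutations, and alternatizing the product counts every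
coset `k! l!` times. Sums over the full permutation group can be reindexed freely, which shuffles do
not allow. -/
theorem wedge_apply {k l n : ℕ} (h : k + l = n)
    (α : V [⋀^Fin k]→L[ℝ] ℝ) (β : V [⋀^Fin l]→L[ℝ] ℝ) (v : Fin n → V) :
    wedge h α β v = ((k.factorial : ℝ) * l.factorial)⁻¹ *
      ∑ σ : Equiv.Perm (Fin n), (Equiv.Perm.sign σ : ℝ) *
        (α (fun i => v (σ (idxL h i))) * β (fun i => v (σ (idxR h i)))) := by
  subst h
  have h1 : (wedge rfl α β : V [⋀^Fin (k + l)]→L[ℝ] ℝ) v =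
      LinearMap.mul' ℝ ℝ ((α.toAlternatingMap.domCoprod β.toAlternatingMap)
        (v ∘ finSumFinEquiv)) := rfl
  have h2 := DFunLike.congr_fun (MultilinearMap.domCoprod_alternization_eq
    α.toAlternatingMap β.toAlternatingMap) (v ∘ finSumFinEquiv)
  rw [MultilinearMap.alternatization_apply] at h2
  have h3 := congrArg (LinearMap.mul' ℝ ℝ) h2
  simp only [map_sum, AlternatingMap.smul_apply, map_nsmul, Fintype.card_fin] at h3
  rw [← h1, nsmul_eq_mul] at h3
  have hne : ((k.factorial : ℝ) * l.factorial) ≠ 0 := by positivity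
  rw [eq_inv_mul_iff_mul_eq₀ hne]
  push_cast at h3
  rw [← h3, ← Equiv.sum_comp (Equiv.permCongr (finSumFinEquiv (m := k) (n := l)).symm)]
  refine Finset.sum_congr rfl fun σ _ => ?_
  rw [Equiv.Perm.sign_permCongr, LinearMap.map_smul_of_tower]
  rcases Int.units_eq_one_or (Equiv.Perm.sign σ) with hs | hs <;>
    simp [hs, Equiv.permCongr_apply, idxL, idxR, Function.comp_def]

theorem wedge_smul_left {k l n : ℕ} (h : k + l = n) (c : ℝ) (α : V [⋀^Fin k]→L[ℝ] ℝ)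
    (β : V [⋀^Fin l]→L[ℝ] ℝ) : wedge h (c • α) β = c • wedge h α β := by
  ext v
  simp only [wedge_apply, ContinuousAlternatingMap.smul_apply, smul_eq_mul, Finset.mul_sum]
  exact Finset.sum_congr rfl fun σ _ => by ring

theorem wedge_smul_right {k l n : ℕ} (h : k + l = n) (c : ℝ) (α : V [⋀^Fin k]→L[ℝ] ℝ)
    (β : V [⋀^Fin l]→L[ℝ] ℝ) : wedge h α (c • β) = c • wedge h α β := by
  ext v
  simp only [wedge_apply, ContinuousAlternatingMap.smul_apply, smul_eq_mul, Finset.mul_sum]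
  exact Finset.sum_congr rfl fun σ _ => by ring

theorem wedge_sum_right {ι : Type*} (s : Finset ι) {k l n : ℕ} (h : k + l = n)
    (α : V [⋀^Fin k]→L[ℝ] ℝ) (β : ι → V [⋀^Fin l]→L[ℝ] ℝ) :
    wedge h α (∑ i ∈ s, β i) = ∑ i ∈ s, wedge h α (β i) := by
  ext v
  simp only [wedge_apply, ContinuousAlternatingMap.sum_apply, Finset.mul_sum]
  rw [Finset.sum_comm]

theorem wedge_compContinuousLinearMap {W : Type*} [AddCommGroup W] [Module ℝ W]
    [TopologicalSpace W] {k l n : ℕ} (h : k + l = n) (α : V [⋀^Fin k]→L[ℝ] ℝ)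
    (β : V [⋀^Fin l]→L[ℝ] ℝ) (f : W →L[ℝ] V) :
    wedge h (α.compContinuousLinearMap f) (β.compContinuousLinearMap f) =
      (wedge h α β).compContinuousLinearMap f := by
  ext v
  simp only [wedge_apply, ContinuousAlternatingMap.compContinuousLinearMap_apply,
    Function.comp_def]

theorem finRotate_pow_val {n : ℕ} (j : ℕ) (i : Fin n) :
    ((finRotate n ^ j) i : ℕ) = (i + j) % n := by
  induction j with
  | zero => simp [Nat.mod_eq_of_lt i.2]
  | succ j ih =>
    rw [pow_succ', Equiv.Perm.mul_apply]
    obtain _ | n := n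
    · exact i.elim0
    · rw [finRotate_apply, Fin.val_add, ih]
      simp [← add_assoc, Nat.add_mod]

theorem wedge_comm {k l n : ℕ} (h : k + l = n) (h' : l + k = n) (α : V [⋀^Fin k]→L[ℝ] ℝ)
    (β : V [⋀^Fin l]→L[ℝ] ℝ) : wedge h' β α = (-1 : ℝ) ^ (k * l) • wedge h α β := by
  ext v
  rw [ContinuousAlternatingMap.smul_apply, wedge_apply, wedge_apply, smul_eq_mul, mul_left_comm,
    mul_comm (l.factorial : ℝ)]
  congr 1
  rw [Finset.mul_sum]
  -- The `l`-th power of the cyclic rotation interchanges the two blocks, so it carries one sum into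
  -- the other.
  rw [← Equiv.sum_comp (Equiv.mulRight (finRotate n ^ l)) fun σ => (-1 : ℝ) ^ (k * l) *
    ((Equiv.Perm.sign σ : ℝ) * (α (fun i => v (σ (idxL h i))) * β (fun i => v (σ (idxR h i)))))]
  refine Finset.sum_congr rfl fun σ _ => ?_
  have hL : ∀ i, (finRotate n ^ l) (idxL h i) = idxR h' i := fun i => by
    apply Fin.ext
    rw [finRotate_pow_val]
    simp only [idxL, idxR, Fin.val_cast, Fin.val_castAdd, Fin.val_natAdd]
    rw [Nat.mod_eq_of_lt (by omega), add_comm]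
  have hR : ∀ i, (finRotate n ^ l) (idxR h i) = idxL h' i := fun i => by
    apply Fin.ext
    rw [finRotate_pow_val]
    simp only [idxL, idxR, Fin.val_cast, Fin.val_castAdd, Fin.val_natAdd]
    rw [show k + (i : ℕ) + l = i + n by omega, Nat.add_mod_right, Nat.mod_eq_of_lt (by omega)]
  have hs : (Equiv.Perm.sign (finRotate n ^ l) : ℝ) = (-1 : ℝ) ^ (k * l) := by
    rw [map_pow, sign_finRotate]
    push_cast
    rw [← pow_mul]
    -- The rotation has sign `(-1)^((n-1)l)`. Apart from `l = 0`, one has `(n-1)l = kl + (l-1)l`,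
    -- and the last product is even.
    obtain _ | l := l
    · simp
    · rw [show (n - 1) * (l + 1) = k * (l + 1) + l * (l + 1) by
        rw [← h, ← add_mul]; rfl, pow_add, (Nat.even_mul_succ_self l).neg_one_pow, mul_one]
  simp only [Equiv.coe_mulRight, Equiv.Perm.mul_apply, hL, hR, Equiv.Perm.sign_mul, Units.val_mul,
    Int.cast_mul, hs]
  have : (-1 : ℝ) ^ (k * l) * (-1 : ℝ) ^ (k * l) = 1 := by
    rw [← mul_pow]; simp
  linear_combination (-(Equiv.Perm.sign σ : ℝ) * β (fun i => v (σ (idxL h' i))) *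
    α (fun i => v (σ (idxR h' i)))) * this

/-- The identification of the index set of `n = k + l` indices with a disjoint union. -/
def idxEquiv {k l n : ℕ} (h : k + l = n) : Fin k ⊕ Fin l ≃ Fin n :=
  finSumFinEquiv.trans (finCongr h)

@[simp] theorem idxEquiv_inl {k l n : ℕ} (h : k + l = n) (i : Fin k) :
    idxEquiv h (Sum.inl i) = idxL h i := by simp [idxEquiv, idxL]

@[simp] theorem idxEquiv_inr {k l n : ℕ} (h : k + l = n) (i : Fin l) :
    idxEquiv h (Sum.inr i) = idxR h i := by simp [idxEquiv, idxR]

@[simp] theorem idxEquiv_symm_idxL {k l n : ℕ} (h : k + l = n) (i : Fin k) :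
    (idxEquiv h).symm (idxL h i) = Sum.inl i := by
  rw [Equiv.symm_apply_eq, idxEquiv_inl]

@[simp] theorem idxEquiv_symm_idxR {k l n : ℕ} (h : k + l = n) (i : Fin l) :
    (idxEquiv h).symm (idxR h i) = Sum.inr i := by
  rw [Equiv.symm_apply_eq, idxEquiv_inr]

/-- The permutation of `n = k + l` indices acting separately on the first `k` and the last `l`. -/
def blockPerm {k l n : ℕ} (h : k + l = n) (ab : Equiv.Perm (Fin k) × Equiv.Perm (Fin l)) :
    Equiv.Perm (Fin n) :=
  (idxEquiv h).permCongr (Equiv.Perm.sumCongrHom _ _ ab)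

theorem blockPerm_idxL {k l n : ℕ} (h : k + l = n)
    (ab : Equiv.Perm (Fin k) × Equiv.Perm (Fin l)) (i : Fin k) :
    blockPerm h ab (idxL h i) = idxL h (ab.1 i) := by
  simp [blockPerm, Equiv.permCongr_apply]

theorem blockPerm_idxR {k l n : ℕ} (h : k + l = n)
    (ab : Equiv.Perm (Fin k) × Equiv.Perm (Fin l)) (i : Fin l) :
    blockPerm h ab (idxR h i) = idxR h (ab.2 i) := by
  simp [blockPerm, Equiv.permCongr_apply]

theorem sign_blockPerm {k l n : ℕ} (h : k + l = n)
    (ab : Equiv.Perm (Fin k) × Equiv.Perm (Fin l)) :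
    Equiv.Perm.sign (blockPerm h ab) = Equiv.Perm.sign ab.1 * Equiv.Perm.sign ab.2 := by
  simp [blockPerm, Equiv.Perm.sign_permCongr]

theorem blockPerm_injective {k l n : ℕ} (h : k + l = n) :
    Function.Injective (blockPerm (k := k) (l := l) h) :=
  (Equiv.injective _).comp Equiv.Perm.sumCongrHom_injective

/-- On a finite set a permutation that keeps the first block inside itself also keeps its
complement, hence splits into two permutations. So any other permutation moves an index across,
which later produces a repeated vector. -/
theorem mem_range_blockPerm {k l n : ℕ} (h : k + l = n) (σ : Equiv.Perm (Fin n))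
    (hσ : σ ∉ Set.range (blockPerm (k := k) (l := l) h)) : ∃ s t, σ (idxL h s) = idxR h t := by
  by_contra! hc
  apply hσ
  have h1 : Set.MapsTo ((idxEquiv h).permCongr.symm σ) (Set.range Sum.inl) (Set.range Sum.inl) := by
    rintro _ ⟨s, rfl⟩
    rcases h2 : (idxEquiv h).permCongr.symm σ (Sum.inl s) with t | t
    · exact ⟨t, rfl⟩
    · exfalso
      apply hc s t
      rw [Equiv.permCongr_symm_apply, idxEquiv_inl, Equiv.symm_apply_eq, idxEquiv_inr] at h2
      exact h2
  obtain ⟨ab, hab⟩ := Equiv.Perm.mem_sumCongrHom_range_of_perm_mapsTo_inl h1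
  exact ⟨ab, by rw [blockPerm, hab, Equiv.apply_symm_apply]⟩

theorem mem_range_blockPerm' {k l n : ℕ} (h : k + l = n) (σ : Equiv.Perm (Fin n))
    (hσ : σ ∉ Set.range (blockPerm (k := k) (l := l) h)) : ∃ s t, σ (idxR h s) = idxL h t := by
  by_contra! hc
  apply hσ
  have h1 : Set.MapsTo ((idxEquiv h).permCongr.symm σ) (Set.range Sum.inl) (Set.range Sum.inl) := by
    rw [Equiv.Perm.perm_mapsTo_inl_iff_mapsTo_inr]
    rintro _ ⟨s, rfl⟩
    rcases h2 : (idxEquiv h).permCongr.symm σ (Sum.inr s) with t | t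
    · exfalso
      apply hc s t
      rw [Equiv.permCongr_symm_apply, idxEquiv_inr, Equiv.symm_apply_eq, idxEquiv_inl] at h2
      exact h2
    · exact ⟨t, rfl⟩
  obtain ⟨ab, hab⟩ := Equiv.Perm.mem_sumCongrHom_range_of_perm_mapsTo_inl h1
  exact ⟨ab, by rw [blockPerm, hab, Equiv.apply_symm_apply]⟩

theorem map_perm_real {k : ℕ} (α : V [⋀^Fin k]→L[ℝ] ℝ) (v : Fin k → V)
    (σ : Equiv.Perm (Fin k)) : α (fun i => v (σ i)) = (Equiv.Perm.sign σ : ℝ) * α v := by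
  have := α.toAlternatingMap.map_perm v σ
  rcases Int.units_eq_one_or (Equiv.Perm.sign σ) with hs | hs <;>
    simpa [hs, Function.comp_def] using this

theorem sign_mul_self {ι : Type*} [DecidableEq ι] [Fintype ι] (σ : Equiv.Perm ι) :
    (Equiv.Perm.sign σ : ℝ) * (Equiv.Perm.sign σ : ℝ) = 1 := by
  rcases Int.units_eq_one_or (Equiv.Perm.sign σ) with hs | hs <;> simp [hs]

/-- A wedge product reduces to its leading term when the mixed terms vanish. -/
theorem wedge_apply_eq_mul {k l n : ℕ} (h : k + l = n)
    (α : V [⋀^Fin k]→L[ℝ] ℝ) (β : V [⋀^Fin l]→L[ℝ] ℝ) (v : Fin n → V)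
    (h0 : ∀ σ : Equiv.Perm (Fin n), σ ∉ Set.range (blockPerm (k := k) (l := l) h) →
      α (fun i => v (σ (idxL h i))) * β (fun i => v (σ (idxR h i))) = 0) :
    wedge h α β v = α (fun i => v (idxL h i)) * β (fun i => v (idxR h i)) := by
  have hne : ((k.factorial : ℝ) * l.factorial) ≠ 0 := by positivity
  rw [wedge_apply, inv_mul_eq_iff_eq_mul₀ hne]
  -- Only the `k! l!` block permutations survive, and each contributes the leading term because its
  -- two signs occur twice.
  rw [← Fintype.sum_of_injective (blockPerm (k := k) (l := l) h) (blockPerm_injective h)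
    (fun _ => α (fun i => v (idxL h i)) * β (fun i => v (idxR h i)))]
  · simp [Fintype.card_perm, mul_assoc]
  · intro σ hσ
    rw [h0 σ hσ, mul_zero]
  · rintro ⟨a, b⟩
    simp only [blockPerm_idxL, blockPerm_idxR, sign_blockPerm, Units.val_mul, Int.cast_mul]
    rw [map_perm_real α (fun i => v (idxL h i)), map_perm_real β (fun i => v (idxR h i))]
    have ha := sign_mul_self a
    have hb := sign_mul_self b
    linear_combination (-(α (fun i => v (idxL h i)) * β (fun i => v (idxR h i))) *
      ((Equiv.Perm.sign b : ℝ) * (Equiv.Perm.sign b : ℝ))) * ha -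
      (α (fun i => v (idxL h i)) * β (fun i => v (idxR h i))) * hb

/-- Absorbing a sum over a group of permutations into the sum over all permutations. -/
theorem sum_sum_sign_mul {ι : Type*} [DecidableEq ι] [Fintype ι] {T : Type*} [Fintype T]
    (ext : T → Equiv.Perm ι) (s : T → ℝ) (hs : ∀ τ, s τ = (Equiv.Perm.sign (ext τ) : ℝ))
    (Φ : Equiv.Perm ι → ℝ) :
    ∑ σ : Equiv.Perm ι, ∑ τ : T, (Equiv.Perm.sign σ : ℝ) * (s τ * Φ (σ * ext τ)) =
      Fintype.card T * ∑ σ : Equiv.Perm ι, (Equiv.Perm.sign σ : ℝ) * Φ σ := by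
  rw [Finset.sum_comm]
  have : ∀ τ : T, ∑ σ : Equiv.Perm ι, (Equiv.Perm.sign σ : ℝ) * (s τ * Φ (σ * ext τ)) =
      ∑ σ : Equiv.Perm ι, (Equiv.Perm.sign σ : ℝ) * Φ σ := by
    intro τ
    refine (Finset.sum_congr rfl fun σ _ => ?_).trans
      (Equiv.sum_comp (Equiv.mulRight (ext τ)) fun σ => (Equiv.Perm.sign σ : ℝ) * Φ σ)
    simp only [Equiv.coe_mulRight, hs, Equiv.Perm.sign_mul, Units.val_mul, Int.cast_mul]
    ring
  simp [this]

/-- A permutation of `k + 1` indices amounts to the image `p` of `0` and a permutation of the rest.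
The `k!` permutations with the same `p` contribute equally. This puts the alternatized derivative in
the same shape as `wedge_apply`. -/
theorem sum_removeNth_eq_sum_perm {k : ℕ} (A : V → V [⋀^Fin k]→L[ℝ] ℝ) (v : Fin (k + 1) → V) :
    ∑ i : Fin _, (-1 : ℝ) ^ (i : ℕ) * A (v i) (i.removeNth v) = ((k.factorial : ℝ))⁻¹ *
      ∑ σ : Equiv.Perm (Fin (k + 1)), (Equiv.Perm.sign σ : ℝ) *
        A (v (σ 0)) (fun i => v (σ i.succ)) := by
  have hne : (k.factorial : ℝ) ≠ 0 := by positivity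
  rw [eq_inv_mul_iff_mul_eq₀ hne, ← Equiv.sum_comp Equiv.Perm.decomposeFin.symm,
    Fintype.sum_prod_type, Finset.mul_sum]
  refine Finset.sum_congr rfl fun p _ => ?_
  have key : ∀ τ : Equiv.Perm (Fin k),
      (Equiv.Perm.sign (Equiv.Perm.decomposeFin.symm (p, τ)) : ℝ) *
        A (v (Equiv.Perm.decomposeFin.symm (p, τ) 0))
          (fun i => v (Equiv.Perm.decomposeFin.symm (p, τ) i.succ)) =
      (-1 : ℝ) ^ (p : ℕ) * A (v p) (p.removeNth v) := by
    intro τ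
    rw [Equiv.Perm.decomposeFin.symm_sign, Equiv.Perm.decomposeFin_symm_apply_zero]
    simp only [Equiv.Perm.decomposeFin_symm_apply_succ]
    rw [map_perm_real (A (v p)) (fun i => v (Equiv.swap 0 p i.succ))]
    have hτ := sign_mul_self τ
    refine Fin.cases ?_ (fun q => ?_) p
    · simp only [Equiv.swap_self, Equiv.refl_apply, if_true, Fin.val_zero, pow_zero, one_mul]
      rw [← mul_assoc, hτ, one_mul]
      rfl
    -- Swapping `0` and `q + 1` lists the remaining vectors in the order of `removeNth` up to a
    -- cycle of sign `(-1)^q`; the swap supplies the missing `-1`.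
    · have h1 : (fun i : Fin k => v (Equiv.swap 0 q.succ i.succ)) =
          fun i => (q.succ.removeNth v) (q.cycleRange i) := by
        funext i
        rw [Fin.removeNth, Fin.succAbove_cycleRange]
      rw [h1, map_perm_real, Fin.sign_cycleRange, if_neg (Fin.succ_ne_zero q)]
      push_cast
      rw [Fin.val_succ, pow_succ]
      linear_combination (-1 : ℝ) ^ (q : ℕ) * (-A (v q.succ) (q.succ.removeNth v)) * hτ
  simp only [key, Finset.sum_const, Finset.card_univ, Fintype.card_perm, Fintype.card_fin,
    nsmul_eq_mul]

/-- The Leibniz rule for the alternatization of the derivative of a wedge product, first factor. -/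
theorem sum_removeNth_wedge_left {k l n : ℕ} (h : k + l = n) (h' : k + 1 + l = n + 1)
    (A : V → V [⋀^Fin k]→L[ℝ] ℝ) (β : V [⋀^Fin l]→L[ℝ] ℝ) (DA : V [⋀^Fin (k + 1)]→L[ℝ] ℝ)
    (hDA : ∀ v, DA v = ∑ i : Fin _, (-1 : ℝ) ^ (i : ℕ) * A (v i) (i.removeNth v)) (v : Fin (n + 1) → V) :
    ∑ i : Fin _, (-1 : ℝ) ^ (i : ℕ) * wedge h (A (v i)) β (i.removeNth v) = wedge h' DA β v := by
  set Φ : Equiv.Perm (Fin (n + 1)) → ℝ := fun σ =>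
    A (v (σ 0)) (fun i => v (σ (idxL h i).succ)) * β (fun i => v (σ (idxR h i).succ)) with hΦ
  have e0 : idxL h' 0 = 0 := by apply Fin.ext; simp [idxL]
  have eL : ∀ i : Fin k, idxL h' i.succ = (idxL h i).succ := fun i => by
    apply Fin.ext; simp [idxL]
  have eR : ∀ i : Fin l, idxR h' i = (idxR h i).succ := fun i => by
    apply Fin.ext; simp [idxR]; omega
  have hl := sum_removeNth_eq_sum_perm (fun w => wedge h (A w) β) v
  rw [hl, wedge_apply]
  simp only [hDA, sum_removeNth_eq_sum_perm, wedge_apply]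
  -- Both sides are double sums of the same summand: on the left the inner permutations fix `0`, on
  -- the right they act on the first `k + 1` indices. Each inner sum is absorbed into the outer one.
  have h1 := sum_sum_sign_mul (fun τ : Equiv.Perm (Fin n) => Equiv.Perm.decomposeFin.symm (0, τ))
    (fun τ => (Equiv.Perm.sign τ : ℝ))
    (fun τ => by simp [Equiv.Perm.decomposeFin.symm_sign]) Φ
  have h2 := sum_sum_sign_mul (fun τ : Equiv.Perm (Fin (k + 1)) => blockPerm h' (τ, 1))
    (fun τ => (Equiv.Perm.sign τ : ℝ))
    (fun τ => by simp [sign_blockPerm]) Φ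
  simp only [hΦ, Equiv.Perm.mul_apply, Equiv.Perm.decomposeFin_symm_apply_zero,
    Equiv.Perm.decomposeFin_symm_apply_succ, Equiv.swap_self, Equiv.refl_apply] at h1
  simp only [hΦ, Equiv.Perm.mul_apply, ← e0, ← eL, ← eR, blockPerm_idxL, blockPerm_idxR,
    Equiv.Perm.one_apply] at h2
  simp only [e0, eL, eR] at h2
  have hn : (n.factorial : ℝ) ≠ 0 := by positivity
  have hk : (k.factorial : ℝ) ≠ 0 := by positivity
  have hk1 : ((k + 1).factorial : ℝ) ≠ 0 := by positivity
  have hl : (l.factorial : ℝ) ≠ 0 := by positivity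
  rw [Fintype.card_perm, Fintype.card_fin] at h1 h2
  simp only [eR]
  calc _ = (n.factorial : ℝ)⁻¹ * ((k.factorial : ℝ) * l.factorial)⁻¹ *
        ∑ σ : Equiv.Perm (Fin (n + 1)), ∑ τ : Equiv.Perm (Fin n), (Equiv.Perm.sign σ : ℝ) *
        ((Equiv.Perm.sign τ : ℝ) * (A (v (σ 0)) (fun i => v (σ (τ (idxL h i)).succ)) *
          β (fun i => v (σ (τ (idxR h i)).succ)))) := by
        simp only [Finset.mul_sum]
        refine Finset.sum_congr rfl fun σ _ => Finset.sum_congr rfl fun τ _ => by ring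
    _ = ((k + 1).factorial * l.factorial : ℝ)⁻¹ * (k.factorial : ℝ)⁻¹ *
        ∑ σ : Equiv.Perm (Fin (n + 1)), ∑ τ : Equiv.Perm (Fin (k + 1)), (Equiv.Perm.sign σ : ℝ) *
        ((Equiv.Perm.sign τ : ℝ) * (A (v (σ (idxL h' (τ 0)))) (fun i => v (σ (idxL h' (τ i.succ)))) *
          β (fun i => v (σ (idxR h i).succ)))) := by
        rw [h1, h2]; field_simp
    _ = _ := by
        simp only [Finset.mul_sum, Finset.sum_mul]
        refine Finset.sum_congr rfl fun σ _ => Finset.sum_congr rfl fun τ _ => by ring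

/-- The Leibniz rule for the alternatization of the derivative of a wedge product, second factor. -/
theorem sum_removeNth_wedge_right {k l n : ℕ} (h : k + l = n) (h' : k + (l + 1) = n + 1)
    (α : V [⋀^Fin k]→L[ℝ] ℝ) (B : V → V [⋀^Fin l]→L[ℝ] ℝ) (DB : V [⋀^Fin (l + 1)]→L[ℝ] ℝ)
    (hDB : ∀ v, DB v = ∑ i : Fin _, (-1 : ℝ) ^ (i : ℕ) * B (v i) (i.removeNth v)) (v : Fin (n + 1) → V) :
    ∑ i : Fin _, (-1 : ℝ) ^ (i : ℕ) * wedge h α (B (v i)) (i.removeNth v) =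
      (-1 : ℝ) ^ k * wedge h' α DB v := by
  -- Commuting the factors before and after costs `(-1)^(kl)` and `(-1)^(k(l+1))`, which differ by
  -- `(-1)^k`.
  have h1 := sum_removeNth_wedge_left (show l + k = n by omega) (by omega) B α DB hDB v
  rw [wedge_comm h' (by omega) α DB, ContinuousAlternatingMap.smul_apply, smul_eq_mul] at h1
  simp only [wedge_comm h (show l + k = n by omega), ContinuousAlternatingMap.smul_apply,
    smul_eq_mul, mul_left_comm _ ((-1 : ℝ) ^ (k * l)), ← Finset.mul_sum] at h1
  have h2 : (-1 : ℝ) ^ (k * l) ≠ 0 := pow_ne_zero _ (by norm_num)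
  apply mul_left_cancel₀ h2
  rw [h1, ← mul_assoc, ← pow_add]
  ring_nf

end WedgeAlgebra

/-! ### Concatenation of index tuples. -/

section Combine

/-- The concatenation of `k` and `l` entries to a tuple of `n = k + l` entries. -/
def combine {X : Type*} {k l n : ℕ} (h : k + l = n) (u : Fin k → X) (w : Fin l → X) : Fin n → X :=
  fun i => Sum.elim u w ((idxEquiv h).symm i)

variable {X : Type*} {k l n : ℕ} (h : k + l = n) (u : Fin k → X) (w : Fin l → X)

@[simp] theorem combine_idxL (i : Fin k) : combine h u w (idxL h i) = u i := by simp [combine]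

@[simp] theorem combine_idxR (i : Fin l) : combine h u w (idxR h i) = w i := by simp [combine]

theorem combine_self (v : Fin n → X) :
    combine h (fun i => v (idxL h i)) (fun i => v (idxR h i)) = v := by
  funext i
  obtain ⟨j, rfl⟩ := (idxEquiv h).surjective i
  rcases j with j | j <;> simp

theorem comp_combine {Y : Type*} (f : X → Y) :
    (fun i => f (combine h u w i)) = combine h (fun i => f (u i)) (fun i => f (w i)) := by
  funext i
  obtain ⟨j, rfl⟩ := (idxEquiv h).surjective i
  rcases j with j | j <;> simp

theorem combine_update_right (i : Fin l) (x : X) :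
    combine h u (Function.update w i x) = Function.update (combine h u w) (idxR h i) x := by
  funext a
  obtain ⟨j, rfl⟩ := (idxEquiv h).surjective a
  rcases j with j | j
  · have : idxL h j ≠ idxR h i := fun hh => by
      simpa using congrArg (idxEquiv h).symm hh
    simp [this]
  · by_cases hij : j = i
    · subst hij; simp
    · have : idxR h j ≠ idxR h i := fun hh => hij (by
        simpa using congrArg (idxEquiv h).symm hh)
      simp [this, hij]

theorem combine_update_left (i : Fin k) (x : X) :
    combine h (Function.update u i x) w = Function.update (combine h u w) (idxL h i) x := by
  funext a
  obtain ⟨j, rfl⟩ := (idxEquiv h).surjective a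
  rcases j with j | j
  · by_cases hij : j = i
    · subst hij; simp
    · have : idxL h j ≠ idxL h i := fun hh => hij (by
        simpa using congrArg (idxEquiv h).symm hh)
      simp [this, hij]
  · have : idxR h j ≠ idxL h i := fun hh => by
      simpa using congrArg (idxEquiv h).symm hh
    simp [this]

theorem idxL_injective : Function.Injective (idxL (k := k) (l := l) h) := fun i j hij => by
  simpa using congrArg (idxEquiv h).symm hij

theorem idxR_injective : Function.Injective (idxR (k := k) (l := l) h) := fun i j hij => by
  simpa using congrArg (idxEquiv h).symm hij

theorem idxL_ne_idxR (i : Fin k) (j : Fin l) : idxL h i ≠ idxR h j := fun hij => by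
  simpa using congrArg (idxEquiv h).symm hij

/-- The concatenation of index tuples as an equivalence. -/
def combineEquiv (X : Type*) : (Fin k → X) × (Fin l → X) ≃ (Fin n → X) where
  toFun p := combine h p.1 p.2
  invFun f := (fun i => f (idxL h i), fun i => f (idxR h i))
  left_inv p := by simp
  right_inv f := combine_self h f

/-- A bijection between subsets of a finite set extends to the whole set. It serves to complete an
injective multi-index to a reordering of a basis. -/
theorem exists_perm_extend {ι κ : Type*} [Fintype κ] [DecidableEq κ] (f g : ι → κ)
    (hf : Function.Injective f) (hg : Function.Injective g) :
    ∃ ρ : Equiv.Perm κ, ∀ i, ρ (f i) = g i := by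
  classical
  refine ⟨((Equiv.ofInjective f hf).symm.trans (Equiv.ofInjective g hg)).extendSubtype,
    fun i => ?_⟩
  rw [Equiv.extendSubtype_apply_of_mem _ _ ⟨i, rfl⟩]
  simp

end Combine

/-! ### Contractions of top forms, nondegeneracy of the wedge, and the inner product of forms. -/

section Hodge

variable {V : Type*} [AddCommGroup V] [Module ℝ V] [TopologicalSpace V]

/-- The form `w ↦ η (u, w)`. -/
def fillLeft {k l n : ℕ} (h : k + l = n) (η : V [⋀^Fin n]→L[ℝ] ℝ) (u : Fin k → V) :
    V [⋀^Fin l]→L[ℝ] ℝ where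
  toFun w := η (combine h u w)
  map_update_add' := by
    intro hd w i x y
    rw [Subsingleton.elim hd (instDecidableEqFin l)]
    simp only [combine_update_right, ContinuousAlternatingMap.map_update_add]
  map_update_smul' := by
    intro hd w i c x
    rw [Subsingleton.elim hd (instDecidableEqFin l)]
    simp only [combine_update_right, ContinuousAlternatingMap.map_update_smul]
  map_eq_zero_of_eq' := by
    intro w i j hij hne
    refine η.map_eq_zero_of_eq (combine h u w) (i := idxR h i) (j := idxR h j) (by simpa) ?_
    exact fun hh => hne (idxR_injective h hh)
  cont := by
    refine η.cont.comp (continuous_pi fun i => ?_)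
    obtain ⟨j, rfl⟩ := (idxEquiv h).surjective i
    rcases j with j | j
    · simpa using continuous_const
    · simpa using continuous_apply j

/-- The form `u ↦ η (u, w)`. -/
def fillRight {k l n : ℕ} (h : k + l = n) (η : V [⋀^Fin n]→L[ℝ] ℝ) (w : Fin l → V) :
    V [⋀^Fin k]→L[ℝ] ℝ where
  toFun u := η (combine h u w)
  map_update_add' := by
    intro hd u i x y
    rw [Subsingleton.elim hd (instDecidableEqFin k)]
    simp only [combine_update_left, ContinuousAlternatingMap.map_update_add]
  map_update_smul' := by
    intro hd u i c x
    rw [Subsingleton.elim hd (instDecidableEqFin k)]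
    simp only [combine_update_left, ContinuousAlternatingMap.map_update_smul]
  map_eq_zero_of_eq' := by
    intro u i j hij hne
    refine η.map_eq_zero_of_eq (combine h u w) (i := idxL h i) (j := idxL h j) (by simpa) ?_
    exact fun hh => hne (idxL_injective h hh)
  cont := by
    refine η.cont.comp (continuous_pi fun i => ?_)
    obtain ⟨j, rfl⟩ := (idxEquiv h).surjective i
    rcases j with j | j
    · simpa using continuous_apply j
    · simpa using continuous_const

@[simp] theorem fillLeft_apply {k l n : ℕ} (h : k + l = n) (η : V [⋀^Fin n]→L[ℝ] ℝ)
    (u : Fin k → V) (w : Fin l → V) : fillLeft h η u w = η (combine h u w) := rfl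

@[simp] theorem fillRight_apply {k l n : ℕ} (h : k + l = n) (η : V [⋀^Fin n]→L[ℝ] ℝ)
    (u : Fin k → V) (w : Fin l → V) : fillRight h η w u = η (combine h u w) := rfl

theorem form_ext_basis {ι : Type*} {k : ℕ} (b : Module.Basis ι ℝ V)
    {α β : V [⋀^Fin k]→L[ℝ] ℝ}
    (h : ∀ i : Fin k → ι, α (fun s => b (i s)) = β (fun s => b (i s))) : α = β := by
  apply ContinuousAlternatingMap.toAlternatingMap_injective
  exact Module.Basis.ext_alternating b fun i _ => h i

/-- Every alternating form of top degree is a multiple of the determinant of the basis. -/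
theorem topForm_ext {n : ℕ} (b : Module.Basis (Fin n) ℝ V) {α β : V [⋀^Fin n]→L[ℝ] ℝ}
    (h : α b = β b) : α = β := by
  apply ContinuousAlternatingMap.toAlternatingMap_injective
  rw [α.toAlternatingMap.eq_smul_basis_det b, β.toAlternatingMap.eq_smul_basis_det b]
  change α b • _ = β b • _
  rw [h]

/-- `α ∧ η (u, ·) = α (u) η` for a form `η` of top degree. -/
theorem wedge_fillLeft {k l n : ℕ} (h : k + l = n) (b : Module.Basis (Fin n) ℝ V)
    (α : V [⋀^Fin k]→L[ℝ] ℝ) (η : V [⋀^Fin n]→L[ℝ] ℝ) (i : Fin k → Fin n) :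
    wedge h α (fillLeft h η fun s => b (i s)) = α (fun s => b (i s)) • η := by
  by_cases hi : Function.Injective i
  -- Test on the basis reordered so that the chosen vectors come first: every mixed term then
  -- repeats one of them inside `η`.
  · obtain ⟨ρ, hρ⟩ := exists_perm_extend (idxL h) i (idxL_injective h) hi
    apply topForm_ext (b.reindex ρ.symm)
    simp only [← hρ]
    rw [wedge_apply_eq_mul, ContinuousAlternatingMap.smul_apply, fillLeft_apply]
    · simp only [Module.Basis.coe_reindex, Equiv.symm_symm, Function.comp_apply]
      rw [combine_self h fun a => b (ρ a), smul_eq_mul]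
      rfl
    · intro σ hσ
      obtain ⟨s, t, hst⟩ := mem_range_blockPerm' h σ hσ
      rw [fillLeft_apply, η.map_eq_zero_of_eq _ (i := idxR h s) (j := idxL h t) _
        (idxL_ne_idxR h t s).symm, mul_zero]
      simp [hst]
  · obtain ⟨s, t, hst, hne⟩ : ∃ s t, i s = i t ∧ s ≠ t := by
      simpa [Function.Injective] using hi
    rw [α.map_eq_zero_of_eq _ (i := s) (j := t) (by rw [hst]) hne, zero_smul]
    have : fillLeft h η (fun s => b (i s)) = 0 := by
      ext w
      exact η.map_eq_zero_of_eq _ (i := idxL h s) (j := idxL h t) (by simp [hst])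
        fun hh => hne (idxL_injective h hh)
    rw [this, ← zero_smul ℝ (0 : V [⋀^Fin l]→L[ℝ] ℝ), wedge_smul_right, zero_smul]

/-- `η (·, w) ∧ γ = γ (w) η` for a form `η` of top degree. -/
theorem fillRight_wedge {k l n : ℕ} (h : k + l = n) (b : Module.Basis (Fin n) ℝ V)
    (γ : V [⋀^Fin l]→L[ℝ] ℝ) (η : V [⋀^Fin n]→L[ℝ] ℝ) (j : Fin l → Fin n) :
    wedge h (fillRight h η fun s => b (j s)) γ = γ (fun s => b (j s)) • η := by
  by_cases hi : Function.Injective j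
  · obtain ⟨ρ, hρ⟩ := exists_perm_extend (idxR h) j (idxR_injective h) hi
    apply topForm_ext (b.reindex ρ.symm)
    simp only [← hρ]
    rw [wedge_apply_eq_mul, ContinuousAlternatingMap.smul_apply, fillRight_apply]
    · simp only [Module.Basis.coe_reindex, Equiv.symm_symm, Function.comp_apply]
      rw [combine_self h fun a => b (ρ a), smul_eq_mul, mul_comm]
      rfl
    · intro σ hσ
      obtain ⟨s, t, hst⟩ := mem_range_blockPerm h σ hσ
      rw [fillRight_apply, η.map_eq_zero_of_eq _ (i := idxL h s) (j := idxR h t) _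
        (idxL_ne_idxR h s t), zero_mul]
      simp [hst]
  · obtain ⟨s, t, hst, hne⟩ : ∃ s t, j s = j t ∧ s ≠ t := by
      simpa [Function.Injective] using hi
    rw [γ.map_eq_zero_of_eq _ (i := s) (j := t) (by rw [hst]) hne, zero_smul]
    have : fillRight h η (fun s => b (j s)) = 0 := by
      ext w
      exact η.map_eq_zero_of_eq _ (i := idxR h s) (j := idxR h t) (by simp [hst])
        fun hh => hne (idxR_injective h hh)
    rw [this, ← zero_smul ℝ (0 : V [⋀^Fin k]→L[ℝ] ℝ), wedge_smul_left, zero_smul]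

/-- The wedge product is nondegenerate. -/
theorem wedge_right_injective {k l n : ℕ} (h : k + l = n) (b : Module.Basis (Fin n) ℝ V)
    (η : V [⋀^Fin n]→L[ℝ] ℝ) (hη : η b ≠ 0) {γ γ' : V [⋀^Fin l]→L[ℝ] ℝ}
    (hγ : ∀ α : V [⋀^Fin k]→L[ℝ] ℝ, wedge h α γ = wedge h α γ') : γ = γ' := by
  refine form_ext_basis b fun j => ?_
  -- The test form `η (·, b_j)` reads off the component of `γ` at `j`.
  have h1 := hγ (fillRight h η fun s => b (j s))
  rw [fillRight_wedge, fillRight_wedge] at h1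
  have h2 := DFunLike.congr_fun h1 (b : Fin n → V)
  simpa [hη] using h2

theorem map_sum_smul_basis {k n : ℕ} (β : V [⋀^Fin k]→L[ℝ] ℝ) (c : Fin k → Fin n → ℝ)
    (b : Fin n → V) :
    β (fun s => ∑ j, c s j • b j) =
      ∑ j : Fin k → Fin n, (∏ s, c s (j s)) * β (fun s => b (j s)) := by
  have h1 := β.toMultilinearMap.map_sum (fun s j => c s j • b j)
  refine h1.trans (Finset.sum_congr rfl fun j _ => ?_)
  exact β.toMultilinearMap.map_smul_univ (fun s => c s (j s)) (fun s => b (j s))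

/-- The reciprocal family of a basis. -/
noncomputable def recip {n : ℕ} (G : V →L[ℝ] V →L[ℝ] ℝ) (b : Fin n → V) (i : Fin n) : V :=
  ∑ j, (Matrix.of fun a c => G (b a) (b c))⁻¹ i j • b j

/-- Multilinearity absorbs the inverse Gram entries into the arguments of `β`, leaving one sum over
dual frames instead of a double sum. -/
theorem formInner_eq_recip {n k : ℕ} (G : V →L[ℝ] V →L[ℝ] ℝ) (b : Fin n → V)
    (α β : V [⋀^Fin k]→L[ℝ] ℝ) :
    formInner G b α β = ((k.factorial : ℝ))⁻¹ *
      ∑ i : Fin k → Fin n, α (fun s => b (i s)) * β (fun s => recip G b (i s)) := by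
  unfold formInner recip
  congr 1
  refine Finset.sum_congr rfl fun i _ => ?_
  rw [map_sum_smul_basis β (fun s j => (Matrix.of fun a c => G (b a) (b c))⁻¹ (i s) j),
    Finset.mul_sum]
  refine Finset.sum_congr rfl fun j _ => ?_
  simp only [Function.comp_def]
  ring

theorem formInner_smul_right {n k : ℕ} (G : V →L[ℝ] V →L[ℝ] ℝ) (b : Fin n → V) (c : ℝ)
    (α β : V [⋀^Fin k]→L[ℝ] ℝ) : formInner G b α (c • β) = c * formInner G b α β := by
  simp only [formInner, ContinuousAlternatingMap.smul_apply, smul_eq_mul, Finset.mul_sum]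
  exact Finset.sum_congr rfl fun i _ => Finset.sum_congr rfl fun j _ => by ring

theorem formInner_smul_left {n k : ℕ} (G : V →L[ℝ] V →L[ℝ] ℝ) (b : Fin n → V) (c : ℝ)
    (α β : V [⋀^Fin k]→L[ℝ] ℝ) : formInner G b (c • α) β = c * formInner G b α β := by
  simp only [formInner, ContinuousAlternatingMap.smul_apply, smul_eq_mul, Finset.mul_sum]
  exact Finset.sum_congr rfl fun i _ => Finset.sum_congr rfl fun j _ => by ring

/-- `G` is an inner product. -/
structure IsInner (G : V →L[ℝ] V →L[ℝ] ℝ) : Prop where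
  symm : ∀ v w, G v w = G w v
  pos : ∀ v, v ≠ 0 → 0 < G v v

/-- The quadratic form of the Gram matrix at `x` is `G v v` for `v = ∑ xᵢ bᵢ`, and `v ≠ 0` when `x ≠
0`. -/
theorem IsInner.gram_det_pos {n : ℕ} {G : V →L[ℝ] V →L[ℝ] ℝ} (hG : IsInner G)
    (b : Module.Basis (Fin n) ℝ V) : 0 < (Matrix.of fun i j => G (b i) (b j)).det := by
  apply Matrix.PosDef.det_pos
  refine Matrix.PosDef.of_dotProduct_mulVec_pos ?_ fun x hx => ?_
  · ext i j
    simp [hG.symm (b j) (b i)]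
  · have h1 : (∑ i, x i • b i) ≠ 0 := fun h0 => hx (by
      funext i
      have := congrArg (fun v => b.repr v i) h0
      simpa [Finsupp.single_apply] using this)
    have h2 := hG.pos _ h1
    simp only [map_sum, map_smul, sum_apply, smul_apply, smul_eq_mul] at h2
    refine h2.trans_eq ?_
    simp only [dotProduct, Matrix.mulVec, Finset.mul_sum, Matrix.of_apply, star_trivial]
    rw [Finset.sum_comm]
    exact Finset.sum_congr rfl fun i _ => Finset.sum_congr rfl fun j _ => by ring

theorem IsInner.ext_basis {n : ℕ} {G : V →L[ℝ] V →L[ℝ] ℝ} (hG : IsInner G)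
    (b : Module.Basis (Fin n) ℝ V) {u v : V} (h : ∀ i, G u (b i) = G v (b i)) : u = v := by
  by_contra hne
  have h1 : ∀ w, G (u - v) w = 0 := fun w => by
    rw [← b.sum_repr w]
    simp only [map_sum, map_smul, map_sub, sub_apply, h, sub_self, smul_zero, Finset.sum_const_zero]
  exact (hG.pos _ (sub_ne_zero.2 hne)).ne' (h1 _)

theorem IsInner.inner_recip {n : ℕ} {G : V →L[ℝ] V →L[ℝ] ℝ} (hG : IsInner G)
    (b : Module.Basis (Fin n) ℝ V) (i j : Fin n) :
    G (b i) (recip G b j) = if i = j then 1 else 0 := by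
  have hu : IsUnit (Matrix.of fun i j => G (b i) (b j)).det :=
    (hG.gram_det_pos b).ne'.isUnit
  have h1 := congrFun (congrFun (Matrix.nonsing_inv_mul _ hu) j) i
  rw [Matrix.mul_apply, Matrix.one_apply] at h1
  simp only [recip, map_sum, map_smul, smul_eq_mul]
  rw [← ite_congr (propext eq_comm) (fun _ => rfl) (fun _ => rfl), ← h1]
  exact Finset.sum_congr rfl fun c _ => by rw [hG.symm (b i)]; rfl

theorem IsInner.sum_inner_recip_smul {n : ℕ} {G : V →L[ℝ] V →L[ℝ] ℝ} (hG : IsInner G)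
    (b : Module.Basis (Fin n) ℝ V) (v : V) : ∑ j, G v (recip G b j) • b j = v := by
  conv_rhs => rw [← b.sum_repr v]
  refine Finset.sum_congr rfl fun j _ => ?_
  congr 1
  conv_lhs => rw [← b.sum_repr v]
  simp only [map_sum, map_smul, sum_apply, smul_apply, hG.inner_recip]
  simp

theorem IsInner.sum_inner_smul_recip {n : ℕ} {G : V →L[ℝ] V →L[ℝ] ℝ} (hG : IsInner G)
    (b : Module.Basis (Fin n) ℝ V) (v : V) : ∑ j, G v (b j) • recip G b j = v := by
  refine hG.ext_basis b fun i => ?_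
  simp [hG.symm _ (b i), hG.inner_recip]

theorem IsInner.formInner_comm {n k : ℕ} {G : V →L[ℝ] V →L[ℝ] ℝ} (hG : IsInner G)
    (b : Fin n → V) (α β : V [⋀^Fin k]→L[ℝ] ℝ) : formInner G b α β = formInner G b β α := by
  have hs : ∀ i j, (Matrix.of fun a c => G (b a) (b c))⁻¹ i j =
      (Matrix.of fun a c => G (b a) (b c))⁻¹ j i := by
    intro i j
    have : (Matrix.of fun a c => G (b a) (b c)).transpose = Matrix.of fun a c => G (b a) (b c) := by
      ext i j
      exact hG.symm _ _
    conv_lhs => rw [← this, ← Matrix.transpose_nonsing_inv]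
    rfl
  unfold formInner
  rw [Finset.sum_comm]
  congr 1
  refine Finset.sum_congr rfl fun i _ => Finset.sum_congr rfl fun j _ => ?_
  rw [Finset.prod_congr rfl fun s _ => hs (j s) (i s)]
  ring

/-- The inner product of forms does not depend on the basis. -/
theorem IsInner.formInner_eq {n k : ℕ} {G : V →L[ℝ] V →L[ℝ] ℝ} (hG : IsInner G)
    (b b' : Module.Basis (Fin n) ℝ V) (α β : V [⋀^Fin k]→L[ℝ] ℝ) :
    formInner G b α β = formInner G b' α β := by
  rw [formInner_eq_recip, formInner_eq_recip]
  congr 1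
  have hP : ∀ a, b' a = ∑ i, G (b' a) (recip G b i) • b i := fun a =>
    (hG.sum_inner_recip_smul b _).symm
  have hQ : ∀ a, recip G b' a = ∑ j, G (recip G b' a) (b j) • recip G b j := fun a =>
    (hG.sum_inner_smul_recip b _).symm
  -- Frame and reciprocal frame transform contragrediently, so the two transition matrices contract
  -- to the identity.
  have hPQ : ∀ i j, ∑ a, G (b' a) (recip G b i) * G (recip G b' a) (b j) =
      if i = j then 1 else 0 := by
    intro i j
    have h1 := hG.inner_recip b j i
    rw [← hG.sum_inner_recip_smul b' (b j)] at h1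
    simp only [map_sum, map_smul, sum_apply, smul_apply, smul_eq_mul] at h1
    rw [← ite_congr (propext eq_comm) (fun _ => rfl) (fun _ => rfl), ← h1]
    exact Finset.sum_congr rfl fun a _ => by rw [hG.symm (b j), mul_comm]
  symm
  calc ∑ a : Fin k → Fin n, α (fun s => b' (a s)) * β (fun s => recip G b' (a s))
      = ∑ a : Fin k → Fin n, ∑ i : Fin k → Fin n, ∑ j : Fin k → Fin n,
          (∏ s, G (b' (a s)) (recip G b (i s)) * G (recip G b' (a s)) (b (j s))) *
            (α (fun s => b (i s)) * β (fun s => recip G b (j s))) := by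
        refine Finset.sum_congr rfl fun a _ => ?_
        rw [show (fun s => b' (a s)) = fun s => ∑ i, G (b' (a s)) (recip G b i) • b i from
          funext fun s => hP _, show (fun s => recip G b' (a s)) =
          fun s => ∑ j, G (recip G b' (a s)) (b j) • recip G b j from funext fun s => hQ _,
          map_sum_smul_basis α (fun s i => G (b' (a s)) (recip G b i)),
          map_sum_smul_basis β (fun s j => G (recip G b' (a s)) (b j)), Finset.sum_mul_sum]
        refine Finset.sum_congr rfl fun i _ => Finset.sum_congr rfl fun j _ => ?_
        rw [Finset.prod_mul_distrib]
        ring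
    _ = ∑ i : Fin k → Fin n, ∑ j : Fin k → Fin n, (∑ a : Fin k → Fin n,
          ∏ s, G (b' (a s)) (recip G b (i s)) * G (recip G b' (a s)) (b (j s))) *
            (α (fun s => b (i s)) * β (fun s => recip G b (j s))) := by
        rw [Finset.sum_comm]
        refine Finset.sum_congr rfl fun i _ => ?_
        rw [Finset.sum_comm]
        exact Finset.sum_congr rfl fun j _ => by rw [Finset.sum_mul]
    _ = ∑ i : Fin k → Fin n, ∑ j : Fin k → Fin n, (if i = j then 1 else 0) *
            (α (fun s => b (i s)) * β (fun s => recip G b (j s))) := by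
        refine Finset.sum_congr rfl fun i _ => Finset.sum_congr rfl fun j _ => ?_
        congr 1
        -- The sum over multi-indices of a product over slots is a product of single sums, each a
        -- Kronecker delta.
        rw [← Fintype.piFinset_univ, ← Finset.prod_univ_sum (fun _ => Finset.univ)
          fun s a => G (b' a) (recip G b (i s)) * G (recip G b' a) (b (j s))]
        simp only [hPQ]
        by_cases hij : i = j
        · simp [hij]
        · obtain ⟨s, hs⟩ := Function.ne_iff.1 hij
          rw [if_neg hij]
          exact Finset.prod_eq_zero (Finset.mem_univ s) (by simp [hs])
    _ = _ := by simp

end Hodge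

/-! ### The pointwise Hodge star: existence, uniqueness, orientation and double star. -/

section HodgeStar

variable {V : Type*} [AddCommGroup V] [Module ℝ V] [TopologicalSpace V]

theorem volForm_apply {n : ℕ} (G : V →L[ℝ] V →L[ℝ] ℝ) (e v : Fin n → V) :
    volForm G e v = (√(Matrix.of fun i j => G (e i) (e j)).det)⁻¹ *
      (Matrix.of fun j i => G (e i) (v j)).det := rfl

theorem IsInner.volForm_basis {n : ℕ} {G : V →L[ℝ] V →L[ℝ] ℝ} (hG : IsInner G)
    (b : Module.Basis (Fin n) ℝ V) :
    volForm G b b = √(Matrix.of fun i j => G (b i) (b j)).det := by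
  have h := hG.gram_det_pos b
  rw [volForm_apply, inv_mul_eq_iff_eq_mul₀ (Real.sqrt_pos.2 h).ne', Real.mul_self_sqrt h.le,
    ← Matrix.det_transpose]
  rfl

theorem IsInner.volForm_basis_ne_zero {n : ℕ} {G : V →L[ℝ] V →L[ℝ] ℝ} (hG : IsInner G)
    (b : Module.Basis (Fin n) ℝ V) : volForm G b b ≠ 0 := by
  rw [hG.volForm_basis]
  exact (Real.sqrt_pos.2 (hG.gram_det_pos b)).ne'

/-- The matrix pairing a basis with its reciprocal is the identity, so only the factor `1 / √det`
remains. This fixes the normalisation in the double star. -/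
theorem IsInner.volForm_recip_mul {n : ℕ} {G : V →L[ℝ] V →L[ℝ] ℝ} (hG : IsInner G)
    (b : Module.Basis (Fin n) ℝ V) : volForm G b (recip G b) * volForm G b b = 1 := by
  have h := hG.gram_det_pos b
  have h1 : (Matrix.of fun j i => G (b i) (recip G b j)) = 1 := by
    ext i j
    rw [Matrix.of_apply, hG.inner_recip, Matrix.one_apply]
    exact if_congr eq_comm rfl rfl
  rw [hG.volForm_basis, volForm_apply, h1, Matrix.det_one, mul_one,
    inv_mul_cancel₀ (Real.sqrt_pos.2 h).ne']

/-- The numerator scales by `det A` and the Gram determinant by its square, so the quotient scales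
by `det A / |det A|`. For singular `A` both sides vanish. -/
theorem volForm_map_basis {n : ℕ} (G : V →L[ℝ] V →L[ℝ] ℝ) (b : Module.Basis (Fin n) ℝ V)
    (A : V →ₗ[ℝ] V) :
    volForm G (fun i => A (b i)) = Real.sign (LinearMap.det A) • volForm G b := by
  have hA : ∀ i, A (b i) = ∑ k, LinearMap.toMatrix b b A k i • b k := fun i => by
    conv_lhs => rw [← b.sum_repr (A (b i))]
    simp [LinearMap.toMatrix_apply]
  have hv : ∀ v : Fin n → V, (Matrix.of fun j i => G (A (b i)) (v j)).det =
      LinearMap.det A * (Matrix.of fun j i => G (b i) (v j)).det := by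
    intro v
    rw [← LinearMap.det_toMatrix b, mul_comm, ← Matrix.det_mul]
    congr 1
    ext j i
    simp only [Matrix.of_apply, Matrix.mul_apply, hA i, map_sum, map_smul, sum_apply,
      smul_apply, smul_eq_mul]
    exact Finset.sum_congr rfl fun k _ => mul_comm _ _
  have hg : (Matrix.of fun i j => G (A (b i)) (A (b j))).det =
      LinearMap.det A ^ 2 * (Matrix.of fun i j => G (b i) (b j)).det := by
    have h1 : (Matrix.of fun i j => G (b i) (A (b j))).det =
        LinearMap.det A * (Matrix.of fun i j => G (b i) (b j)).det := by
      rw [← LinearMap.det_toMatrix b, mul_comm, ← Matrix.det_mul]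
      congr 1
      ext i j
      simp only [Matrix.of_apply, Matrix.mul_apply, hA j, map_sum, map_smul, smul_eq_mul]
      exact Finset.sum_congr rfl fun k _ => mul_comm _ _
    have h2 := hv fun i => A (b i)
    rw [← Matrix.det_transpose] at h2
    refine h2.trans ?_
    rw [← Matrix.det_transpose, sq, mul_assoc, ← h1]
    rfl
  ext v
  rw [ContinuousAlternatingMap.smul_apply, volForm_apply, volForm_apply, hv, hg,
    Real.sqrt_mul (sq_nonneg _), Real.sqrt_sq_eq_abs, smul_eq_mul, mul_inv]
  rcases lt_trichotomy (LinearMap.det A) 0 with hd | hd | hd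
  · rw [Real.sign_of_neg hd, abs_of_neg hd]
    field_simp
    rw [mul_div_mul_left _ _ hd.ne]
  · rw [hd]; simp
  · rw [Real.sign_of_pos hd, abs_of_pos hd]
    field_simp

/-- The Hodge star in components, with respect to the volume form `η`. -/
noncomputable def starAux {k l n : ℕ} (h : k + l = n) (G : V →L[ℝ] V →L[ℝ] ℝ) (b : Fin n → V)
    (η : V [⋀^Fin n]→L[ℝ] ℝ) (β : V [⋀^Fin k]→L[ℝ] ℝ) : V [⋀^Fin l]→L[ℝ] ℝ :=
  ((k.factorial : ℝ))⁻¹ • ∑ i : Fin k → Fin n, ∑ j : Fin k → Fin n,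
    ((∏ s, (Matrix.of fun a c => G (b a) (b c))⁻¹ (i s) (j s)) * β (fun s => b (i s))) •
      fillLeft h η fun s => b (j s)

/-- Reading the component formula as an inner product reduces linearity, basis independence and
smoothness of the star to those of `formInner`. -/
theorem starAux_apply {k l n : ℕ} (h : k + l = n) (G : V →L[ℝ] V →L[ℝ] ℝ) (b : Fin n → V)
    (η : V [⋀^Fin n]→L[ℝ] ℝ) (β : V [⋀^Fin k]→L[ℝ] ℝ) (w : Fin l → V) :
    starAux h G b η β w = formInner G b β (fillRight h η w) := by
  simp only [starAux, formInner, ContinuousAlternatingMap.smul_apply,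
    ContinuousAlternatingMap.sum_apply, fillLeft_apply, fillRight_apply, smul_eq_mul]
  rfl

theorem IsInner.wedge_starAux {k l n : ℕ} (h : k + l = n) {G : V →L[ℝ] V →L[ℝ] ℝ}
    (hG : IsInner G) (b : Module.Basis (Fin n) ℝ V) (η : V [⋀^Fin n]→L[ℝ] ℝ)
    (α β : V [⋀^Fin k]→L[ℝ] ℝ) : wedge h α (starAux h G b η β) = formInner G b α β • η := by
  rw [hG.formInner_comm, starAux, wedge_smul_right]
  simp only [wedge_sum_right, wedge_smul_right, wedge_fillLeft, formInner, smul_smul,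
    ← Finset.sum_smul]
  rfl

/-- The component formula satisfies the property behind the choice operator, and nondegeneracy of
the wedge makes the solution unique. Nondegeneracy is tested with the volume form of `b`, so `e` may
be linearly dependent. -/
theorem IsInner.hodge_eq {k l n : ℕ} (h : k + l = n) {G : V →L[ℝ] V →L[ℝ] ℝ}
    (hG : IsInner G) (b : Module.Basis (Fin n) ℝ V) (e : Fin n → V) (β : V [⋀^Fin k]→L[ℝ] ℝ) :
    hodge h G b e β = starAux h G b (volForm G e) β := by
  have h1 : ∀ α : V [⋀^Fin k]→L[ℝ] ℝ, wedge h α (hodge h G b e β) =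
      formInner G b α β • volForm G e :=
    Classical.epsilon_spec (p := fun γ : V [⋀^Fin l]→L[ℝ] ℝ =>
      ∀ α : V [⋀^Fin k]→L[ℝ] ℝ, wedge h α γ = formInner G b α β • volForm G e)
      ⟨starAux h G b (volForm G e) β, fun α => hG.wedge_starAux h b _ α β⟩
  refine wedge_right_injective h b (volForm G b) (hG.volForm_basis_ne_zero b) fun α => ?_
  rw [h1, hG.wedge_starAux]

theorem IsInner.wedge_hodge {k l n : ℕ} (h : k + l = n) {G : V →L[ℝ] V →L[ℝ] ℝ}
    (hG : IsInner G) (b : Module.Basis (Fin n) ℝ V) (e : Fin n → V) (α β : V [⋀^Fin k]→L[ℝ] ℝ) :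
    wedge h α (hodge h G b e β) = formInner G b α β • volForm G e := by
  rw [hG.hodge_eq, hG.wedge_starAux]

theorem IsInner.hodge_apply {k l n : ℕ} (h : k + l = n) {G : V →L[ℝ] V →L[ℝ] ℝ}
    (hG : IsInner G) (b : Module.Basis (Fin n) ℝ V) (e : Fin n → V) (β : V [⋀^Fin k]→L[ℝ] ℝ)
    (w : Fin l → V) :
    hodge h G b e β w = formInner G b β (fillRight h (volForm G e) w) := by
  rw [hG.hodge_eq, starAux_apply]

theorem IsInner.hodge_smul {k l n : ℕ} (h : k + l = n) {G : V →L[ℝ] V →L[ℝ] ℝ}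
    (hG : IsInner G) (b : Module.Basis (Fin n) ℝ V) (e : Fin n → V) (c : ℝ)
    (β : V [⋀^Fin k]→L[ℝ] ℝ) : hodge h G b e (c • β) = c • hodge h G b e β := by
  ext w
  rw [hG.hodge_apply, ContinuousAlternatingMap.smul_apply, hG.hodge_apply, formInner_smul_left,
    smul_eq_mul]

theorem IsInner.hodge_map_basis {k l n : ℕ} (h : k + l = n) {G : V →L[ℝ] V →L[ℝ] ℝ}
    (hG : IsInner G) (b b' : Module.Basis (Fin n) ℝ V) (A : V →ₗ[ℝ] V)
    (β : V [⋀^Fin k]→L[ℝ] ℝ) : hodge h G b (fun i => A (b' i)) β =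
      Real.sign (LinearMap.det A) • hodge h G b b' β := by
  ext w
  rw [hG.hodge_apply, ContinuousAlternatingMap.smul_apply, hG.hodge_apply, volForm_map_basis,
    show fillRight h (Real.sign (LinearMap.det A) • volForm G b') w =
      Real.sign (LinearMap.det A) • fillRight h (volForm G b') w from rfl, formInner_smul_right,
    smul_eq_mul]

theorem sign_mul_sign (a b : ℝ) : Real.sign (a * b) = Real.sign a * Real.sign b := by
  rcases lt_trichotomy a 0 with ha | ha | ha <;> rcases lt_trichotomy b 0 with hb | hb | hb <;>
    simp [*, Real.sign_of_neg, Real.sign_of_pos, mul_pos_of_neg_of_neg, mul_neg_of_neg_of_pos,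
      mul_neg_of_pos_of_neg]

/-- An arbitrary family is the linear image of a basis; the case of a basis and multiplicativity of
the sign of the determinant do the rest. -/
theorem IsInner.hodge_map {k l n : ℕ} (h : k + l = n) {G : V →L[ℝ] V →L[ℝ] ℝ}
    (hG : IsInner G) (b : Module.Basis (Fin n) ℝ V) (A : V →ₗ[ℝ] V) (e : Fin n → V)
    (β : V [⋀^Fin k]→L[ℝ] ℝ) : hodge h G b (fun i => A (e i)) β =
      Real.sign (LinearMap.det A) • hodge h G b e β := by
  have he : e = fun i => b.constr ℝ e (b i) := funext fun i => (b.constr_basis ℝ e i).symm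
  rw [he, hG.hodge_map_basis, smul_smul, ← sign_mul_sign, ← LinearMap.det_comp,
    ← hG.hodge_map_basis]
  rfl

theorem IsInner.hodge_eq_of_basis {k l n : ℕ} (h : k + l = n) {G : V →L[ℝ] V →L[ℝ] ℝ}
    (hG : IsInner G) (b b' : Module.Basis (Fin n) ℝ V) (e : Fin n → V)
    (β : V [⋀^Fin k]→L[ℝ] ℝ) : hodge h G b e β = hodge h G b' e β := by
  ext w
  rw [hG.hodge_apply, hG.hodge_apply, hG.formInner_eq b b']

/-- `α ∧ γ = ⟨⋆α, γ⟩ vol`. -/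
theorem IsInner.wedge_eq_formInner_hodge {k l n : ℕ} (h : k + l = n) {G : V →L[ℝ] V →L[ℝ] ℝ}
    (hG : IsInner G) (b : Module.Basis (Fin n) ℝ V) (α : V [⋀^Fin k]→L[ℝ] ℝ)
    (γ : V [⋀^Fin l]→L[ℝ] ℝ) :
    wedge h α γ = formInner G b γ (hodge h G b b α) • volForm G b := by
  apply topForm_ext b
  rw [ContinuousAlternatingMap.smul_apply, wedge_apply, formInner_eq_recip]
  simp only [hG.hodge_apply, formInner_eq_recip, fillRight_apply]
  -- The multi-indices of lengths `k` and `l` merge into one of length `n`.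
  have h1 : ∑ j : Fin l → Fin n, γ (fun s => b (j s)) * (((k.factorial : ℝ))⁻¹ *
      ∑ i : Fin k → Fin n, α (fun s => b (i s)) *
        volForm G b (combine h (fun s => recip G b (i s)) fun s => recip G b (j s))) =
      ((k.factorial : ℝ))⁻¹ * ∑ f : Fin n → Fin n, α (fun s => b (f (idxL h s))) *
        γ (fun s => b (f (idxR h s))) * volForm G b (fun i => recip G b (f i)) := by
    rw [← Equiv.sum_comp (combineEquiv h (Fin n)), Fintype.sum_prod_type, Finset.sum_comm,
      Finset.mul_sum]
    refine Finset.sum_congr rfl fun j _ => ?_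
    simp only [Finset.mul_sum]
    refine Finset.sum_congr rfl fun i _ => ?_
    simp only [combineEquiv, Equiv.coe_fn_mk, combine_idxL, combine_idxR,
      comp_combine h i j (recip G b)]
    ring
  -- The volume form kills repeated vectors, so only permutations remain, and these reproduce the
  -- sum defining the wedge.
  rw [h1, ← Fintype.sum_of_injective (fun σ : Equiv.Perm (Fin n) => (σ : Fin n → Fin n))
    (DFunLike.coe_injective) (fun σ => volForm G b (recip G b) * ((Equiv.Perm.sign σ : ℝ) *
      (α (fun s => b (σ (idxL h s))) * γ (fun s => b (σ (idxR h s))))))]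
  · rw [← Finset.mul_sum, smul_eq_mul]
    have h2 := hG.volForm_recip_mul b
    set S := ∑ σ : Equiv.Perm (Fin n), (Equiv.Perm.sign σ : ℝ) *
      (α (fun s => b (σ (idxL h s))) * γ (fun s => b (σ (idxR h s))))
    rw [mul_inv]
    linear_combination (-((k.factorial : ℝ)⁻¹ * (l.factorial : ℝ)⁻¹ * S)) * h2
  · intro f hf
    have : ¬ Function.Injective f := fun hi => hf
      ⟨Equiv.ofBijective f (Finite.injective_iff_bijective.1 hi), rfl⟩
    obtain ⟨s, t, hst, hne⟩ : ∃ s t, f s = f t ∧ s ≠ t := by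
      simpa [Function.Injective] using this
    rw [(volForm G b).map_eq_zero_of_eq _ (i := s) (j := t) (by rw [hst]) hne, mul_zero]
  · intro σ
    rw [map_perm_real (volForm G b) (recip G b)]
    ring

/-- The double Hodge star is `(-1)^(k l)`. -/
theorem IsInner.hodge_hodge {k l n : ℕ} (h : k + l = n) (h' : l + k = n)
    {G : V →L[ℝ] V →L[ℝ] ℝ} (hG : IsInner G) (b : Module.Basis (Fin n) ℝ V)
    (α : V [⋀^Fin k]→L[ℝ] ℝ) :
    hodge h' G b b (hodge h G b b α) = (-1 : ℝ) ^ (k * l) • α := by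
  -- Pairing with `γ` gives `γ ∧ ⋆⋆α = ⟨γ, ⋆α⟩ vol = α ∧ γ`, and only graded commutativity is left.
  refine wedge_right_injective h' b (volForm G b) (hG.volForm_basis_ne_zero b) fun γ => ?_
  rw [hG.wedge_hodge, ← hG.wedge_eq_formInner_hodge, wedge_smul_right, wedge_comm h' h γ α,
    mul_comm l k]

end HodgeStar

/-! ### Coordinate frames and the Hodge star on the manifold. -/

section ChartFrames

variable {m : ℕ} {M : Type*} [TopologicalSpace M] [ChartedSpace (EuclideanHalfSpace (m + 1)) M]
  [IsManifold (𝓡∂ (m + 1)) ∞ M]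

theorem mem_baseSet {c x : M} (hx : x ∈ (extChartAt (𝓡∂ (m + 1)) c).source) :
    x ∈ (trivializationAt (Coord (m + 1)) (TangentSpace (𝓡∂ (m + 1))) c).baseSet := by
  rwa [extChartAt_source] at hx

theorem chartD_chartInvD {c x : M} (hx : x ∈ (extChartAt (𝓡∂ (m + 1)) c).source)
    (v : Coord (m + 1)) : chartD c x (chartInvD c x v) = v :=
  Bundle.Trivialization.continuousLinearMapAt_symmL _ (mem_baseSet hx) v

theorem chartInvD_chartD {c x : M} (hx : x ∈ (extChartAt (𝓡∂ (m + 1)) c).source)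
    (v : Tan m x) : chartInvD c x (chartD c x v) = v :=
  Bundle.Trivialization.symmL_continuousLinearMapAt _ (mem_baseSet hx) v

/-- The fibre at `x` is modelled by the preferred chart at `x`, so both differentials are coordinate
changes from or to that chart and compose by the cocycle relation. -/
theorem chartD_chartInvD_eq {c c' x : M} (hx : x ∈ (extChartAt (𝓡∂ (m + 1)) c).source)
    (hx' : x ∈ (extChartAt (𝓡∂ (m + 1)) c').source) (v : Coord (m + 1)) :
    chartD c' x (chartInvD c x v) = tangentCoordChange (𝓡∂ (m + 1)) c c' x v := by
  have h := mem_extChartAt_source (I := 𝓡∂ (m + 1)) x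
  rw [chartD, chartInvD, TangentBundle.symmL_trivializationAt_eq_core (mem_baseSet hx),
    TangentBundle.continuousLinearMapAt_trivializationAt_eq_core (mem_baseSet hx')]
  exact tangentCoordChange_comp ⟨⟨hx, h⟩, hx'⟩

/-- The chart differential as a linear equivalence. -/
noncomputable def chartEquiv {c x : M} (hx : x ∈ (extChartAt (𝓡∂ (m + 1)) c).source) :
    Tan m x ≃ₗ[ℝ] Coord (m + 1) :=
  LinearEquiv.ofLinearMap (chartD c x).toLinearMap (chartInvD c x).toLinearMap
    (LinearMap.ext (chartD_chartInvD hx)) (LinearMap.ext (chartInvD_chartD hx))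

variable (m) in
/-- The standard basis of the coordinate space. -/
noncomputable def stdBasis : Module.Basis (Fin (m + 1)) ℝ (Coord (m + 1)) :=
  (EuclideanSpace.basisFun (Fin (m + 1)) ℝ).toBasis

@[simp] theorem coe_stdBasis : (stdBasis m : Fin (m + 1) → Coord (m + 1)) = stdVec := by
  funext i
  simp [stdBasis, stdVec]

/-- The coordinate frame of a chart as a basis of the tangent space. -/
noncomputable def chartBasis {c x : M} (hx : x ∈ (extChartAt (𝓡∂ (m + 1)) c).source) :
    Module.Basis (Fin (m + 1)) ℝ (Tan m x) :=
  (stdBasis m).map (chartEquiv hx).symm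

@[simp] theorem coe_chartBasis {c x : M} (hx : x ∈ (extChartAt (𝓡∂ (m + 1)) c).source) :
    (chartBasis hx : Fin (m + 1) → Tan m x) = coordFrame c x := by
  funext i
  simp [chartBasis, coordFrame]
  rfl

theorem isInner_inner (g : Metric m M) (x : M) : IsInner (V := Tan m x) (g.inner x) :=
  ⟨g.symm x, g.pos x⟩

variable (g : Metric m M)

/-- The preferred chart may jump with `x`; independence of the basis permits one fixed chart, as
smoothness requires. -/
theorem starForm_eq {k l : ℕ} (h : k + l = m + 1) (α : Form m M k) {c x : M}
    (hx : x ∈ (extChartAt (𝓡∂ (m + 1)) c).source) (e : Fin (m + 1) → Tan m x) :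
    starForm g h α x e = hodge h (g.inner x) (coordFrame c x) e (α x) := by
  have := (isInner_inner g x).hodge_eq_of_basis h
    (chartBasis (mem_extChartAt_source (I := 𝓡∂ (m + 1)) x)) (chartBasis hx) e (α x)
  simpa [starForm] using this

theorem isPseudo_starForm {k l : ℕ} (h : k + l = m + 1) (α : Form m M k) :
    IsPseudo (starForm g h α) := by
  intro x A e
  have := (isInner_inner g x).hodge_map h
    (chartBasis (mem_extChartAt_source (I := 𝓡∂ (m + 1)) x)) A e (α x)
  simpa [starForm] using this

/-- Every family of vectors is a linear image of the basis, and both pseudo-forms react to it by the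
same sign. -/
theorem IsPseudo.eq_of_basis {k : ℕ} {τ τ' : PseudoForm m M k} (hτ : IsPseudo τ)
    (hτ' : IsPseudo τ') {x : M} (b : Module.Basis (Fin (m + 1)) ℝ (Tan m x))
    (h : τ x b = τ' x b) : τ x = τ' x := by
  funext e
  have he : e = fun i => b.constr ℝ e (b i) := funext fun i => (b.constr_basis ℝ e i).symm
  rw [he, hτ, hτ', h]

theorem sign_mul_sign_self {d : ℝ} (hd : d ≠ 0) : Real.sign d * Real.sign d = 1 := by
  rcases lt_or_gt_of_ne hd with h | h
  · simp [Real.sign_of_neg h]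
  · simp [Real.sign_of_pos h]

/-- The pseudo-form and the volume form each contribute the orientation sign of the change of frame,
and the two cancel. -/
theorem starPseudo_eq {k l : ℕ} (h : k + l = m + 1) {τ : PseudoForm m M k} (hτ : IsPseudo τ)
    {c x : M} (hx : x ∈ (extChartAt (𝓡∂ (m + 1)) c).source) :
    starPseudo g h τ x =
      hodge h (g.inner x) (coordFrame c x) (coordFrame c x) (τ x (coordFrame c x)) := by
  have hx0 := mem_extChartAt_source (I := 𝓡∂ (m + 1)) x
  set b := chartBasis hx
  set b0 := chartBasis hx0
  have hG := isInner_inner g x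
  have hA : ∀ i, b0 i = b.equiv b0 (Equiv.refl _) (b i) := by simp
  have hd : LinearMap.det ((b.equiv b0 (Equiv.refl _) : Tan m x ≃ₗ[ℝ] Tan m x) :
      Tan m x →ₗ[ℝ] Tan m x) ≠ 0 := (LinearEquiv.isUnit_det' _).ne_zero
  have h1 : (b0 : Fin (m + 1) → Tan m x) = fun i => ((b.equiv b0 (Equiv.refl _) :
      Tan m x ≃ₗ[ℝ] Tan m x) : Tan m x →ₗ[ℝ] Tan m x) (b i) := funext hA
  have h2 : starPseudo g h τ x = hodge h (g.inner x) b0 b0 (τ x b0) := by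
    simp [starPseudo, b0]
  rw [h2, hG.hodge_eq_of_basis h b0 b]
  conv_lhs => rw [h1]
  rw [hτ, hG.hodge_map, hG.hodge_smul, smul_smul, sign_mul_sign_self hd, one_smul]
  simp [b]

theorem starPseudo_starForm {k l : ℕ} (h : k + l = m + 1) (h' : l + k = m + 1)
    (α : Form m M k) : starPseudo g h' (starForm g h α) = (-1 : ℝ) ^ (k * l) • α := by
  funext x
  have := (isInner_inner g x).hodge_hodge h h'
    (chartBasis (mem_extChartAt_source (I := 𝓡∂ (m + 1)) x)) (α x)
  simpa [starPseudo, starForm] using this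

theorem starForm_starPseudo {k l : ℕ} (h : k + l = m + 1) (h' : l + k = m + 1)
    {τ : PseudoForm m M k} (hτ : IsPseudo τ) :
    starForm g h' (starPseudo g h τ) = (-1 : ℝ) ^ (k * l) • τ := by
  funext x
  refine (isPseudo_starForm g h' _).eq_of_basis (τ' := (-1 : ℝ) ^ (k * l) • τ) (fun x A e => ?_)
    (chartBasis (mem_extChartAt_source (I := 𝓡∂ (m + 1)) x)) ?_
  · simp only [Pi.smul_apply, hτ x A e]
    rw [smul_comm]
  · have := (isInner_inner g x).hodge_hodge h h'
      (chartBasis (mem_extChartAt_source (I := 𝓡∂ (m + 1)) x))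
      (τ x (coordFrame x x))
    simpa [starPseudo, starForm] using this

theorem starForm_smul {k l : ℕ} (h : k + l = m + 1) (c : ℝ) (α : Form m M k) :
    starForm g h (c • α) = c • starForm g h α := by
  funext x e
  have := (isInner_inner g x).hodge_smul h
    (chartBasis (mem_extChartAt_source (I := 𝓡∂ (m + 1)) x)) e c (α x)
  simpa [starForm] using this

theorem starPseudo_smul {k l : ℕ} (h : k + l = m + 1) (c : ℝ) (τ : PseudoForm m M k) :
    starPseudo g h (c • τ) = c • starPseudo g h τ := by
  funext x
  have := (isInner_inner g x).hodge_smul h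
    (chartBasis (mem_extChartAt_source (I := 𝓡∂ (m + 1)) x)) (coordFrame x x) c
    (τ x (coordFrame x x))
  simpa [starPseudo] using this

end ChartFrames

/-! ### Chart independence of the exterior derivative. -/

section ExteriorDerivative

variable {m : ℕ} {M : Type*} [TopologicalSpace M] [ChartedSpace (EuclideanHalfSpace (m + 1)) M]
  [IsManifold (𝓡∂ (m + 1)) ∞ M]

theorem Form.rep_congr {k : ℕ} {α β : Form m M k} {x : M} (h : ∀ᶠ x' in 𝓝 x, α x' = β x')
    (c : M) (hx : x ∈ (extChartAt (𝓡∂ (m + 1)) c).source) :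
    ∀ᶠ y in 𝓝 (extChartAt (𝓡∂ (m + 1)) c x), Form.rep c α y = Form.rep c β y := by
  have h1 := (continuousAt_extChartAt_symm' hx).tendsto
  rw [(extChartAt (𝓡∂ (m + 1)) c).left_inv hx] at h1
  filter_upwards [h1.eventually h] with y hy
  rw [Form.rep, hy, Form.rep]

theorem Form.d_congr {k l : ℕ} (h : k + 1 = l) {α β : Form m M k} {x : M}
    (hαβ : ∀ᶠ x' in 𝓝 x, α x' = β x') : Form.d h α x = Form.d h β x := by
  rw [Form.d, Form.d, Filter.EventuallyEq.extDerivWithin_eq_nhds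
    (Form.rep_congr hαβ x (mem_extChartAt_source x))]

theorem uniqueDiffOn_range : UniqueDiffOn ℝ (range (𝓡∂ (m + 1))) := (𝓡∂ (m + 1)).uniqueDiffOn

theorem extChartAt_mem_range (c x : M) :
    extChartAt (𝓡∂ (m + 1)) c x ∈ range (𝓡∂ (m + 1)) := ⟨_, rfl⟩

theorem Form.rep_eq_pullback {k : ℕ} (α : Form m M k) {c c' x : M}
    (hx : x ∈ (extChartAt (𝓡∂ (m + 1)) c).source)
    (hx' : x ∈ (extChartAt (𝓡∂ (m + 1)) c').source) :
    Form.rep c α (extChartAt (𝓡∂ (m + 1)) c x) =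
      (Form.rep c' α (extChartAt (𝓡∂ (m + 1)) c' x)).compContinuousLinearMap
        (tangentCoordChange (𝓡∂ (m + 1)) c c' x) := by
  simp only [Form.rep]
  rw [(extChartAt (𝓡∂ (m + 1)) c).left_inv hx, (extChartAt (𝓡∂ (m + 1)) c').left_inv hx']
  ext v
  simp only [ContinuousAlternatingMap.compContinuousLinearMap_apply, Function.comp_def]
  congr 1
  funext i
  rw [← chartD_chartInvD_eq hx hx', chartInvD_chartD hx']

theorem castDeg_compContinuousLinearMap {V W : Type*} [AddCommGroup V] [Module ℝ V]
    [TopologicalSpace V] [AddCommGroup W] [Module ℝ W] [TopologicalSpace W] {k l : ℕ}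
    (h : k = l) (α : V [⋀^Fin k]→L[ℝ] ℝ) (f : W →L[ℝ] V) :
    castDeg h (α.compContinuousLinearMap f) = (castDeg h α).compContinuousLinearMap f := by
  subst h; rfl

theorem castDeg_smul {V : Type*} [AddCommGroup V] [Module ℝ V]
    [TopologicalSpace V] {k l : ℕ} (h : k = l) (r : ℝ) (α : V [⋀^Fin k]→L[ℝ] ℝ) :
    castDeg h (r • α) = r • castDeg h α := by
  subst h; rfl

theorem two_le_infty : (2 : WithTop ℕ∞) ≤ ∞ := by
  exact WithTop.coe_le_coe.2 (le_top : (2 : ℕ∞) ≤ ⊤)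

/-- The exterior derivative can be computed in any chart. -/
theorem Form.d_eq {k l : ℕ} (h : k + 1 = l) {α : Form m M k} {c x : M}
    (hx : x ∈ (extChartAt (𝓡∂ (m + 1)) c).source)
    (hα : DifferentiableWithinAt ℝ (Form.rep c α) (range (𝓡∂ (m + 1)))
      (extChartAt (𝓡∂ (m + 1)) c x)) :
    Form.d h α x = castDeg h ((extDerivWithin (Form.rep c α) (range (𝓡∂ (m + 1)))
      (extChartAt (𝓡∂ (m + 1)) c x)).compContinuousLinearMap (chartD c x)) := by
  have hxx := mem_extChartAt_source (I := 𝓡∂ (m + 1)) x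
  set F : Coord (m + 1) → Coord (m + 1) :=
    extChartAt (𝓡∂ (m + 1)) c ∘ (extChartAt (𝓡∂ (m + 1)) x).symm with hF
  have hFx : F (extChartAt (𝓡∂ (m + 1)) x x) = extChartAt (𝓡∂ (m + 1)) c x := by
    rw [hF, Function.comp_apply, (extChartAt (𝓡∂ (m + 1)) x).left_inv hxx]
  have hmem : extChartAt (𝓡∂ (m + 1)) x x ∈
      ((extChartAt (𝓡∂ (m + 1)) x).symm ≫ (extChartAt (𝓡∂ (m + 1)) c)).source := by
    rw [PartialEquiv.trans_source'', PartialEquiv.symm_symm, PartialEquiv.symm_target]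
    exact mem_image_of_mem _ ⟨hxx, hx⟩
  -- Near `x` the two representations differ by pullback along the transition map, and `d` commutes
  -- with pullbacks.
  have h1 : Form.rep x α =ᶠ[𝓝[range (𝓡∂ (m + 1))] (extChartAt (𝓡∂ (m + 1)) x x)]
      fun y => (Form.rep c α (F y)).compContinuousLinearMap
        (fderivWithin ℝ F (range (𝓡∂ (m + 1))) y) := by
    have h2 := (continuousAt_extChartAt_symm' hxx).tendsto
    rw [(extChartAt (𝓡∂ (m + 1)) x).left_inv hxx] at h2
    filter_upwards [extChartAt_target_mem_nhdsWithin x, nhdsWithin_le_nhds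
      (h2.eventually ((isOpen_extChartAt_source (I := 𝓡∂ (m + 1)) c).mem_nhds hx))] with y hy hyc
    have h3 := Form.rep_eq_pullback α ((extChartAt (𝓡∂ (m + 1)) x).map_target hy) hyc
    rw [(extChartAt (𝓡∂ (m + 1)) x).right_inv hy] at h3
    rw [h3, tangentCoordChange_def, (extChartAt (𝓡∂ (m + 1)) x).right_inv hy]
    rfl
  rw [Form.d, h1.extDerivWithin_eq_of_mem (extChartAt_mem_range x x),
    extDerivWithin_pullback (t := range (𝓡∂ (m + 1))) (r := ∞) (by rw [hF] at hFx; rwa [hFx])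
      (contDiffWithinAt_ext_coord_change c x hmem) (by simpa using two_le_infty) uniqueDiffOn_range
      ((𝓡∂ (m + 1)).range_subset_closure_interior (extChartAt_mem_range x x))
      (extChartAt_mem_range x x) (fun y _ => extChartAt_mem_range c _)]
  rw [hF] at hFx
  rw [hFx]
  congr 1
  ext v
  simp only [ContinuousAlternatingMap.compContinuousLinearMap_apply, Function.comp_def]
  congr 1
  funext i
  change tangentCoordChange (𝓡∂ (m + 1)) x c x (chartD x x (v i)) = _
  rw [← chartD_chartInvD_eq hxx hx, chartInvD_chartD hxx]

theorem Form.rep_d {k l : ℕ} (h : k + 1 = l) {α : Form m M k} {c : M} {y : Coord (m + 1)}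
    (hy : y ∈ (extChartAt (𝓡∂ (m + 1)) c).target)
    (hα : DifferentiableWithinAt ℝ (Form.rep c α) (range (𝓡∂ (m + 1))) y) :
    Form.rep c (Form.d h α) y =
      castDeg h (extDerivWithin (Form.rep c α) (range (𝓡∂ (m + 1))) y) := by
  have hx := (extChartAt (𝓡∂ (m + 1)) c).map_target hy
  have hr := (extChartAt (𝓡∂ (m + 1)) c).right_inv hy
  rw [Form.rep, Form.d_eq h hx (by rwa [hr]), hr, ← castDeg_compContinuousLinearMap]
  congr 1
  ext v
  simp only [ContinuousAlternatingMap.compContinuousLinearMap_apply, Function.comp_def,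
    chartD_chartInvD hx]

theorem Form.IsSmooth.differentiableWithinAt_rep {k : ℕ} {α : Form m M k} {c : M}
    (hα : ContDiffOn ℝ ∞ (Form.rep c α) (extChartAt (𝓡∂ (m + 1)) c).target) {y : Coord (m + 1)}
    (hy : y ∈ (extChartAt (𝓡∂ (m + 1)) c).target) :
    DifferentiableWithinAt ℝ (Form.rep c α) (range (𝓡∂ (m + 1))) y :=
  ((hα y hy).differentiableWithinAt (by simp)).mono_of_mem_nhdsWithin
    (extChartAt_target_mem_nhdsWithin_of_mem hy)

theorem Form.d_smul {k l : ℕ} (h : k + 1 = l) (r : ℝ) (α : Form m M k) :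
    Form.d h (r • α) = r • Form.d h α := by
  funext x
  have : Form.rep x (r • α) = r • Form.rep x α := rfl
  rw [Form.d, this, extDerivWithin_smul _ _ (uniqueDiffOn_range _ (extChartAt_mem_range x x)),
    Pi.smul_apply, Form.d, ← castDeg_smul]
  rfl

theorem PseudoForm.d_smul {k l : ℕ} (h : k + 1 = l) (r : ℝ) (τ : PseudoForm m M k) :
    PseudoForm.d h (r • τ) = r • PseudoForm.d h τ := by
  funext x e
  exact congrFun (Form.d_smul h r (PseudoForm.orient x (fun i => chartD x x (e i)) τ)) x

theorem det_conj_chart {c x x' : M} (hx : x ∈ (extChartAt (𝓡∂ (m + 1)) c).source)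
    (hx' : x' ∈ (extChartAt (𝓡∂ (m + 1)) c).source) (A : Tan m x →ₗ[ℝ] Tan m x) :
    LinearMap.det (((chartEquiv hx).trans (chartEquiv hx').symm : Tan m x →ₗ[ℝ] Tan m x') ∘ₗ
      A ∘ₗ (((chartEquiv hx).trans (chartEquiv hx').symm).symm : Tan m x' →ₗ[ℝ] Tan m x)) =
      LinearMap.det A :=
  LinearMap.det_conj A _

/-- Moving `A` to nearby tangent spaces through the chart is a conjugation, which keeps the
determinant. The sign is thus constant near `x` and comes out of `d`. -/
theorem isPseudo_d {k l : ℕ} (h : k + 1 = l) {τ : PseudoForm m M k} (hτ : IsPseudo τ) :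
    IsPseudo (PseudoForm.d h τ) := by
  intro x A e
  have hxx := mem_extChartAt_source (I := 𝓡∂ (m + 1)) x
  have h1 := congrFun (Form.d_smul h (Real.sign (LinearMap.det A))
    (PseudoForm.orient x (fun i => chartD x x (e i)) τ)) x
  refine Eq.trans ?_ h1
  refine Form.d_congr h ?_
  filter_upwards [(isOpen_extChartAt_source (I := 𝓡∂ (m + 1)) x).mem_nhds hxx] with x' hx'
  rw [Pi.smul_apply, PseudoForm.orient, PseudoForm.orient, ← det_conj_chart hxx hx' A, ← hτ]
  congr 1
  funext i
  change _ = chartInvD x x' (chartD x x (A (chartInvD x x (chartD x x' (chartInvD x x' _)))))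
  rw [chartD_chartInvD hx', chartInvD_chartD hxx]

/-- The left side extends the frame of `c` at `x` with constant coordinates in the chart at `x`, the
right side uses the frame of `c` itself. The determinant comparing them is continuous and equals `1`
at `x`, so they define the same orientation nearby. -/
theorem PseudoForm.d_eq_orient {k l : ℕ} (h : k + 1 = l) {τ : PseudoForm m M k}
    (hτ : IsPseudo τ) {c x : M} (hx : x ∈ (extChartAt (𝓡∂ (m + 1)) c).source) :
    PseudoForm.orient c stdVec (PseudoForm.d h τ) x =
      Form.d h (PseudoForm.orient c stdVec τ) x := by
  have hxx := mem_extChartAt_source (I := 𝓡∂ (m + 1)) x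
  change Form.d h _ x = _
  refine Form.d_congr h ?_
  have hcont : ContinuousAt (fun x' => ((tangentCoordChange (𝓡∂ (m + 1)) c x x).comp
      (tangentCoordChange (𝓡∂ (m + 1)) x c x') : Coord (m + 1) →L[ℝ] Coord (m + 1)).det) x := by
    have h1 : ContinuousAt (tangentCoordChange (𝓡∂ (m + 1)) x c) x :=
      (continuousOn_tangentCoordChange x c).continuousAt
        (((isOpen_extChartAt_source x).inter (isOpen_extChartAt_source c)).mem_nhds ⟨hxx, hx⟩)
    exact ContinuousLinearMap.continuous_det.continuousAt.comp (continuousAt_const.clm_comp h1)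
  have hpos : 0 < ((tangentCoordChange (𝓡∂ (m + 1)) c x x).comp
      (tangentCoordChange (𝓡∂ (m + 1)) x c x) : Coord (m + 1) →L[ℝ] Coord (m + 1)).det := by
    have : (tangentCoordChange (𝓡∂ (m + 1)) c x x).comp
      (tangentCoordChange (𝓡∂ (m + 1)) x c x) = ContinuousLinearMap.id ℝ (Coord (m + 1)) := by
      ext1 v
      exact (tangentCoordChange_comp ⟨⟨hxx, hx⟩, hxx⟩).trans (tangentCoordChange_self hxx)
    rw [this]
    simp [ContinuousLinearMap.det]
  filter_upwards [(isOpen_extChartAt_source (I := 𝓡∂ (m + 1)) x).mem_nhds hxx,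
    (isOpen_extChartAt_source (I := 𝓡∂ (m + 1)) c).mem_nhds hx,
    hcont.eventually (lt_mem_nhds hpos)] with x' hx' hc' hd
  set B : Coord (m + 1) →ₗ[ℝ] Coord (m + 1) := ((tangentCoordChange (𝓡∂ (m + 1)) c x x).comp
      (tangentCoordChange (𝓡∂ (m + 1)) x c x')).toLinearMap with hB
  have h1 := hτ x' ((chartEquiv hx').symm.toLinearMap ∘ₗ B ∘ₗ (chartEquiv hx').symm.symm.toLinearMap)
    (fun i => chartInvD c x' (stdVec i))
  rw [LinearMap.det_conj, Real.sign_of_pos (by exact hd), one_smul] at h1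
  refine Eq.trans ?_ h1
  rw [PseudoForm.orient]
  congr 1
  funext i
  change _ = chartInvD x x' (tangentCoordChange (𝓡∂ (m + 1)) c x x
    (tangentCoordChange (𝓡∂ (m + 1)) x c x' (chartD x x' (chartInvD c x' (stdVec i)))))
  rw [chartD_chartInvD_eq hx hxx, chartD_chartInvD_eq hc' hx', tangentCoordChange_comp
    ⟨⟨hc', hx'⟩, hc'⟩, tangentCoordChange_self hc']

theorem PseudoForm.rep_d {k l : ℕ} (h : k + 1 = l) {τ : PseudoForm m M k}
    (hτ : PseudoForm.IsSmooth τ) {c : M} {y : Coord (m + 1)}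
    (hy : y ∈ (extChartAt (𝓡∂ (m + 1)) c).target) :
    Form.rep c (PseudoForm.orient c stdVec (PseudoForm.d h τ)) y = castDeg h
      (extDerivWithin (Form.rep c (PseudoForm.orient c stdVec τ)) (range (𝓡∂ (m + 1))) y) := by
  rw [← Form.rep_d h hy (Form.IsSmooth.differentiableWithinAt_rep (hτ.2 c) hy), Form.rep,
    Form.rep, PseudoForm.d_eq_orient h hτ.1 ((extChartAt (𝓡∂ (m + 1)) c).map_target hy)]

end ExteriorDerivative

/-! ### Smoothness of the Hodge star. -/

section Smoothness

/-- Taking components is an injective linear map into a finite-dimensional space, so it has a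
linear, hence continuous, left inverse that rebuilds the form. -/
theorem contDiffOn_form_iff {m k : ℕ} {N : WithTop ℕ∞} {s : Set (Coord (m + 1))}
    {F : Coord (m + 1) → Coord (m + 1) [⋀^Fin k]→L[ℝ] ℝ} :
    ContDiffOn ℝ N F s ↔
      ∀ i : Fin k → Fin (m + 1), ContDiffOn ℝ N (fun y => F y fun a => stdVec (i a)) s := by
  constructor
  · intro h i
    exact (ContinuousAlternatingMap.apply ℝ (Coord (m + 1)) ℝ
      (fun a => stdVec (i a))).contDiff.comp_contDiffOn h
  · intro h
    let T : (Coord (m + 1) [⋀^Fin k]→L[ℝ] ℝ) →ₗ[ℝ] ((Fin k → Fin (m + 1)) → ℝ) :=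
      { toFun := fun α i => α fun a => stdVec (i a)
        map_add' := fun _ _ => rfl
        map_smul' := fun _ _ => rfl }
    have hT : LinearMap.ker T = ⊥ := by
      refine LinearMap.ker_eq_bot.2 fun α β hαβ => form_ext_basis (stdBasis m) fun i => ?_
      simpa [T] using congrFun hαβ i
    obtain ⟨S, hS⟩ := T.exists_leftInverse_of_injective hT
    have h1 : F = fun y => LinearMap.toContinuousLinearMap S (T (F y)) := by
      funext y
      exact (LinearMap.congr_fun hS (F y)).symm
    rw [h1]
    exact (LinearMap.toContinuousLinearMap S).contDiff.comp_contDiffOn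
      (contDiffOn_pi.2 fun i => h i)

theorem contDiffOn_det {ι : Type*} [Fintype ι] [DecidableEq ι] {E : Type*} [NormedAddCommGroup E]
    [NormedSpace ℝ E] {N : WithTop ℕ∞} {s : Set E} {A : E → Matrix ι ι ℝ}
    (hA : ∀ i j, ContDiffOn ℝ N (fun y => A y i j) s) :
    ContDiffOn ℝ N (fun y => (A y).det) s := by
  simp only [Matrix.det_apply]
  refine ContDiffOn.sum fun σ _ => ContDiffOn.const_smul _ ?_
  exact contDiffOn_prod fun i _ => hA _ _

/-- By the adjugate formula the entries are quotients of determinants. -/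
theorem contDiffOn_matrix_inv {ι : Type*} [Fintype ι] [DecidableEq ι] {E : Type*}
    [NormedAddCommGroup E] [NormedSpace ℝ E] {N : WithTop ℕ∞} {s : Set E} {A : E → Matrix ι ι ℝ}
    (hA : ∀ i j, ContDiffOn ℝ N (fun y => A y i j) s) (hd : ∀ y ∈ s, (A y).det ≠ 0) (i j : ι) :
    ContDiffOn ℝ N (fun y => (A y)⁻¹ i j) s := by
  simp only [Matrix.inv_def, Ring.inverse_eq_inv', Matrix.smul_apply, smul_eq_mul,
    Matrix.adjugate_apply]
  refine ((contDiffOn_det hA).inv hd).mul (contDiffOn_det fun a b => ?_)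
  by_cases h : a = j
  · subst h; simpa using contDiffOn_const
  · simpa [Matrix.updateRow_ne h] using hA a b

variable {m : ℕ} {M : Type*} [TopologicalSpace M] [ChartedSpace (EuclideanHalfSpace (m + 1)) M]
  [IsManifold (𝓡∂ (m + 1)) ∞ M]

theorem contMDiffOn_coordFrame (c : M) (i : Fin (m + 1)) :
    ContMDiffOn (𝓡∂ (m + 1)) ((𝓡∂ (m + 1)).prod 𝓘(ℝ, Coord (m + 1))) ∞
      (fun x => Bundle.TotalSpace.mk' (Coord (m + 1))
        (E := fun x : M => TangentSpace (𝓡∂ (m + 1)) x) x (coordFrame c x i))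
      (extChartAt (𝓡∂ (m + 1)) c).source := by
  have h := (trivializationAt (Coord (m + 1)) (TangentSpace (𝓡∂ (m + 1)))
    c).contMDiffOn_localFrame_baseSet (I := 𝓡∂ (m + 1)) ∞ (stdBasis m) i
  have hs : (trivializationAt (Coord (m + 1)) (TangentSpace (𝓡∂ (m + 1))) c).baseSet =
      (extChartAt (𝓡∂ (m + 1)) c).source := by rw [extChartAt_source]; rfl
  rw [hs] at h
  refine h.congr fun x hx => ?_
  congr 1
  rw [Bundle.Trivialization.localFrame_apply_of_mem_baseSet _ _ (mem_baseSet hx)]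
  simp only [Bundle.Trivialization.basisAt, Module.Basis.map_apply, coe_stdBasis, coordFrame,
    chartInvD]
  exact Bundle.Trivialization.symmₗ_apply (R := ℝ) _ (mem_baseSet hx) (stdVec i)

variable (g : Metric m M)

theorem contDiffOn_gram (c : M) (i j : Fin (m + 1)) :
    ContDiffOn ℝ ∞ (fun y => g.inner ((extChartAt (𝓡∂ (m + 1)) c).symm y)
      (coordFrame c ((extChartAt (𝓡∂ (m + 1)) c).symm y) i)
      (coordFrame c ((extChartAt (𝓡∂ (m + 1)) c).symm y) j))
      (extChartAt (𝓡∂ (m + 1)) c).target := by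
  have h1 : ContMDiffOn (𝓡∂ (m + 1)) 𝓘(ℝ) ∞
      (fun x => g.inner x (coordFrame c x i) (coordFrame c x j))
      (extChartAt (𝓡∂ (m + 1)) c).source := by
    intro x hx
    have : ContMDiffWithinAt (𝓡∂ (m + 1)) ((𝓡∂ (m + 1)).prod 𝓘(ℝ)) ∞
        (fun x => Bundle.TotalSpace.mk' ℝ (E := Bundle.Trivial M ℝ) x
          (g.inner x (coordFrame c x i) (coordFrame c x j)))
        (extChartAt (𝓡∂ (m + 1)) c).source x := by
      apply ContMDiffWithinAt.clm_bundle_apply₂ (F₁ := Coord (m + 1)) (F₂ := Coord (m + 1))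
      · exact g.contMDiff.contMDiffAt.contMDiffWithinAt
      · exact contMDiffOn_coordFrame c i x hx
      · exact contMDiffOn_coordFrame c j x hx
    simp only [Bundle.contMDiffWithinAt_totalSpace] at this
    exact this.2
  have h2 := h1.comp (contMDiffOn_extChartAt_symm (I := 𝓡∂ (m + 1)) (n := ∞) c)
    (fun y hy => (extChartAt (𝓡∂ (m + 1)) c).map_target hy)
  exact contMDiffOn_iff_contDiffOn.1 h2

/-- The Hodge star of a form that is smooth in a chart is smooth in this chart. -/
theorem contDiffOn_rep_hodge {k l : ℕ} (h : k + l = m + 1) (c : M) (α : Form m M k)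
    (hα : ContDiffOn ℝ ∞ (Form.rep c α) (extChartAt (𝓡∂ (m + 1)) c).target) :
    ContDiffOn ℝ ∞ (Form.rep c (fun x =>
      hodge h (g.inner x) (coordFrame c x) (coordFrame c x) (α x) : Form m M l))
      (extChartAt (𝓡∂ (m + 1)) c).target := by
  have hg := contDiffOn_gram g c
  have hdet : ∀ y ∈ (extChartAt (𝓡∂ (m + 1)) c).target,
      0 < (Matrix.of fun i j => g.inner ((extChartAt (𝓡∂ (m + 1)) c).symm y)
        (coordFrame c ((extChartAt (𝓡∂ (m + 1)) c).symm y) i)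
        (coordFrame c ((extChartAt (𝓡∂ (m + 1)) c).symm y) j)).det := by
    intro y hy
    have := (isInner_inner g ((extChartAt (𝓡∂ (m + 1)) c).symm y)).gram_det_pos
      (chartBasis ((extChartAt (𝓡∂ (m + 1)) c).map_target hy))
    rwa [coe_chartBasis] at this
  rw [contDiffOn_form_iff] at hα ⊢
  intro J
  have h1 : ∀ y ∈ (extChartAt (𝓡∂ (m + 1)) c).target,
      Form.rep c (fun x => hodge h (g.inner x) (coordFrame c x) (coordFrame c x) (α x) :
        Form m M l) y (fun a => stdVec (J a)) =
      formInner (g.inner ((extChartAt (𝓡∂ (m + 1)) c).symm y))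
        (coordFrame c ((extChartAt (𝓡∂ (m + 1)) c).symm y))
        (α ((extChartAt (𝓡∂ (m + 1)) c).symm y))
        (fillRight h (volForm (g.inner ((extChartAt (𝓡∂ (m + 1)) c).symm y))
          (coordFrame c ((extChartAt (𝓡∂ (m + 1)) c).symm y)))
          fun a => coordFrame c ((extChartAt (𝓡∂ (m + 1)) c).symm y) (J a)) := by
    intro y hy
    have := (isInner_inner g ((extChartAt (𝓡∂ (m + 1)) c).symm y)).hodge_apply h
      (chartBasis ((extChartAt (𝓡∂ (m + 1)) c).map_target hy))
      (coordFrame c ((extChartAt (𝓡∂ (m + 1)) c).symm y))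
      (α ((extChartAt (𝓡∂ (m + 1)) c).symm y))
      (fun a => coordFrame c ((extChartAt (𝓡∂ (m + 1)) c).symm y) (J a))
    rw [coe_chartBasis] at this
    exact this
  refine ContDiffOn.congr ?_ h1
  unfold formInner
  refine contDiffOn_const.mul (ContDiffOn.sum fun a _ => ContDiffOn.sum fun b _ =>
    ((contDiffOn_prod fun s _ => ?_).mul (hα a)).mul ?_)
  · exact contDiffOn_matrix_inv (A := fun y => Matrix.of fun i j =>
      g.inner ((extChartAt (𝓡∂ (m + 1)) c).symm y)
        (coordFrame c ((extChartAt (𝓡∂ (m + 1)) c).symm y) i)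
        (coordFrame c ((extChartAt (𝓡∂ (m + 1)) c).symm y) j)) hg (fun y hy => (hdet y hy).ne') _ _
  · have h2 : ∀ y, (fillRight h (volForm (g.inner ((extChartAt (𝓡∂ (m + 1)) c).symm y))
          (coordFrame c ((extChartAt (𝓡∂ (m + 1)) c).symm y)))
          fun a => coordFrame c ((extChartAt (𝓡∂ (m + 1)) c).symm y) (J a))
        (coordFrame c ((extChartAt (𝓡∂ (m + 1)) c).symm y) ∘ b) =
        (√(Matrix.of fun i j => g.inner ((extChartAt (𝓡∂ (m + 1)) c).symm y)
          (coordFrame c ((extChartAt (𝓡∂ (m + 1)) c).symm y) i)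
          (coordFrame c ((extChartAt (𝓡∂ (m + 1)) c).symm y) j)).det)⁻¹ *
        (Matrix.of fun j i => g.inner ((extChartAt (𝓡∂ (m + 1)) c).symm y)
          (coordFrame c ((extChartAt (𝓡∂ (m + 1)) c).symm y) i)
          (coordFrame c ((extChartAt (𝓡∂ (m + 1)) c).symm y) (combine h b J j))).det := by
      intro y
      rw [fillRight_apply, Function.comp_def, ← comp_combine h b J, volForm_apply]
    simp only [h2]
    refine ContDiffOn.mul ?_ (contDiffOn_det fun _ _ => hg _ _)
    have h3 := contDiffOn_det (A := fun y => Matrix.of fun i j =>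
      g.inner ((extChartAt (𝓡∂ (m + 1)) c).symm y)
        (coordFrame c ((extChartAt (𝓡∂ (m + 1)) c).symm y) i)
        (coordFrame c ((extChartAt (𝓡∂ (m + 1)) c).symm y) j)) hg
    -- Positivity of the Gram determinant keeps both the square root and the inverse smooth.
    exact (h3.sqrt fun y hy => (hdet y hy).ne').inv
      fun y hy => (Real.sqrt_pos.2 (hdet y hy)).ne'

theorem Form.rep_congr_target {k : ℕ} {α β : Form m M k} (c : M)
    (h : ∀ x ∈ (extChartAt (𝓡∂ (m + 1)) c).source, α x = β x) :
    EqOn (Form.rep c α) (Form.rep c β) (extChartAt (𝓡∂ (m + 1)) c).target := fun y hy => by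
  rw [Form.rep, Form.rep, h _ ((extChartAt (𝓡∂ (m + 1)) c).map_target hy)]

theorem isSmooth_starForm {k l : ℕ} (h : k + l = m + 1) {α : Form m M k} (hα : Form.IsSmooth α) :
    PseudoForm.IsSmooth (starForm g h α) := by
  refine ⟨isPseudo_starForm g h α, fun c => ?_⟩
  exact (contDiffOn_rep_hodge g h c α (hα c)).congr
    (Form.rep_congr_target c fun _ hx => starForm_eq g h α hx _)

theorem isSmooth_starPseudo {k l : ℕ} (h : k + l = m + 1) {τ : PseudoForm m M k}
    (hτ : PseudoForm.IsSmooth τ) : Form.IsSmooth (starPseudo g h τ) := fun c =>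
  (contDiffOn_rep_hodge g h c (PseudoForm.orient c stdVec τ) (hτ.2 c)).congr
    (Form.rep_congr_target c fun _ hx => starPseudo_eq g h hτ.1 hx)

end Smoothness

/-! ### Leibniz rule and divergence theorem in coordinates. -/

section Euclidean

theorem fderivWithin_wedge_apply {m k l n : ℕ} (h : k + l = n)
    {α : Coord (m + 1) → Coord (m + 1) [⋀^Fin k]→L[ℝ] ℝ}
    {β : Coord (m + 1) → Coord (m + 1) [⋀^Fin l]→L[ℝ] ℝ} {s : Set (Coord (m + 1))}
    {y : Coord (m + 1)} (hs : UniqueDiffWithinAt ℝ s y) (hα : DifferentiableWithinAt ℝ α s y)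
    (hβ : DifferentiableWithinAt ℝ β s y) (u : Fin n → Coord (m + 1)) (w : Coord (m + 1)) :
    fderivWithin ℝ (fun z => wedge h (α z) (β z) u) s y w =
      wedge h (fderivWithin ℝ α s y w) (β y) u + wedge h (α y) (fderivWithin ℝ β s y w) u := by
  have ha : ∀ v : Fin k → Coord (m + 1), HasFDerivWithinAt (fun z => α z v)
      ((ContinuousAlternatingMap.apply ℝ (Coord (m + 1)) ℝ v).comp (fderivWithin ℝ α s y)) s y :=
    fun v => (ContinuousAlternatingMap.apply ℝ (Coord (m + 1)) ℝ v).hasFDerivAt.comp_hasFDerivWithinAt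
      y hα.hasFDerivWithinAt
  have hb : ∀ v : Fin l → Coord (m + 1), HasFDerivWithinAt (fun z => β z v)
      ((ContinuousAlternatingMap.apply ℝ (Coord (m + 1)) ℝ v).comp (fderivWithin ℝ β s y)) s y :=
    fun v => (ContinuousAlternatingMap.apply ℝ (Coord (m + 1)) ℝ v).hasFDerivAt.comp_hasFDerivWithinAt
      y hβ.hasFDerivWithinAt
  have h1 := (HasFDerivWithinAt.fun_sum (u := Finset.univ) fun (σ : Equiv.Perm (Fin n)) _ =>
    ((ha fun i => u (σ (idxL h i))).fun_mul (hb fun i => u (σ (idxR h i)))).const_mul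
      (Equiv.Perm.sign σ : ℝ)).const_mul ((k.factorial : ℝ) * l.factorial)⁻¹
  simp only [wedge_apply]
  rw [h1.fderivWithin hs]
  simp only [smul_apply, sum_apply, add_apply, ContinuousLinearMap.comp_apply,
    ContinuousAlternatingMap.apply_apply, smul_eq_mul, ← mul_add, ← Finset.sum_add_distrib]
  congr 1
  exact Finset.sum_congr rfl fun σ _ => by ring

/-- The Leibniz rule. -/
theorem extDerivWithin_wedge_apply {m k l n : ℕ} (h : k + l = n) (h₁ : k + 1 + l = n + 1)
    (h₂ : k + (l + 1) = n + 1) {α : Coord (m + 1) → Coord (m + 1) [⋀^Fin k]→L[ℝ] ℝ}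
    {β : Coord (m + 1) → Coord (m + 1) [⋀^Fin l]→L[ℝ] ℝ} {s : Set (Coord (m + 1))}
    {y : Coord (m + 1)} (hs : UniqueDiffWithinAt ℝ s y) (hα : DifferentiableWithinAt ℝ α s y)
    (hβ : DifferentiableWithinAt ℝ β s y)
    (hαβ : DifferentiableWithinAt ℝ (fun z => wedge h (α z) (β z)) s y)
    (v : Fin (n + 1) → Coord (m + 1)) :
    extDerivWithin (fun z => wedge h (α z) (β z)) s y v =
      wedge h₁ (extDerivWithin α s y) (β y) v +
        (-1 : ℝ) ^ k * wedge h₂ (α y) (extDerivWithin β s y) v := by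
  rw [extDerivWithin_apply hαβ hs]
  simp only [fderivWithin_wedge_apply h hs hα hβ]
  rw [← sum_removeNth_wedge_left h h₁ (fun w => fderivWithin ℝ α s y w) (β y)
    (extDerivWithin α s y), ← sum_removeNth_wedge_right h h₂ (α y)
    (fun w => fderivWithin ℝ β s y w) (extDerivWithin β s y), ← Finset.sum_add_distrib]
  · refine Finset.sum_congr rfl fun i _ => ?_
    rw [zsmul_eq_mul]
    push_cast
    ring
  · intro v
    simp [extDerivWithin, ContinuousAlternatingMap.alternatizeUncurryFin_apply]
  · intro v
    simp [extDerivWithin, ContinuousAlternatingMap.alternatizeUncurryFin_apply]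

theorem contDiffOn_wedge {m k l n : ℕ} (h : k + l = n) {N : WithTop ℕ∞}
    {α : Coord (m + 1) → Coord (m + 1) [⋀^Fin k]→L[ℝ] ℝ}
    {β : Coord (m + 1) → Coord (m + 1) [⋀^Fin l]→L[ℝ] ℝ} {s : Set (Coord (m + 1))}
    (hα : ContDiffOn ℝ N α s) (hβ : ContDiffOn ℝ N β s) :
    ContDiffOn ℝ N (fun z => wedge h (α z) (β z)) s := by
  rw [contDiffOn_form_iff] at hα hβ ⊢
  intro i
  simp only [wedge_apply]
  exact contDiffOn_const.mul (ContDiffOn.sum fun σ _ => contDiffOn_const.mul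
    ((hα fun a => i (σ (idxL h a))).mul (hβ fun a => i (σ (idxR h a)))))

theorem range_halfSpace (m : ℕ) : range (𝓡∂ (m + 1)) = {y : Coord (m + 1) | 0 ≤ y 0} :=
  range_modelWithCornersEuclideanHalfSpace (m + 1)

/-- The divergence theorem for compactly supported vector fields on the half space. -/
theorem integral_halfSpace_divergence {m : ℕ} (f : Fin (m + 1) → Coord (m + 1) → ℝ)
    (hf : ∀ i, ContDiffOn ℝ 1 (f i) (range (𝓡∂ (m + 1)))) (R : ℝ)
    (hR : ∀ i, ∀ y ∈ range (𝓡∂ (m + 1)), R < ‖y‖ → f i y = 0) :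
    ∫ y in range (𝓡∂ (m + 1)), ∑ i, fderivWithin ℝ (f i) (range (𝓡∂ (m + 1))) y (stdVec i) =
      -∫ z : Coord m, f 0 (hyperplane z) := by
  set H : Set (Coord (m + 1)) := range (𝓡∂ (m + 1)) with hH
  have hmem : ∀ y, y ∈ H ↔ 0 ≤ y 0 := fun y => by rw [hH, range_halfSpace]; rfl
  have hHc : IsClosed H := (𝓡∂ (m + 1)).isClosed_range
  -- The box has its lower face on the bounding hyperplane; `r` is positive and exceeds `R`, so the
  -- fields vanish on all other faces.
  set r : ℝ := max R 0 + 1 with hr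
  have hr0 : 0 < r := by positivity
  have hrR : R < r := (le_max_left _ _).trans_lt (lt_add_one _)
  have hcoord : ∀ (n : ℕ) (y : Coord n) (i : Fin n), |y i| ≤ ‖y‖ := fun n y i => by
    simpa using PiLp.norm_apply_le y i
  set a : Fin (m + 1) → ℝ := Fin.cons 0 fun _ => -r with ha
  set b : Fin (m + 1) → ℝ := fun _ => r with hb
  have hab : a ≤ b := fun i => by
    refine Fin.cases ?_ (fun j => ?_) i
    · simp [ha, hb, hr0.le]
    · simp only [ha, hb, Fin.cons_succ]; linarith
  let T : (Fin (m + 1) → ℝ) →L[ℝ] Coord (m + 1) :=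
    (EuclideanSpace.equiv (Fin (m + 1)) ℝ).symm.toContinuousLinearMap
  have hT : ∀ x, T x = WithLp.toLp 2 x := fun x => rfl
  have hTe : ∀ i, T (Pi.single i 1) = stdVec i := fun i => by
    rw [hT, stdVec]; rfl
  have hTH : ∀ x ∈ Icc a b, T x ∈ H := fun x hx => by
    rw [hmem]; exact hx.1 0
  have hbig : ∀ i, ∀ y ∈ H, (∃ j, r ≤ |y j|) → f i y = 0 := fun i y hy ⟨j, hj⟩ =>
    hR i y hy (hrR.trans_le (hj.trans (hcoord _ y j)))
  have hzero : ∀ y ∈ H, R < ‖y‖ →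
      ∑ i, fderivWithin ℝ (f i) H y (stdVec i) = 0 := by
    intro y hy hyR
    refine Finset.sum_eq_zero fun i _ => ?_
    have h1 : f i =ᶠ[𝓝[H] y] fun _ => 0 := by
      filter_upwards [self_mem_nhdsWithin, nhdsWithin_le_nhds
        (continuous_norm.continuousAt.eventually (lt_mem_nhds hyR))] with z hz hzR
      exact hR i z hz hzR
    rw [h1.fderivWithin_eq (hR i y hy hyR), fderivWithin_fun_const]
    rfl
  have key := integral_divergence_of_hasFDerivAt_off_countable' a b hab
    (fun i x => f i (T x)) (fun i x => (fderivWithin ℝ (f i) H (T x)).comp T) ∅ countable_empty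
    (fun i => (hf i).continuousOn.comp T.continuous.continuousOn hTH) ?_ ?_
  · have h1 : ∫ y in H, ∑ i, fderivWithin ℝ (f i) H y (stdVec i) =
        ∫ x in Icc a b, ∑ i, ((fderivWithin ℝ (f i) H (T x)).comp T) (Pi.single i 1) := by
      simp only [ContinuousLinearMap.comp_apply, hTe]
      rw [← (PiLp.volume_preserving_toLp (Fin (m + 1))).setIntegral_preimage_emb
        (MeasurableEquiv.toLp 2 (Fin (m + 1) → ℝ)).measurableEmbedding]
      refine (setIntegral_eq_of_subset_of_forall_sdiff_eq_zero ?_ hTH ?_)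
      · exact hHc.measurableSet.preimage (MeasurableEquiv.toLp 2 (Fin (m + 1) → ℝ)).measurable
      · rintro x ⟨hx, hx'⟩
        refine hzero _ hx (lt_of_not_ge fun hle => hx' ?_)
        have h2 : ∀ i, |x i| ≤ r := fun i =>
          (hcoord _ (WithLp.toLp 2 x) i).trans (hle.trans hrR.le)
        refine ⟨fun i => ?_, fun i => (abs_le.1 (h2 i)).2⟩
        refine Fin.cases ?_ (fun j => ?_) i
        · exact (hmem _).1 hx
        · exact (abs_le.1 (h2 j.succ)).1
    rw [h1, key, Fin.sum_univ_succ]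
    have hface : ∀ (j : Fin (m + 1)) (c : ℝ) (x : Fin m → ℝ), c ∈ Icc (a j) (b j) →
        x ∈ Icc (a ∘ j.succAbove) (b ∘ j.succAbove) → |c| = r →
        f j (T (j.insertNth c x)) = 0 := by
      intro j c x hc hx hcr
      refine hbig j _ (hTH _ (Fin.insertNth_mem_Icc.2 ⟨hc, hx⟩)) ⟨j, ?_⟩
      rw [hT]
      change r ≤ |(j.insertNth c x : Fin (m + 1) → ℝ) j|
      rw [Fin.insertNth_apply_same, hcr]
    have hfront : ∀ j : Fin (m + 1), ∫ x in Icc (a ∘ j.succAbove) (b ∘ j.succAbove),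
        f j (T (j.insertNth (b j) x)) = 0 := fun j =>
      setIntegral_eq_zero_of_forall_eq_zero fun x hx =>
        hface j _ x ⟨hab j, le_rfl⟩ hx (abs_of_pos hr0)
    have hback : ∀ j : Fin m, ∫ x in Icc (a ∘ j.succ.succAbove) (b ∘ j.succ.succAbove),
        f j.succ (T (j.succ.insertNth (a j.succ) x)) = 0 := fun j =>
      setIntegral_eq_zero_of_forall_eq_zero fun x hx =>
        hface j.succ _ x ⟨le_rfl, hab _⟩ hx (by simp [ha, abs_of_pos hr0])
    -- Only the lower face of coordinate `0` survives, and the divergence theorem counts it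
    -- negatively.
    simp only [hfront, hback, sub_zero, Finset.sum_const_zero, add_zero, zero_sub]
    congr 1
    have hhyp : ∀ x : Fin m → ℝ, T ((0 : Fin (m + 1)).insertNth (a 0) x) =
        hyperplane (WithLp.toLp 2 x) := fun x => by
      rw [hT, Fin.insertNth_zero']
      rfl
    simp only [hhyp]
    rw [← (PiLp.volume_preserving_toLp (Fin m)).integral_comp
      (MeasurableEquiv.toLp 2 (Fin m → ℝ)).measurableEmbedding]
    refine setIntegral_eq_integral_of_forall_compl_eq_zero fun x hx => ?_
    by_contra hne
    refine hx ?_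
    have h3 : ∀ j : Fin m, |x j| < r := fun j => by
      refine lt_of_not_ge fun hle => hne (hbig 0 _ ?_ ⟨j.succ, by simpa [hyperplane] using hle⟩)
      rw [hmem]
      simp [hyperplane]
    exact ⟨fun j => by simpa [ha] using (abs_lt.1 (h3 j)).1.le, fun j => (abs_lt.1 (h3 j)).2.le⟩
  · rintro x ⟨hx, -⟩ i
    -- Interior points of the box are interior to the half space, where the one-sided derivative is
    -- a full derivative.
    have hxH : H ∈ 𝓝 (T x) := by
      have hpos : 0 < T x 0 := (hx 0 (mem_univ _)).1
      have hcont : Continuous fun y : Coord (m + 1) => y 0 := by fun_prop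
      filter_upwards [hcont.continuousAt.eventually (lt_mem_nhds hpos)] with y hy
      exact (hmem y).2 hy.le
    have hd : HasFDerivAt (f i) (fderivWithin ℝ (f i) H (T x)) (T x) :=
      ((((hf i) (T x) (mem_of_mem_nhds hxH)).differentiableWithinAt
        one_ne_zero).hasFDerivWithinAt).hasFDerivAt hxH
    exact hd.comp x T.hasFDerivAt
  · refine ContinuousOn.integrableOn_compact isCompact_Icc (continuousOn_finsetSum _ fun i _ => ?_)
    have h1 := ((hf i).continuousOn_fderivWithin (𝓡∂ (m + 1)).uniqueDiffOn le_rfl).comp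
      T.continuous.continuousOn hTH
    exact (h1.clm_comp continuousOn_const).clm_apply continuousOn_const

end Euclidean

/-! ### Change of variables between charts. -/

section ChartIntegrals

variable {m : ℕ} {M : Type*} [TopologicalSpace M] [ChartedSpace (EuclideanHalfSpace (m + 1)) M]

theorem measurableSet_chart_target (c : M) :
    MeasurableSet (extChartAt (𝓡∂ (m + 1)) c).target := by
  rw [extChartAt_target]
  exact (((chartAt (EuclideanHalfSpace (m + 1)) c).open_target.preimage
    (𝓡∂ (m + 1)).continuous_symm).measurableSet).inter (𝓡∂ (m + 1)).isClosed_range.measurableSet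

theorem measurableSet_chart_preimage (c : M) {U : Set M} (hU : IsOpen U) :
    MeasurableSet ((extChartAt (𝓡∂ (m + 1)) c).target ∩
      (extChartAt (𝓡∂ (m + 1)) c).symm ⁻¹' U) := by
  obtain ⟨V, hV, hVe⟩ := (continuousOn_iff'.1
    (continuousOn_extChartAt_symm (I := 𝓡∂ (m + 1)) c)) U hU
  rw [inter_comm, hVe]
  exact hV.measurableSet.inter (measurableSet_chart_target c)

theorem integrableOn_of_continuousOn_of_compact {E : Type*} [TopologicalSpace E]
    [MeasurableSpace E] [OpensMeasurableSpace E] [T2Space E] {μ : Measure E}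
    [IsFiniteMeasureOnCompacts μ] {s K : Set E} {f : E → ℝ}
    (hs : MeasurableSet s) (hK : IsCompact K) (hKs : K ⊆ s) (hf : ContinuousOn f s)
    (h0 : ∀ y ∈ s, y ∉ K → f y = 0) : IntegrableOn f s μ :=
  ((hf.mono hKs).integrableOn_compact hK).of_forall_sdiff_eq_zero hs fun y hy => h0 y hy.1 hy.2

variable [IsManifold (𝓡∂ (m + 1)) ∞ M]

/-- The change of variables between two charts. -/
theorem integral_chart_eq (c b : M) (u v : Coord (m + 1) → ℝ)
    (huv : ∀ x ∈ (extChartAt (𝓡∂ (m + 1)) c).source, x ∈ (extChartAt (𝓡∂ (m + 1)) b).source →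
      u (extChartAt (𝓡∂ (m + 1)) c x) = |(tangentCoordChange (𝓡∂ (m + 1)) c b x).det| *
        v (extChartAt (𝓡∂ (m + 1)) b x))
    (hu : ∀ x ∈ (extChartAt (𝓡∂ (m + 1)) c).source, x ∉ (extChartAt (𝓡∂ (m + 1)) b).source →
      u (extChartAt (𝓡∂ (m + 1)) c x) = 0)
    (hv : ∀ x ∈ (extChartAt (𝓡∂ (m + 1)) b).source, x ∉ (extChartAt (𝓡∂ (m + 1)) c).source →
      v (extChartAt (𝓡∂ (m + 1)) b x) = 0) :
    ∫ y in (extChartAt (𝓡∂ (m + 1)) c).target, u y =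
      ∫ y in (extChartAt (𝓡∂ (m + 1)) b).target, v y := by
  set φ := extChartAt (𝓡∂ (m + 1)) c
  set ψ := extChartAt (𝓡∂ (m + 1)) b
  set S : Set (Coord (m + 1)) := φ.target ∩ φ.symm ⁻¹' ψ.source with hS
  have hSm : MeasurableSet S :=
    measurableSet_chart_preimage c (isOpen_extChartAt_source (I := 𝓡∂ (m + 1)) b)
  have h1 : ∫ y in φ.target, u y = ∫ y in S, u y := by
    symm
    refine (setIntegral_eq_of_subset_of_forall_sdiff_eq_zero (measurableSet_chart_target c)
      inter_subset_left fun y hy => ?_).symm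
    have := hu _ (φ.map_target hy.1) fun h => hy.2 ⟨hy.1, h⟩
    rwa [φ.right_inv hy.1] at this
  have himg : (ψ ∘ φ.symm) '' S = ψ.target ∩ ψ.symm ⁻¹' φ.source := by
    ext y
    constructor
    · rintro ⟨z, ⟨hz, hz'⟩, rfl⟩
      refine ⟨ψ.map_source hz', ?_⟩
      rw [mem_preimage, Function.comp_apply, ψ.left_inv hz']
      exact φ.map_target hz
    · rintro ⟨hy, hy'⟩
      refine ⟨φ (ψ.symm y), ⟨φ.map_source hy', ?_⟩, ?_⟩
      · rw [mem_preimage, φ.left_inv hy']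
        exact ψ.map_target hy
      · rw [Function.comp_apply, φ.left_inv hy', ψ.right_inv hy]
  have h2 : ∫ y in ψ.target, v y = ∫ y in (ψ ∘ φ.symm) '' S, v y := by
    rw [himg]
    refine (setIntegral_eq_of_subset_of_forall_sdiff_eq_zero (measurableSet_chart_target b)
      inter_subset_left fun y hy => ?_)
    have := hv _ (ψ.map_target hy.1) fun h => hy.2 ⟨hy.1, h⟩
    rwa [ψ.right_inv hy.1] at this
  rw [h1, h2, integral_image_eq_integral_abs_det_fderiv_smul volume hSm
    (f' := fun y => tangentCoordChange (𝓡∂ (m + 1)) c b (φ.symm y))]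
  · refine setIntegral_congr_fun hSm fun y hy => ?_
    have := huv _ (φ.map_target hy.1) hy.2
    rw [φ.right_inv hy.1] at this
    exact this
  · intro y hy
    have h3 := hasFDerivWithinAt_tangentCoordChange (I := 𝓡∂ (m + 1)) (x := c) (y := b)
      ⟨φ.map_target hy.1, hy.2⟩
    rw [φ.right_inv hy.1] at h3
    exact h3.mono (inter_subset_left.trans (extChartAt_target_subset_range c))
  · rintro y ⟨hy, hy'⟩ z ⟨hz, hz'⟩ hyz
    have h4 := ψ.injOn hy' hz' hyz
    exact φ.symm.injOn hy hz h4

/-- The determinant of the coordinate change governs the sign of the local representations. -/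
theorem PseudoForm.rep_orient_eq {k : ℕ} {τ : PseudoForm m M k} (hτ : IsPseudo τ) {c b x : M}
    (hc : x ∈ (extChartAt (𝓡∂ (m + 1)) c).source) (hb : x ∈ (extChartAt (𝓡∂ (m + 1)) b).source) :
    Form.rep c (PseudoForm.orient c stdVec τ) (extChartAt (𝓡∂ (m + 1)) c x) =
      Real.sign (tangentCoordChange (𝓡∂ (m + 1)) c b x).det •
      (Form.rep b (PseudoForm.orient b stdVec τ)
        (extChartAt (𝓡∂ (m + 1)) b x)).compContinuousLinearMap
        (tangentCoordChange (𝓡∂ (m + 1)) c b x) := by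
  rw [Form.rep_eq_pullback _ hc hb]
  simp only [Form.rep]
  rw [(extChartAt (𝓡∂ (m + 1)) b).left_inv hb]
  have h1 := hτ x ((chartEquiv hb).symm.toLinearMap ∘ₗ
    (tangentCoordChange (𝓡∂ (m + 1)) c b x).toLinearMap ∘ₗ (chartEquiv hb).symm.symm.toLinearMap)
    (fun i => chartInvD b x (stdVec i))
  rw [LinearMap.det_conj] at h1
  have h2 : PseudoForm.orient c stdVec τ x = Real.sign (tangentCoordChange (𝓡∂ (m + 1)) c b x).det •
      PseudoForm.orient b stdVec τ x := by
    refine Eq.trans ?_ h1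
    rw [PseudoForm.orient]
    congr 1
    funext i
    change _ = chartInvD b x (tangentCoordChange (𝓡∂ (m + 1)) c b x
      (chartD b x (chartInvD b x (stdVec i))))
    rw [chartD_chartInvD hb, ← chartD_chartInvD_eq hc hb, chartInvD_chartD hb]
  rw [h2]
  rfl

theorem fderivWithin_chart_eq {f : M → ℝ} {c b x : M}
    (hc : x ∈ (extChartAt (𝓡∂ (m + 1)) c).source) (hb : x ∈ (extChartAt (𝓡∂ (m + 1)) b).source)
    (hf : DifferentiableWithinAt ℝ (f ∘ (extChartAt (𝓡∂ (m + 1)) b).symm) (range (𝓡∂ (m + 1)))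
      (extChartAt (𝓡∂ (m + 1)) b x)) :
    fderivWithin ℝ (f ∘ (extChartAt (𝓡∂ (m + 1)) c).symm) (range (𝓡∂ (m + 1)))
      (extChartAt (𝓡∂ (m + 1)) c x) =
    (fderivWithin ℝ (f ∘ (extChartAt (𝓡∂ (m + 1)) b).symm) (range (𝓡∂ (m + 1)))
      (extChartAt (𝓡∂ (m + 1)) b x)).comp (tangentCoordChange (𝓡∂ (m + 1)) c b x) := by
  have h0 := hasFDerivWithinAt_tangentCoordChange (I := 𝓡∂ (m + 1)) ⟨hc, hb⟩
  have hF : (extChartAt (𝓡∂ (m + 1)) b ∘ (extChartAt (𝓡∂ (m + 1)) c).symm)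
      (extChartAt (𝓡∂ (m + 1)) c x) = extChartAt (𝓡∂ (m + 1)) b x := by
    rw [Function.comp_apply, (extChartAt (𝓡∂ (m + 1)) c).left_inv hc]
  have h1 : HasFDerivWithinAt ((f ∘ (extChartAt (𝓡∂ (m + 1)) b).symm) ∘
      (extChartAt (𝓡∂ (m + 1)) b ∘ (extChartAt (𝓡∂ (m + 1)) c).symm)) _ (range (𝓡∂ (m + 1)))
      (extChartAt (𝓡∂ (m + 1)) c x) :=
    HasFDerivWithinAt.comp (t := range (𝓡∂ (m + 1))) _
      (by rw [hF]; exact hf.hasFDerivWithinAt) h0 (fun y _ => extChartAt_mem_range b _)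
  have h2 : (f ∘ (extChartAt (𝓡∂ (m + 1)) c).symm) =ᶠ[𝓝[range (𝓡∂ (m + 1))]
      (extChartAt (𝓡∂ (m + 1)) c x)] ((f ∘ (extChartAt (𝓡∂ (m + 1)) b).symm) ∘
      (extChartAt (𝓡∂ (m + 1)) b ∘ (extChartAt (𝓡∂ (m + 1)) c).symm)) := by
    have h3 := (continuousAt_extChartAt_symm' hc).tendsto
    rw [(extChartAt (𝓡∂ (m + 1)) c).left_inv hc] at h3
    filter_upwards [nhdsWithin_le_nhds
      (h3.eventually ((isOpen_extChartAt_source (I := 𝓡∂ (m + 1)) b).mem_nhds hb))] with y hy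
    simp only [Function.comp_apply]
    rw [(extChartAt (𝓡∂ (m + 1)) b).left_inv hy]
  rw [h2.fderivWithin_eq_of_mem (extChartAt_mem_range c x),
    h1.fderivWithin (uniqueDiffOn_range _ (extChartAt_mem_range c x))]

end ChartIntegrals

/-! ### Stokes' theorem in one chart. -/

section LocalStokes

variable {m : ℕ}

/-- The product `L ∧ B` of a covector and a form. -/
noncomputable def covecWedge {k : ℕ} (L : Coord (m + 1) →L[ℝ] ℝ) (B : Coord (m + 1) [⋀^Fin k]→L[ℝ] ℝ) :
    Coord (m + 1) [⋀^Fin (k + 1)]→L[ℝ] ℝ :=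
  ContinuousAlternatingMap.alternatizeUncurryFin (L.smulRight B)

theorem covecWedge_apply {k : ℕ} (L : Coord (m + 1) →L[ℝ] ℝ) (B : Coord (m + 1) [⋀^Fin k]→L[ℝ] ℝ)
    (v : Fin (k + 1) → Coord (m + 1)) :
    covecWedge L B v = ∑ i : Fin (k + 1), (-1) ^ (i : ℕ) * (L (v i) * B (i.removeNth v)) := by
  rw [covecWedge, ContinuousAlternatingMap.alternatizeUncurryFin_apply]
  refine Finset.sum_congr rfl fun i _ => ?_
  rw [zsmul_eq_mul]
  push_cast
  rfl

theorem covecWedge_comp {k : ℕ} (L : Coord (m + 1) →L[ℝ] ℝ) (B : Coord (m + 1) [⋀^Fin k]→L[ℝ] ℝ)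
    (s : ℝ) (T : Coord (m + 1) →L[ℝ] Coord (m + 1)) (v : Fin (k + 1) → Coord (m + 1)) :
    covecWedge (L.comp T) (s • B.compContinuousLinearMap T) v =
      s * covecWedge L B (fun i => T (v i)) := by
  rw [covecWedge_apply, covecWedge_apply, Finset.mul_sum]
  refine Finset.sum_congr rfl fun i _ => ?_
  have : (fun j => T (i.removeNth v j)) = i.removeNth fun i => T (v i) := rfl
  rw [← this]
  change _ * (L (T (v i)) * (s * B fun j => T (i.removeNth v j))) = _
  ring

theorem topForm_map (B : Coord (m + 1) [⋀^Fin (m + 1)]→L[ℝ] ℝ)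
    (T : Coord (m + 1) →L[ℝ] Coord (m + 1)) :
    B (fun i => T (stdVec i)) = T.det * B stdVec := by
  have h := AlternatingMap.eq_smul_basis_det (stdBasis m) B.toAlternatingMap
  have h1 : B (fun i => T (stdVec i)) = B stdVec * (stdBasis m).det (fun i => T (stdVec i)) := by
    have := congrArg (fun f => f fun i => T (stdVec i)) h
    simpa using this
  have h2 := (stdBasis m).det_comp T.toLinearMap (stdBasis m)
  rw [(stdBasis m).det_self, mul_one, coe_stdBasis] at h2
  rw [h1, mul_comm]
  congr 1

theorem sign_mul_eq_abs (d : ℝ) : Real.sign d * d = |d| := by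
  rcases lt_trichotomy d 0 with h | rfl | h
  · rw [Real.sign_of_neg h, abs_of_neg h]; ring
  · simp
  · rw [Real.sign_of_pos h, abs_of_pos h]; ring

/-- The top form scales by the determinant; the orientation sign of a pseudo-form makes it the
absolute value, the factor in the change of variables. -/
theorem covecWedge_chart (L : Coord (m + 1) →L[ℝ] ℝ) (B : Coord (m + 1) [⋀^Fin m]→L[ℝ] ℝ)
    (T : Coord (m + 1) →L[ℝ] Coord (m + 1)) :
    covecWedge (L.comp T) (Real.sign T.det • B.compContinuousLinearMap T) stdVec =
      |T.det| * covecWedge L B stdVec := by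
  rw [covecWedge_comp, topForm_map, ← mul_assoc, sign_mul_eq_abs]

open Classical in
/-- Stokes' theorem for a compactly supported multiple of a form on a relatively open subset of the
half space. -/
theorem integral_halfSpace_stokes {T K : Set (Coord (m + 1))} (hTr : T ⊆ range (𝓡∂ (m + 1)))
    (hTm : MeasurableSet T) (hT : ∀ y ∈ T, T ∈ 𝓝[range (𝓡∂ (m + 1))] y) (hK : IsCompact K)
    (hKT : K ⊆ T) {ρ : Coord (m + 1) → ℝ} {A : Coord (m + 1) → Coord (m + 1) [⋀^Fin m]→L[ℝ] ℝ}
    (hρ : ContDiffOn ℝ ∞ ρ T) (hA : ContDiffOn ℝ ∞ A T) (hρ0 : ∀ y ∈ T, y ∉ K → ρ y = 0) :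
    ∫ y in T, (ρ y * extDerivWithin A (range (𝓡∂ (m + 1))) y stdVec +
      covecWedge (fderivWithin ℝ ρ (range (𝓡∂ (m + 1))) y) (A y) stdVec) =
    -∫ z : Coord m, if hyperplane z ∈ T then
      ρ (hyperplane z) * A (hyperplane z) (fun i => stdVec i.succ) else 0 := by
  set H := range (𝓡∂ (m + 1)) with hH
  -- The vector field dual to `A`: its divergence is the coefficient of `dA`.
  set f : Fin (m + 1) → Coord (m + 1) → ℝ :=
    fun i y => (-1) ^ (i : ℕ) * (A y) (i.removeNth stdVec) with hf
  -- Extension by zero keeps the regularity: `T` is open in the half space, and outside the compact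
  -- set `K ⊆ T` the product vanishes.
  set F : Fin (m + 1) → Coord (m + 1) → ℝ :=
    fun i y => if y ∈ T then ρ y * f i y else 0 with hF
  have hfT : ∀ i, ContDiffOn ℝ ∞ (f i) T := fun i =>
    contDiffOn_const.mul (contDiffOn_form_iff.1 hA fun a => i.succAbove a)
  have hFK : ∀ i, ∀ y ∉ K, F i y = 0 := by
    intro i y hy
    simp only [hF]
    split_ifs with h
    · rw [hρ0 y h hy, zero_mul]
    · rfl
  have hFT : ∀ i, ∀ y ∈ T, F i =ᶠ[𝓝[H] y] fun y => ρ y * f i y := by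
    intro i y hy
    filter_upwards [hT y hy] with z hz
    simp only [hF, if_pos hz]
  have hFz : ∀ i, ∀ y ∉ T, F i =ᶠ[𝓝[H] y] fun _ => 0 := by
    intro i y hy
    filter_upwards [nhdsWithin_le_nhds (hK.isClosed.isOpen_compl.mem_nhds fun h => hy (hKT h))]
      with z hz using hFK i z hz
  have hFc : ∀ i, ContDiffOn ℝ 1 (F i) H := by
    intro i y hyH
    by_cases hy : y ∈ T
    · have h1 : ContDiffWithinAt ℝ 1 (fun y => ρ y * f i y) H y :=
        (((hρ y hy).mul (hfT i y hy)).of_le (by simp)).mono_of_mem_nhdsWithin (hT y hy)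
      exact h1.congr_of_eventuallyEq_of_mem (hFT i y hy) hyH
    · exact contDiffWithinAt_const.congr_of_eventuallyEq_of_mem (hFz i y hy) hyH
  obtain ⟨R, hR⟩ := hK.isBounded.exists_norm_le
  have hdiv := integral_halfSpace_divergence F hFc R fun i y _ hy =>
    hFK i y fun h => absurd (hR y h) (not_le.2 hy)
  have hL : ∫ y in H, ∑ i, fderivWithin ℝ (F i) H y (stdVec i) =
      ∫ y in T, (ρ y * extDerivWithin A H y stdVec +
        covecWedge (fderivWithin ℝ ρ H y) (A y) stdVec) := by
    rw [setIntegral_eq_of_subset_of_forall_sdiff_eq_zero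
      (𝓡∂ (m + 1)).isClosed_range.measurableSet hTr]
    · refine setIntegral_congr_fun hTm fun y hy => ?_
      have hu := uniqueDiffOn_range y (hTr hy)
      have hAd : DifferentiableWithinAt ℝ A H y :=
        ((hA y hy).differentiableWithinAt (by simp)).mono_of_mem_nhdsWithin (hT y hy)
      have hρd : DifferentiableWithinAt ℝ ρ H y :=
        ((hρ y hy).differentiableWithinAt (by simp)).mono_of_mem_nhdsWithin (hT y hy)
      have hfd : ∀ i : Fin (m + 1),
          DifferentiableWithinAt ℝ (fun y => A y (i.removeNth stdVec)) H y := fun i =>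
        (((contDiffOn_form_iff.1 hA fun a => i.succAbove a) y hy).differentiableWithinAt
          (by simp)).mono_of_mem_nhdsWithin (hT y hy)
      change _ = _ * _ + _
      rw [extDerivWithin_apply hAd hu, covecWedge_apply, Finset.mul_sum, ← Finset.sum_add_distrib]
      refine Finset.sum_congr rfl fun i _ => ?_
      rw [(hFT i y hy).fderivWithin_eq_of_mem (hTr hy),
        fderivWithin_fun_mul hu hρd ((hfd i).const_mul _)]
      rw [fderivWithin_const_mul hu (hfd i)]
      simp only [add_apply, smul_apply, smul_eq_mul, zsmul_eq_mul]
      push_cast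
      ring
    · intro y hy
      refine Finset.sum_eq_zero fun i _ => ?_
      rw [(hFz i y hy.2).fderivWithin_eq_of_mem hy.1]
      simp
  rw [← hL, hdiv]
  congr 1
  refine integral_congr_ae (Filter.Eventually.of_forall fun z => ?_)
  simp only [hF, hf, Fin.val_zero, pow_zero, one_mul]
  rfl

end LocalStokes

/-! ### Partition of unity and cancellation of the terms `dρ_c ∧ η`. -/

section Stokes

variable {m : ℕ} {M : Type*} [TopologicalSpace M] [ChartedSpace (EuclideanHalfSpace (m + 1)) M]
  [IsManifold (𝓡∂ (m + 1)) ∞ M]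

theorem contDiffOn_comp_chart_symm {f : M → ℝ} (hf : ContMDiff (𝓡∂ (m + 1)) 𝓘(ℝ, ℝ) ∞ f) (b : M) :
    ContDiffOn ℝ ∞ (f ∘ (extChartAt (𝓡∂ (m + 1)) b).symm) (extChartAt (𝓡∂ (m + 1)) b).target :=
  contMDiffOn_iff_contDiffOn.1 (hf.comp_contMDiffOn (contMDiffOn_extChartAt_symm b))

/-- The chart target is open in the half space, so derivatives within either set agree. -/
theorem continuousOn_fderivWithin_chart {b : M} {f : Coord (m + 1) → ℝ}
    (hf : ContDiffOn ℝ ∞ f (extChartAt (𝓡∂ (m + 1)) b).target) :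
    ContinuousOn (fderivWithin ℝ f (range (𝓡∂ (m + 1)))) (extChartAt (𝓡∂ (m + 1)) b).target := by
  refine (hf.continuousOn_fderivWithin (uniqueDiffOn_extChartAt_target b) (by simp)).congr ?_
  intro y hy
  exact fderivWithin_of_mem_nhdsWithin (extChartAt_target_mem_nhdsWithin_of_mem hy)
    (uniqueDiffOn_range y (extChartAt_target_subset_range b hy))
    ((hf y hy).differentiableWithinAt (by simp))

theorem continuousOn_covecWedge_chart {k : ℕ} {b : M} {f : Coord (m + 1) → ℝ}
    {A : Coord (m + 1) → Coord (m + 1) [⋀^Fin k]→L[ℝ] ℝ}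
    (hf : ContDiffOn ℝ ∞ f (extChartAt (𝓡∂ (m + 1)) b).target)
    (hA : ContDiffOn ℝ ∞ A (extChartAt (𝓡∂ (m + 1)) b).target) (i : Fin (k + 1) → Fin (m + 1)) :
    ContinuousOn (fun y => covecWedge (fderivWithin ℝ f (range (𝓡∂ (m + 1))) y) (A y)
      (fun j => stdVec (i j))) (extChartAt (𝓡∂ (m + 1)) b).target := by
  simp only [covecWedge_apply]
  refine continuousOn_finsetSum _ fun j _ => continuousOn_const.mul
    (((continuousOn_fderivWithin_chart hf).clm_apply continuousOn_const).mul ?_)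
  exact (contDiffOn_form_iff.1 hA fun a => i (j.succAbove a)).continuousOn

theorem continuousOn_extDerivWithin_chart {k : ℕ} {b : M}
    {A : Coord (m + 1) → Coord (m + 1) [⋀^Fin k]→L[ℝ] ℝ}
    (hA : ContDiffOn ℝ ∞ A (extChartAt (𝓡∂ (m + 1)) b).target) (i : Fin (k + 1) → Fin (m + 1)) :
    ContinuousOn (fun y => extDerivWithin A (range (𝓡∂ (m + 1))) y (fun j => stdVec (i j)))
      (extChartAt (𝓡∂ (m + 1)) b).target := by
  refine ContinuousOn.congr (f := fun y => ∑ j : Fin (k + 1), (-1 : ℝ) ^ (j : ℕ) *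
    fderivWithin ℝ (fun y => A y (fun a => stdVec (i (j.succAbove a)))) (range (𝓡∂ (m + 1))) y
      (stdVec (i j))) ?_ fun y hy => ?_
  · refine continuousOn_finsetSum _ fun j _ => continuousOn_const.mul
      (ContinuousOn.clm_apply (continuousOn_fderivWithin_chart
        (contDiffOn_form_iff.1 hA fun a => i (j.succAbove a))) continuousOn_const)
  · rw [extDerivWithin_apply (((hA y hy).differentiableWithinAt
      (by simp)).mono_of_mem_nhdsWithin (extChartAt_target_mem_nhdsWithin_of_mem hy))
      (uniqueDiffOn_range y (extChartAt_target_subset_range b hy))]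
    refine Finset.sum_congr rfl fun j _ => ?_
    rw [zsmul_eq_mul]
    push_cast
    rfl

variable [T2Space M] [CompactSpace M]

theorem tsupport_partition_subset (c : M) :
    tsupport (partition m M c) ⊆ (extChartAt (𝓡∂ (m + 1)) c).source := by
  rw [extChartAt_source]
  exact (SmoothPartitionOfUnity.exists_isSubordinate_chartAt_source
    (𝓡∂ (m + 1)) M).choose_spec c

theorem partition_eq_zero {c x : M} (hx : x ∉ (extChartAt (𝓡∂ (m + 1)) c).source) :
    partition m M c x = 0 :=
  image_eq_zero_of_notMem_tsupport fun h => hx (tsupport_partition_subset c h)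

variable (m M) in
theorem finite_partition : {c : M | (Function.support (partition m M c)).Nonempty}.Finite :=
  (partition m M).locallyFinite.finite_nonempty_of_compact

variable (m M) in
/-- The finite set of indices of the nonzero functions of the partition of unity. -/
noncomputable def partitionIndex : Finset M := (finite_partition m M).toFinset

theorem partition_eq_zero_of_notMem {c : M} (hc : c ∉ partitionIndex m M) (x : M) :
    partition m M c x = 0 := by
  by_contra h
  exact hc ((finite_partition m M).mem_toFinset.2 ⟨x, h⟩)

theorem sum_partition (x : M) : ∑ c ∈ partitionIndex m M, partition m M c x = 1 := by
  rw [← finsum_eq_sum_of_support_subset]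
  · exact (partition m M).sum_eq_one (mem_univ x)
  · intro c hc
    by_contra h
    exact hc (partition_eq_zero_of_notMem h x)

/-- The support of `ρ_c` in the coordinates of `φ_c`. -/
def chartSupport (c : M) : Set (Coord (m + 1)) :=
  extChartAt (𝓡∂ (m + 1)) c '' tsupport (partition m M c)

theorem isCompact_chartSupport (c : M) : IsCompact (chartSupport (m := m) c) :=
  ((isClosed_tsupport _).isCompact).image_of_continuousOn
    ((continuousOn_extChartAt c).mono (tsupport_partition_subset c))

theorem chartSupport_subset (c : M) :
    chartSupport (m := m) c ⊆ (extChartAt (𝓡∂ (m + 1)) c).target := by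
  rintro _ ⟨x, hx, rfl⟩
  exact (extChartAt (𝓡∂ (m + 1)) c).map_source (tsupport_partition_subset c hx)

theorem notMem_tsupport_of_notMem_chartSupport {c : M} {y : Coord (m + 1)}
    (hy : y ∈ (extChartAt (𝓡∂ (m + 1)) c).target) (hyK : y ∉ chartSupport (m := m) c) :
    (extChartAt (𝓡∂ (m + 1)) c).symm y ∉ tsupport (partition m M c) :=
  fun h => hyK ⟨_, h, (extChartAt (𝓡∂ (m + 1)) c).right_inv hy⟩

theorem fderivWithin_partition_eq_zero {c b x : M}
    (hb : x ∈ (extChartAt (𝓡∂ (m + 1)) b).source) (hx : x ∉ tsupport (partition m M c)) :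
    fderivWithin ℝ (partition m M c ∘ (extChartAt (𝓡∂ (m + 1)) b).symm) (range (𝓡∂ (m + 1)))
      (extChartAt (𝓡∂ (m + 1)) b x) = 0 := by
  have h1 := (continuousAt_extChartAt_symm' hb).tendsto
  rw [(extChartAt (𝓡∂ (m + 1)) b).left_inv hb] at h1
  have h2 : partition m M c ∘ (extChartAt (𝓡∂ (m + 1)) b).symm =ᶠ[𝓝[range (𝓡∂ (m + 1))]
      (extChartAt (𝓡∂ (m + 1)) b x)] fun _ => (0 : ℝ) := by
    filter_upwards [nhdsWithin_le_nhds (h1.eventually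
      ((isClosed_tsupport (partition m M c)).isOpen_compl.mem_nhds hx))] with y hy
    exact image_eq_zero_of_notMem_tsupport (f := partition m M c) hy
  rw [h2.fderivWithin_eq_of_mem (extChartAt_mem_range b x), fderivWithin_fun_const]
  rfl

/-- The coordinate expression of `df ∧ η`. -/
noncomputable def gradWedge (f : M → ℝ) (η : PseudoForm m M m) (b : M) (y : Coord (m + 1)) : ℝ :=
  covecWedge (fderivWithin ℝ (f ∘ (extChartAt (𝓡∂ (m + 1)) b).symm) (range (𝓡∂ (m + 1))) y)
    (Form.rep b (PseudoForm.orient b stdVec η) y) stdVec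

theorem gradWedge_chart {η : PseudoForm m M m} (hη : IsPseudo η) {f : M → ℝ}
    (hf : ContMDiff (𝓡∂ (m + 1)) 𝓘(ℝ, ℝ) ∞ f) {c b x : M}
    (hc : x ∈ (extChartAt (𝓡∂ (m + 1)) c).source) (hb : x ∈ (extChartAt (𝓡∂ (m + 1)) b).source) :
    gradWedge f η c (extChartAt (𝓡∂ (m + 1)) c x) =
      |(tangentCoordChange (𝓡∂ (m + 1)) c b x).det| *
        gradWedge f η b (extChartAt (𝓡∂ (m + 1)) b x) := by
  have hb' := (extChartAt (𝓡∂ (m + 1)) b).map_source hb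
  rw [gradWedge, PseudoForm.rep_orient_eq hη hc hb, fderivWithin_chart_eq hc hb
    (((contDiffOn_comp_chart_symm hf b _ hb').differentiableWithinAt (by simp)).mono_of_mem_nhdsWithin
      (extChartAt_target_mem_nhdsWithin_of_mem hb')), covecWedge_chart]
  rfl

/-- The integrals of `dρ_c ∧ η` add up to zero. -/
theorem sum_integral_gradWedge {η : PseudoForm m M m} (hη : PseudoForm.IsSmooth η) :
    ∑ c ∈ partitionIndex m M, ∫ y in (extChartAt (𝓡∂ (m + 1)) c).target,
      gradWedge (partition m M c) η c y = 0 := by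
  have hcont : ∀ c b : M, ContinuousOn (gradWedge (partition m M c) η b)
      (extChartAt (𝓡∂ (m + 1)) b).target := fun c b =>
    continuousOn_covecWedge_chart (contDiffOn_comp_chart_symm (partition m M c).contMDiff b)
      (hη.2 b) id
  have hpart : ∀ c b : M, ContinuousOn
      (fun y => partition m M c ((extChartAt (𝓡∂ (m + 1)) b).symm y))
      (extChartAt (𝓡∂ (m + 1)) b).target := fun c b =>
    (contDiffOn_comp_chart_symm (partition m M c).contMDiff b).continuousOn
  -- Insert `1 = ∑ ρ_b` and move the piece with factor `ρ_b` to the chart `b`; it is supported in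
  -- the overlap.
  have h1 : ∀ c : M, ∫ y in (extChartAt (𝓡∂ (m + 1)) c).target,
      gradWedge (partition m M c) η c y = ∑ b ∈ partitionIndex m M,
        ∫ y in (extChartAt (𝓡∂ (m + 1)) b).target,
          partition m M b ((extChartAt (𝓡∂ (m + 1)) b).symm y) *
            gradWedge (partition m M c) η b y := by
    intro c
    have h2 : ∀ b ∈ partitionIndex m M, ∫ y in (extChartAt (𝓡∂ (m + 1)) b).target,
          partition m M b ((extChartAt (𝓡∂ (m + 1)) b).symm y) *
            gradWedge (partition m M c) η b y =
        ∫ y in (extChartAt (𝓡∂ (m + 1)) c).target,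
          partition m M b ((extChartAt (𝓡∂ (m + 1)) c).symm y) *
            gradWedge (partition m M c) η c y := by
      intro b _
      symm
      refine integral_chart_eq c b _ _ (fun x hc hb => ?_) (fun x hc hb => ?_) fun x hb hc => ?_
      · rw [(extChartAt (𝓡∂ (m + 1)) c).left_inv hc, (extChartAt (𝓡∂ (m + 1)) b).left_inv hb,
          gradWedge_chart hη.1 (partition m M c).contMDiff hc hb]
        ring
      · rw [(extChartAt (𝓡∂ (m + 1)) c).left_inv hc, partition_eq_zero hb, zero_mul]
      · rw [gradWedge, fderivWithin_partition_eq_zero hb fun h => hc (tsupport_partition_subset c h),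
          covecWedge_apply]
        simp
    rw [Finset.sum_congr rfl h2, ← integral_finsetSum]
    · refine setIntegral_congr_fun (measurableSet_chart_target c) fun y _ => ?_
      change _ = ∑ b ∈ partitionIndex m M, _ * _
      rw [← Finset.sum_mul, sum_partition, one_mul]
    · intro b _
      refine integrableOn_of_continuousOn_of_compact (measurableSet_chart_target c)
        (isCompact_chartSupport c) (chartSupport_subset c) ((hpart b c).mul (hcont c c)) ?_
      intro y hy hyK
      have h3 := fderivWithin_partition_eq_zero ((extChartAt (𝓡∂ (m + 1)) c).map_target hy)
        (notMem_tsupport_of_notMem_chartSupport hy hyK)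
      rw [(extChartAt (𝓡∂ (m + 1)) c).right_inv hy] at h3
      rw [gradWedge, h3, covecWedge_apply]
      simp
  -- After exchanging the sums, all `dρ_c` are evaluated in the same chart `b`, where they add up to
  -- `d1 = 0`.
  rw [Finset.sum_congr rfl fun c _ => h1 c, Finset.sum_comm]
  refine Finset.sum_eq_zero fun b _ => ?_
  rw [← integral_finsetSum]
  · refine setIntegral_eq_zero_of_forall_eq_zero fun y hy => ?_
    have hyr := extChartAt_target_subset_range b hy
    have h4 : ∑ c ∈ partitionIndex m M, fderivWithin ℝ (partition m M c ∘
        (extChartAt (𝓡∂ (m + 1)) b).symm) (range (𝓡∂ (m + 1))) y = 0 := by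
      rw [← fderivWithin_fun_sum (uniqueDiffOn_range y hyr)]
      · simp only [Function.comp_def, sum_partition, fderivWithin_fun_const]
        rfl
      · intro c _
        exact ((contDiffOn_comp_chart_symm (partition m M c).contMDiff b y hy).differentiableWithinAt
          (by simp)).mono_of_mem_nhdsWithin (extChartAt_target_mem_nhdsWithin_of_mem hy)
    rw [← Finset.mul_sum]
    simp only [gradWedge, covecWedge_apply]
    rw [Finset.sum_comm]
    refine mul_eq_zero_of_right _ (Finset.sum_eq_zero fun i _ => ?_)
    rw [← Finset.mul_sum, ← Finset.sum_mul]
    have h5 := congrArg (fun L : Coord (m + 1) →L[ℝ] ℝ => L (stdVec i)) h4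
    simp only [sum_apply, zero_apply] at h5
    rw [h5, zero_mul, mul_zero]
  · intro c _
    refine integrableOn_of_continuousOn_of_compact (measurableSet_chart_target b)
      (isCompact_chartSupport b) (chartSupport_subset b) ((hpart b b).mul (hcont c b)) ?_
    intro y hy hyK
    rw [image_eq_zero_of_notMem_tsupport (notMem_tsupport_of_notMem_chartSupport hy hyK), zero_mul]

end Stokes

/-! ### Orientation of the boundary and global Stokes' theorem. -/

section BoundaryOrientation

variable {m : ℕ} {M : Type*} [TopologicalSpace M] [ChartedSpace (EuclideanHalfSpace (m + 1)) M]
  [IsManifold (𝓡∂ (m + 1)) ∞ M]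

/-- In every chart, the inward normal coordinate of an inward vector is nonnegative. -/
theorem tangentCoordChange_inward_nonneg {c x : M}
    (hc : x ∈ (extChartAt (𝓡∂ (m + 1)) c).source)
    (hc0 : extChartAt (𝓡∂ (m + 1)) c x 0 = 0) :
    0 ≤ tangentCoordChange (𝓡∂ (m + 1)) x c x (stdVec 0) 0 := by
  have hxx := mem_extChartAt_source (I := 𝓡∂ (m + 1)) x
  have hd := hasFDerivWithinAt_tangentCoordChange (I := 𝓡∂ (m + 1)) ⟨hxx, hc⟩
  have hd0 := (EuclideanSpace.proj (𝕜 := ℝ) (0 : Fin (m + 1))).hasFDerivAt.comp_hasFDerivWithinAt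
    (extChartAt (𝓡∂ (m + 1)) x x) hd
  -- On the half space the coordinate `φ_c⁰` attains its minimum `0` at the boundary point, so its
  -- derivative in an inward direction is nonnegative.
  refine IsLocalMinOn.hasFDerivWithinAt_nonneg ?_ hd0
    (mem_posTangentConeAt_of_segment_subset ?_)
  · refine Filter.Eventually.of_forall fun y => ?_
    simp only [Function.comp_apply]
    rw [(extChartAt (𝓡∂ (m + 1)) x).left_inv hxx]
    have h2 := extChartAt_mem_range (m := m) c ((extChartAt (𝓡∂ (m + 1)) x).symm y)
    rw [range_halfSpace] at h2
    change extChartAt (𝓡∂ (m + 1)) c x 0 ≤ _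
    rw [hc0]
    exact h2
  · have h0 := extChartAt_mem_range (m := m) x x
    rw [range_halfSpace] at h0 ⊢
    rintro y ⟨a, b, ha, hb, hab, rfl⟩
    have : (0 : ℝ) ≤ extChartAt (𝓡∂ (m + 1)) x x 0 := h0
    simp only [mem_ofPred_eq, PiLp.add_apply, PiLp.smul_apply, smul_eq_mul, stdVec,
      PiLp.single_apply, if_true]
    positivity

/-- If the component vanished, the outward vector would be a combination of `∂₁, …, ∂ₘ` of `c`,
which are tangent to the boundary; yet in the chart at `x` its component is `-1`. -/
theorem chartD_outward_neg {c x : M} (hx : x ∈ Bdry m M)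
    (hc : x ∈ (extChartAt (𝓡∂ (m + 1)) c).source)
    (hc0 : extChartAt (𝓡∂ (m + 1)) c x 0 = 0) :
    (chartD c x (outward x) : Coord (m + 1)) 0 < 0 := by
  have hxx := mem_extChartAt_source (I := 𝓡∂ (m + 1)) x
  set w : Coord (m + 1) := chartD c x (outward x) with hw
  have h1 : w 0 ≤ 0 := by
    rw [hw, outward, chartD_chartInvD_eq hxx hc, map_neg]
    simpa using tangentCoordChange_inward_nonneg hc hc0
  refine lt_of_le_of_ne h1 fun h0 => ?_
  have h2 : (chartD x x (chartInvD c x w) : Coord (m + 1)) 0 = -1 := by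
    rw [hw, chartInvD_chartD hc, outward, chartD_chartInvD hxx]
    simp [stdVec]
  have h3 : w = ∑ i : Fin m, w i.succ • stdVec i.succ := by
    have := (stdBasis m).sum_repr w
    rw [Fin.sum_univ_succ] at this
    simpa [stdBasis, stdVec, h0] using this.symm
  have h4 : ∀ i : Fin m, (chartD x x (chartInvD c x (stdVec i.succ)) : Coord (m + 1)) 0 = 0 :=
    fun i => coordFrame_mem_bdryTan c x hx hc i
  rw [h3, map_sum, map_sum] at h2
  simp [h4] at h2

/-- The linear map of the coordinate space that maps the first basis vector to `w` and fixes the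
others. -/
noncomputable def replaceFirst (w : Coord (m + 1)) : Coord (m + 1) →ₗ[ℝ] Coord (m + 1) :=
  (stdBasis m).constr ℝ (Fin.cons w fun i : Fin m => stdVec i.succ : Fin (m + 1) → Coord (m + 1))

/-- The matrix is the identity with its first column replaced, so Cramer's rule for the identity
gives the determinant. -/
theorem det_replaceFirst (w : Coord (m + 1)) : LinearMap.det (replaceFirst w) = w 0 := by
  have h : LinearMap.toMatrix (stdBasis m) (stdBasis m) (replaceFirst w) =
      (1 : Matrix (Fin (m + 1)) (Fin (m + 1)) ℝ).updateCol 0 w := by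
    ext i j
    rw [LinearMap.toMatrix_apply, replaceFirst, Module.Basis.constr_basis]
    refine Fin.cases ?_ (fun j => ?_) j
    · simp [stdBasis]
    · simp [stdBasis, stdVec, Matrix.one_apply]
  rw [← LinearMap.det_toMatrix (stdBasis m), h, ← Matrix.cramer_apply, Matrix.cramer_one]
  rfl

/-- The boundary orientation of the frame `∂₁, …, ∂ₘ` is opposite to the orientation of the
coordinates. -/
theorem PseudoForm.outward_frame {k : ℕ} {τ : PseudoForm m M k} (hτ : IsPseudo τ) {c x : M}
    (hx : x ∈ Bdry m M) (hc : x ∈ (extChartAt (𝓡∂ (m + 1)) c).source)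
    (hc0 : extChartAt (𝓡∂ (m + 1)) c x 0 = 0) :
    τ x (Fin.cons (outward x) fun i : Fin m => coordFrame c x i.succ) =
      -τ x (coordFrame c x) := by
  have h1 := hτ x ((chartEquiv hc).symm.toLinearMap ∘ₗ replaceFirst (chartD c x (outward x)) ∘ₗ
    (chartEquiv hc).symm.symm.toLinearMap) (coordFrame c x)
  rw [LinearMap.det_conj, det_replaceFirst, Real.sign_of_neg (chartD_outward_neg hx hc hc0),
    show (-1 : ℝ) • τ x (coordFrame c x) = -τ x (coordFrame c x) by
      ext v; exact neg_one_mul _] at h1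
  rw [← h1]
  congr 1
  funext i
  change _ = chartInvD c x (replaceFirst (chartD c x (outward x))
    (chartD c x (chartInvD c x (stdVec i))))
  rw [chartD_chartInvD hc, replaceFirst, ← coe_stdBasis, Module.Basis.constr_basis]
  refine Fin.cases ?_ (fun i => ?_) i
  · exact (chartInvD_chartD hc _).symm
  · rw [Fin.cons_succ, Fin.cons_succ, coe_stdBasis]
    rfl

variable [T2Space M] [CompactSpace M]

-- The minus sign comes from `PseudoForm.outward_frame`: the outward vector followed by `∂₁, …, ∂ₘ`
-- is oriented against the chart.
open Classical in
theorem BdryPseudoForm.integral_tr {η : PseudoForm m M m} (hη : IsPseudo η) :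
    BdryPseudoForm.integral (PseudoForm.tr η) = ∑ c ∈ partitionIndex m M,
      -∫ z : Coord m, if hyperplane z ∈ (extChartAt (𝓡∂ (m + 1)) c).target then
        partition m M c ((extChartAt (𝓡∂ (m + 1)) c).symm (hyperplane z)) *
          Form.rep c (PseudoForm.orient c stdVec η) (hyperplane z) (fun i => stdVec i.succ)
        else 0 := by
  rw [BdryPseudoForm.integral, finsum_eq_sum_of_support_subset]
  · refine Finset.sum_congr rfl fun c _ => ?_
    rw [← integral_neg]
    refine integral_congr_ae (Filter.Eventually.of_forall fun z => ?_)
    by_cases h : hyperplane z ∈ (extChartAt (𝓡∂ (m + 1)) c).target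
    · simp only [dif_pos h, if_pos h]
      rw [← mul_neg]
      congr 1
      have hs := (extChartAt (𝓡∂ (m + 1)) c).map_target h
      have h1 := PseudoForm.outward_frame hη (mem_bdry c z h) hs (by
        rw [(extChartAt (𝓡∂ (m + 1)) c).right_inv h]
        simp [hyperplane])
      exact congrArg (fun B : Tan m ((extChartAt (𝓡∂ (m + 1)) c).symm (hyperplane z)) [⋀^Fin m]→L[ℝ] ℝ
        => B fun i : Fin m => coordFrame c _ i.succ) h1
    · simp only [dif_neg h, if_neg h, neg_zero]
  · intro c hc
    by_contra h
    refine hc (integral_eq_zero_of_ae (Filter.Eventually.of_forall fun z => ?_))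
    simp only [partition_eq_zero_of_notMem h, zero_mul]
    split_ifs <;> rfl

theorem PseudoForm.integral_eq_sum (τ : PseudoForm m M (m + 1)) :
    PseudoForm.integral τ = ∑ c ∈ partitionIndex m M,
      ∫ y in (extChartAt (𝓡∂ (m + 1)) c).target,
        partition m M c ((extChartAt (𝓡∂ (m + 1)) c).symm y) *
          Form.rep c (PseudoForm.orient c stdVec τ) y stdVec := by
  rw [PseudoForm.integral, finsum_eq_sum_of_support_subset]
  intro c hc
  by_contra h
  refine hc (integral_eq_zero_of_ae (Filter.Eventually.of_forall fun z => ?_))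
  simp only [partition_eq_zero_of_notMem h, zero_mul]
  rfl

/-- Stokes' theorem for outer-oriented forms. -/
theorem PseudoForm.integral_d {η : PseudoForm m M m} (hη : PseudoForm.IsSmooth η) :
    PseudoForm.integral (PseudoForm.d rfl η) = BdryPseudoForm.integral (PseudoForm.tr η) := by
  have hT : ∀ c : M, ∀ y ∈ (extChartAt (𝓡∂ (m + 1)) c).target,
      (extChartAt (𝓡∂ (m + 1)) c).target ∈ 𝓝[range (𝓡∂ (m + 1))] y :=
    fun c y hy => extChartAt_target_mem_nhdsWithin_of_mem hy
  have hρ := fun c : M => contDiffOn_comp_chart_symm (partition m M c).contMDiff c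
  have hρ0 : ∀ c : M, ∀ y ∈ (extChartAt (𝓡∂ (m + 1)) c).target, y ∉ chartSupport (m := m) c →
      (partition m M c ∘ (extChartAt (𝓡∂ (m + 1)) c).symm) y = 0 := fun c y hy hyK =>
    image_eq_zero_of_notMem_tsupport (f := partition m M c)
      (notMem_tsupport_of_notMem_chartSupport hy hyK)
  have h1 : ∀ c : M, ∫ y in (extChartAt (𝓡∂ (m + 1)) c).target,
      (partition m M c ((extChartAt (𝓡∂ (m + 1)) c).symm y) *
        Form.rep c (PseudoForm.orient c stdVec (PseudoForm.d rfl η)) y stdVec) =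
      ∫ y in (extChartAt (𝓡∂ (m + 1)) c).target,
        (partition m M c ∘ (extChartAt (𝓡∂ (m + 1)) c).symm) y *
        extDerivWithin (Form.rep c (PseudoForm.orient c stdVec η)) (range (𝓡∂ (m + 1))) y stdVec := by
    intro c
    refine setIntegral_congr_fun (measurableSet_chart_target c) fun y hy => ?_
    rw [PseudoForm.rep_d rfl hη hy, castDeg_rfl]
    rfl
  have h2 := sum_integral_gradWedge hη
  rw [PseudoForm.integral_eq_sum, BdryPseudoForm.integral_tr hη.1,
    Finset.sum_congr rfl fun c _ => h1 c]
  -- Adding the vanishing sum of the `dρ_c ∧ η` completes `ρ_c dη` to `d(ρ_c η)`, to which the local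
  -- theorem applies.
  refine Eq.trans (Eq.trans (add_zero _).symm (congrArg _ h2.symm)) ?_
  rw [← Finset.sum_add_distrib]
  refine Finset.sum_congr rfl fun c _ => ?_
  refine Eq.trans ?_ (integral_halfSpace_stokes (extChartAt_target_subset_range c)
    (measurableSet_chart_target c) (hT c) (isCompact_chartSupport c) (chartSupport_subset c)
    (hρ c) (hη.2 c) (hρ0 c))
  symm
  refine integral_add ?_ ?_
  · exact integrableOn_of_continuousOn_of_compact (measurableSet_chart_target c)
      (isCompact_chartSupport c) (chartSupport_subset c)
      ((hρ c).continuousOn.mul (continuousOn_extDerivWithin_chart (hη.2 c) id))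
      fun y hy hyK => by rw [hρ0 c y hy hyK, zero_mul]
  · refine integrableOn_of_continuousOn_of_compact (measurableSet_chart_target c)
      (isCompact_chartSupport c) (chartSupport_subset c)
      (continuousOn_covecWedge_chart (hρ c) (hη.2 c) id) fun y hy hyK => ?_
    have h3 := fderivWithin_partition_eq_zero ((extChartAt (𝓡∂ (m + 1)) c).map_target hy)
      (notMem_tsupport_of_notMem_chartSupport hy hyK)
    rw [(extChartAt (𝓡∂ (m + 1)) c).right_inv hy] at h3
    rw [h3, covecWedge_apply]
    simp

end BoundaryOrientation

/-! ### Integration by parts for a pseudo-form and a form. -/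

section PowerBalance

variable {m : ℕ} {M : Type*} [TopologicalSpace M] [ChartedSpace (EuclideanHalfSpace (m + 1)) M]
  [IsManifold (𝓡∂ (m + 1)) ∞ M]

theorem rep_orient_wedgeForm {k l n : ℕ} (h : k + l = n) (τ : PseudoForm m M k) (α : Form m M l)
    (c : M) (B : Fin (m + 1) → Coord (m + 1)) (y : Coord (m + 1)) :
    Form.rep c (PseudoForm.orient c B (PseudoForm.wedgeForm h τ α)) y =
      wedge h (Form.rep c (PseudoForm.orient c B τ) y) (Form.rep c α y) :=
  (wedge_compContinuousLinearMap h _ _ _).symm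

theorem PseudoForm.IsSmooth.wedgeForm {k l n : ℕ} (h : k + l = n) {τ : PseudoForm m M k}
    {α : Form m M l} (hτ : PseudoForm.IsSmooth τ) (hα : Form.IsSmooth α) :
    PseudoForm.IsSmooth (PseudoForm.wedgeForm h τ α) := by
  refine ⟨fun x A e => ?_, fun c => ?_⟩
  · rw [PseudoForm.wedgeForm, hτ.1, wedge_smul_left]
    rfl
  · simp only [funext (rep_orient_wedgeForm h τ α c stdVec)]
    exact contDiffOn_wedge h (hτ.2 c) (hα c)

theorem PseudoForm.IsSmooth.const_smul {k : ℕ} {τ : PseudoForm m M k} (hτ : PseudoForm.IsSmooth τ)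
    (r : ℝ) : PseudoForm.IsSmooth (r • τ) := by
  refine ⟨fun x A e => ?_, fun c => ?_⟩
  · rw [Pi.smul_apply, Pi.smul_apply, Pi.smul_apply, hτ.1, smul_comm]
  · exact (hτ.2 c).const_smul r

theorem PseudoForm.tr_wedgeForm {k l n : ℕ} (h : k + l = n) (τ : PseudoForm m M k)
    (α : Form m M l) : PseudoForm.tr (PseudoForm.wedgeForm h τ α) =
      BdryPseudoForm.wedgeForm h (PseudoForm.tr τ) (Form.tr α) := by
  funext x e
  exact (wedge_compContinuousLinearMap h _ _ _).symm

/-- Both sides equal `⟨α, β⟩ vol`, and the inner product is symmetric. -/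
theorem wedgePseudo_starForm_comm (g : Metric m M) {k l : ℕ} (h : k + l = m + 1)
    (α β : Form m M k) : Form.wedgePseudo h α (starForm g h β) =
      Form.wedgePseudo h β (starForm g h α) := by
  funext x e
  have hG := isInner_inner g x
  have hb := coe_chartBasis (mem_extChartAt_source (I := 𝓡∂ (m + 1)) x)
  rw [Form.wedgePseudo, Form.wedgePseudo, starForm, starForm, ← hb, hG.wedge_hodge,
    hG.wedge_hodge, hG.formInner_comm]

theorem wedgeForm_eq_wedgePseudo {k l n : ℕ} (h : k + l = n) (h' : l + k = n)
    (τ : PseudoForm m M k) (α : Form m M l) :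
    PseudoForm.wedgeForm h τ α = (-1 : ℝ) ^ (l * k) • Form.wedgePseudo h' α τ := by
  funext x e
  exact wedge_comm h' h (α x) (τ x e)

variable [T2Space M] [CompactSpace M]

theorem PseudoForm.integral_smul (r : ℝ) (τ : PseudoForm m M (m + 1)) :
    PseudoForm.integral (r • τ) = r * PseudoForm.integral τ := by
  rw [PseudoForm.integral_eq_sum, PseudoForm.integral_eq_sum, Finset.mul_sum]
  refine Finset.sum_congr rfl fun c _ => ?_
  rw [← integral_const_mul]
  refine integral_congr_ae (Filter.Eventually.of_forall fun y => ?_)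
  exact mul_left_comm _ _ _

theorem BdryPseudoForm.integral_smul (r : ℝ) (σ : BdryPseudoForm m M m) :
    BdryPseudoForm.integral (r • σ) = r * BdryPseudoForm.integral σ := by
  rw [BdryPseudoForm.integral, BdryPseudoForm.integral, ← smul_eq_mul, smul_finsum]
  refine finsum_congr fun c => ?_
  rw [smul_eq_mul, ← integral_const_mul]
  refine integral_congr_ae (Filter.Eventually.of_forall fun z => ?_)
  simp only []
  split_ifs
  · exact mul_left_comm _ _ _
  · rw [mul_zero]

/-- The integral of `d (τ ∧ α)`. -/
theorem integral_d_wedgeForm {k l : ℕ} (h : k + l = m) (h₁ : k + 1 + l = m + 1)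
    (h₂ : k + (l + 1) = m + 1) {τ : PseudoForm m M k} {α : Form m M l}
    (hτ : PseudoForm.IsSmooth τ) (hα : Form.IsSmooth α) :
    PseudoForm.integral (PseudoForm.wedgeForm h₁ (PseudoForm.d rfl τ) α) +
      (-1) ^ k * PseudoForm.integral (PseudoForm.wedgeForm h₂ τ (Form.d rfl α)) =
    PseudoForm.integral (PseudoForm.d rfl (PseudoForm.wedgeForm h τ α)) := by
  have hτα := hτ.wedgeForm h hα
  rw [← PseudoForm.integral_smul, PseudoForm.integral_eq_sum, PseudoForm.integral_eq_sum,
    PseudoForm.integral_eq_sum, ← Finset.sum_add_distrib]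
  refine Finset.sum_congr rfl fun c _ => ?_
  have hρ := (contDiffOn_comp_chart_symm (partition m M c).contMDiff c).continuousOn
  have hint : ∀ u : Coord (m + 1) → ℝ, ContinuousOn u (extChartAt (𝓡∂ (m + 1)) c).target →
      IntegrableOn (fun y => partition m M c ((extChartAt (𝓡∂ (m + 1)) c).symm y) * u y)
        (extChartAt (𝓡∂ (m + 1)) c).target := fun u hu =>
    integrableOn_of_continuousOn_of_compact (measurableSet_chart_target c)
      (isCompact_chartSupport c) (chartSupport_subset c) (hρ.mul hu) fun y hy hyK => by
        rw [image_eq_zero_of_notMem_tsupport (notMem_tsupport_of_notMem_chartSupport hy hyK),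
          zero_mul]
  -- Continuity of the derivatives suffices: it is needed only to split the integral.
  have hdτ : ContDiffOn ℝ 0 (Form.rep c (PseudoForm.orient c stdVec (PseudoForm.d rfl τ)))
      (extChartAt (𝓡∂ (m + 1)) c).target := by
    refine ContDiffOn.congr ?_ fun y hy => PseudoForm.rep_d rfl hτ hy
    exact contDiffOn_form_iff.2 fun i =>
      contDiffOn_zero.2 (continuousOn_extDerivWithin_chart (hτ.2 c) i)
  have hdα : ContDiffOn ℝ 0 (Form.rep c (Form.d rfl α)) (extChartAt (𝓡∂ (m + 1)) c).target := by
    refine ContDiffOn.congr ?_ fun y hy =>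
      Form.rep_d rfl hy (Form.IsSmooth.differentiableWithinAt_rep (hα c) hy)
    exact contDiffOn_form_iff.2 fun i =>
      contDiffOn_zero.2 (continuousOn_extDerivWithin_chart (hα c) i)
  have hwedge : ∀ {k l : ℕ} (h : k + l = m + 1)
      {A : Coord (m + 1) → Coord (m + 1) [⋀^Fin k]→L[ℝ] ℝ}
      {B : Coord (m + 1) → Coord (m + 1) [⋀^Fin l]→L[ℝ] ℝ},
      ContDiffOn ℝ 0 A (extChartAt (𝓡∂ (m + 1)) c).target →
      ContDiffOn ℝ 0 B (extChartAt (𝓡∂ (m + 1)) c).target →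
      ContinuousOn (fun y => wedge h (A y) (B y) stdVec) (extChartAt (𝓡∂ (m + 1)) c).target :=
    fun h _ _ hA hB => (contDiffOn_form_iff.1 (contDiffOn_wedge h hA hB) id).continuousOn
  rw [← integral_add]
  · refine setIntegral_congr_fun (measurableSet_chart_target c) fun y hy => ?_
    have hyr := uniqueDiffOn_range y (extChartAt_target_subset_range c hy)
    have hd1 := Form.IsSmooth.differentiableWithinAt_rep (hτ.2 c) hy
    have hd2 := Form.IsSmooth.differentiableWithinAt_rep (hα c) hy
    have hd3 := Form.IsSmooth.differentiableWithinAt_rep (hτα.2 c) hy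
    simp only [funext (rep_orient_wedgeForm h τ α c stdVec)] at hd3
    have h3 := extDerivWithin_wedge_apply h h₁ h₂ hyr hd1 hd2 hd3 stdVec
    have e1 : Form.rep c (PseudoForm.orient c stdVec (PseudoForm.d rfl
        (PseudoForm.wedgeForm h τ α))) y stdVec =
        Form.rep c (PseudoForm.orient c stdVec
          (PseudoForm.wedgeForm h₁ (PseudoForm.d rfl τ) α)) y stdVec +
        (-1) ^ k * Form.rep c (PseudoForm.orient c stdVec
          (PseudoForm.wedgeForm h₂ τ (Form.d rfl α))) y stdVec := by
      rw [PseudoForm.rep_d rfl hτα hy, castDeg_rfl, rep_orient_wedgeForm, rep_orient_wedgeForm,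
        PseudoForm.rep_d rfl hτ hy, castDeg_rfl, Form.rep_d rfl hy hd2, castDeg_rfl, ← h3]
      simp only [funext (rep_orient_wedgeForm h τ α c stdVec)]
    exact (mul_add _ _ _).symm.trans (congrArg _ e1.symm)
  · refine hint _ ?_
    simp only [rep_orient_wedgeForm]
    exact hwedge h₁ hdτ ((hα c).of_le (by simp))
  · refine hint (fun y => (-1) ^ k * Form.rep c (PseudoForm.orient c stdVec
      (PseudoForm.wedgeForm h₂ τ (Form.d rfl α))) y stdVec) (continuousOn_const.mul ?_)
    simp only [rep_orient_wedgeForm]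
    exact hwedge h₂ ((hτ.2 c).of_le (by simp)) hdα

/-- Integration by parts. -/
theorem integral_by_parts {k l : ℕ} (h : k + l = m) (h₁ : k + 1 + l = m + 1)
    (h₂ : k + (l + 1) = m + 1) {τ : PseudoForm m M k} {α : Form m M l}
    (hτ : PseudoForm.IsSmooth τ) (hα : Form.IsSmooth α) :
    dualPseudoForm h₁ (PseudoForm.d rfl τ) α + (-1) ^ k * dualPseudoForm h₂ τ (Form.d rfl α) =
      dualBdry h (PseudoForm.tr τ) (Form.tr α) := by
  rw [dualPseudoForm, dualPseudoForm, integral_d_wedgeForm h h₁ h₂ hτ hα,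
    PseudoForm.integral_d (hτ.wedgeForm h hα), PseudoForm.tr_wedgeForm, dualBdry]

end PowerBalance

/-! ### The adjoint structure: codifferential equations and power balance. -/

section StokesDirac

variable {m : ℕ} {M : Type*} [TopologicalSpace M] [ChartedSpace (EuclideanHalfSpace (m + 1)) M]
  [IsManifold (𝓡∂ (m + 1)) ∞ M] (g : Metric m M)

theorem neg_one_pow_congr {N N' : ℕ} (h : Even (N + N')) : (-1 : ℝ) ^ N = (-1) ^ N' := by
  rcases Nat.even_or_odd N with h1 | h1
  · rw [h1.neg_one_pow, ((Nat.even_add.1 h).1 h1).neg_one_pow]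
  · rw [h1.neg_one_pow, Odd.neg_one_pow]
    rwa [← Nat.not_even_iff_odd, ← Nat.even_add.1 h, Nat.not_even_iff_odd]

theorem PseudoForm.tr_smul {k : ℕ} (r : ℝ) (τ : PseudoForm m M k) :
    PseudoForm.tr (r • τ) = r • PseudoForm.tr τ := rfl

/-- The adjoint Stokes–Dirac structure satisfies the codifferential equations. -/
theorem AdjointStokesDirac.codiff {p q : ℕ}
    (hp : q + 1 + p = m + 1) (hq : p + 1 + q = m + 1) (hpq : q + 1 + (p + 1) = m + 2)
    {f₁ : Form m M p} {fHat₂ : PseudoForm m M q} {eHat₁ : PseudoForm m M (q + 1)}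
    {e₂ : Form m M (p + 1)} {fBdry : BdryForm m M p} {eHatBdry : BdryPseudoForm m M q}
    (hA : AdjointStokesDirac g hp hq hpq f₁ fHat₂ eHat₁ e₂ fBdry eHatBdry) :
    CodiffStokesDirac g hp hq hpq f₁ fHat₂ eHat₁ e₂ fBdry eHatBdry := by
  obtain ⟨hs, fHat₁, f₂, e₁, eHat₂, hD, rfl, rfl, rfl, rfl⟩ := hA
  have hq' : q + (p + 1) = m + 1 := by omega
  have hp' : p + (q + 1) = m + 1 := by omega
  -- Here `p` and `q` denote the codegrees, so the degrees of the flows `f̂₁` and `f₂` are `q + 1`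
  -- and `p + 1`.
  have hstar : starForm g hq (starPseudo g hq' eHat₂) = (-1 : ℝ) ^ (q * (p + 1)) • eHat₂ :=
    starForm_starPseudo g hq' hq hD.smooth_eHat₂.1
  refine ⟨hs, isSmooth_starPseudo g _ hD.smooth_eHat₂, ?_, ?_, hD.port_f, ?_⟩
  · have h1 := hD.flow₁
    have h2 : PseudoForm.d rfl eHat₂ = (-1 : ℝ) ^ ((q + 1) * (p + 1) + 1) • starForm g hp' f₁ := by
      rw [h1, smul_smul, ← pow_add, Even.neg_one_pow ⟨_, rfl⟩, one_smul]
    rw [codiffForm, hstar, PseudoForm.d_smul, h2, starPseudo_smul, starPseudo_smul,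
      starPseudo_starForm g hp' hp, smul_smul, smul_smul, smul_smul, smul_smul, ← pow_add,
      ← pow_add, ← pow_add, ← pow_add, Even.neg_one_pow, one_smul]
    -- Half of the total exponent: each summand of `a₀` meets its twin from the flow sign, the
    -- double stars of `f₁` and `ê₂`, or the normalisation of `d*`.
    exact ⟨(q + 1) * (p + 1) + 1 + (q + 1) * p + (p + 1) * q + (m + 1) * (p + 1 + 1) + 1, by ring⟩
  · rw [codiffPseudo, smul_smul, ← pow_add, Even.neg_one_pow, one_smul, hD.flow₂]
    exact ⟨(m + 1) * (q + 1 + 1) + 1, by ring⟩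
  · rw [hD.port_e, hstar, PseudoForm.tr_smul, smul_smul, ← pow_add]
    congr 1
    refine neg_one_pow_congr ⟨q + 1 + (p + 1) * q, by ring⟩

/-- The codifferential equations define tuples of the adjoint Stokes–Dirac structure. -/
theorem CodiffStokesDirac.adjoint {p q : ℕ}
    (hp : q + 1 + p = m + 1) (hq : p + 1 + q = m + 1) (hpq : q + 1 + (p + 1) = m + 2)
    {f₁ : Form m M p} {fHat₂ : PseudoForm m M q} {eHat₁ : PseudoForm m M (q + 1)}
    {e₂ : Form m M (p + 1)} {fBdry : BdryForm m M p} {eHatBdry : BdryPseudoForm m M q}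
    (hC : CodiffStokesDirac g hp hq hpq f₁ fHat₂ eHat₁ e₂ fBdry eHatBdry) :
    AdjointStokesDirac g hp hq hpq f₁ fHat₂ eHat₁ e₂ fBdry eHatBdry := by
  have hq' : q + (p + 1) = m + 1 := by omega
  have hp' : p + (q + 1) = m + 1 := by omega
  have hs₂ := isSmooth_starForm g hq hC.smooth_e₂
  -- The sign in front of `⋆e₂` inverts the star, whose square on forms of this degree is that same
  -- sign.
  refine ⟨hC.smooth_eHat₁, starForm g hp' f₁, Form.d rfl (starPseudo g hp eHat₁),
    starPseudo g hp eHat₁, (-1 : ℝ) ^ ((p + 1) * q) • starForm g hq e₂,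
    ⟨isSmooth_starPseudo g hp hC.smooth_eHat₁, hs₂.const_smul _, ?_, rfl, hC.port_f, ?_⟩,
    rfl, ?_, rfl, ?_⟩
  · rw [hC.flow₁, codiffForm, starForm_smul, starForm_smul,
      starForm_starPseudo g hp hp' (isPseudo_d rfl hs₂.1), PseudoForm.d_smul, smul_smul, smul_smul,
      smul_smul, ← pow_add, ← pow_add, ← pow_add]
    congr 1
    exact neg_one_pow_congr
      ⟨(q + 1) * (p + 1) + 1 + (q + 1) * p + (p + 1) * q + (m + 1) * (p + 1 + 1) + 1, by ring⟩
  · rw [hC.port_e, PseudoForm.tr_smul, smul_smul, ← pow_add]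
  · rw [hC.flow₂, codiffPseudo, smul_smul, ← pow_add, Even.neg_one_pow, one_smul]
    exact ⟨(m + 1) * (q + 1 + 1) + 1, by ring⟩
  · rw [starPseudo_smul, starPseudo_starForm g hq hq', smul_smul, ← pow_add,
      Even.neg_one_pow ⟨_, rfl⟩, one_smul]

variable [T2Space M] [CompactSpace M]

/-- Writing `τ = ±⋆⋆τ`, symmetry gives `α ∧ ⋆⋆τ = ⋆τ ∧ ⋆α`; the sign of the double star cancels that
of commuting `τ` and `α`. -/
theorem dualPseudoForm_star {k l : ℕ} (h : k + l = m + 1) (h' : l + k = m + 1)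
    {τ : PseudoForm m M k} (hτ : IsPseudo τ) (α : Form m M l) :
    dualPseudoForm h τ α = dualFormPseudo h' (starPseudo g h τ) (starForm g h' α) := by
  have h1 : τ = (-1 : ℝ) ^ (k * l) • starForm g h' (starPseudo g h τ) := by
    rw [starForm_starPseudo g h h' hτ, smul_smul, ← pow_add, Even.neg_one_pow ⟨_, rfl⟩, one_smul]
  have h2 : PseudoForm.wedgeForm h τ α =
      Form.wedgePseudo h' (starPseudo g h τ) (starForm g h' α) := by
    rw [wedgePseudo_starForm_comm, wedgeForm_eq_wedgePseudo h h', mul_comm l k]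
    conv_lhs => rw [h1]
    funext x e
    change (-1 : ℝ) ^ (k * l) • wedge h' (α x) ((-1 : ℝ) ^ (k * l) • _) = _
    rw [wedge_smul_right, smul_smul, ← pow_add, Even.neg_one_pow ⟨_, rfl⟩, one_smul]
    rfl
  rw [dualPseudoForm, dualFormPseudo, h2]

/-- The power balance of the adjoint Stokes–Dirac structure. -/
theorem AdjointStokesDirac.power_balance {p q : ℕ}
    (hp : q + 1 + p = m + 1) (hq : p + 1 + q = m + 1) (hpq : q + 1 + (p + 1) = m + 2)
    (hm : q + p = m)
    {f₁ : Form m M p} {fHat₂ : PseudoForm m M q} {eHat₁ : PseudoForm m M (q + 1)}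
    {e₂ : Form m M (p + 1)} {fBdry : BdryForm m M p} {eHatBdry : BdryPseudoForm m M q}
    (hA : AdjointStokesDirac g hp hq hpq f₁ fHat₂ eHat₁ e₂ fBdry eHatBdry) :
    dualPseudoForm hp eHat₁ f₁ + dualFormPseudo hq e₂ fHat₂ + dualBdry hm eHatBdry fBdry = 0 := by
  obtain ⟨hs, fHat₁, f₂, e₁, eHat₂, hD, rfl, rfl, rfl, rfl⟩ := hA
  have hq' : q + (p + 1) = m + 1 := by omega
  have hp' : p + (q + 1) = m + 1 := by omega
  -- The pairing becomes `e₁ ∧ f̂₁` with `f̂₁ = (-1)^r dê₂`; commuting `e₁` past `dê₂` leaves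
  -- `(-1)^q`.
  have h1 : dualPseudoForm hp eHat₁ f₁ = (-1) ^ q *
      dualPseudoForm hp (PseudoForm.d rfl eHat₂) (starPseudo g hp eHat₁) := by
    rw [dualPseudoForm_star g hp hp' hs.1, hD.flow₁, dualFormPseudo, dualPseudoForm,
      wedgeForm_eq_wedgePseudo hp hp', ← PseudoForm.integral_smul, smul_smul, ← pow_add]
    congr 1
    funext x e
    change wedge hp' _ ((-1 : ℝ) ^ _ • _) = _
    rw [wedge_smul_right, neg_one_pow_congr (N' := q + p * (q + 1)) ?_]
    · rfl
    · exact ⟨(q + 1) * (p + 1), by ring⟩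
  have h2 := dualPseudoForm_star g hq' hq hD.smooth_eHat₂.1 f₂
  have h3 : dualBdry hm eHatBdry fBdry = -((-1) ^ q *
      dualBdry hm (PseudoForm.tr eHat₂) (Form.tr (starPseudo g hp eHat₁))) := by
    rw [hD.port_e, hD.port_f, dualBdry, dualBdry, ← neg_mul, ← BdryPseudoForm.integral_smul]
    congr 1
    funext x e
    change wedge hm ((-1 : ℝ) ^ _ • _) _ = _
    rw [wedge_smul_left, pow_succ, mul_neg_one]
    rfl
  -- The boundary term equals `-(-1)^q` times the integrated Leibniz rule, so it cancels both
  -- interior terms.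
  rw [h3, ← integral_by_parts hm hp hq' hD.smooth_eHat₂ hD.smooth_e₁, h1, ← h2, hD.flow₂]
  have h4 : ((-1 : ℝ) ^ q) * (-1) ^ q = 1 := by rw [← pow_add, Even.neg_one_pow ⟨_, rfl⟩]
  linear_combination -dualPseudoForm hq' eHat₂ (Form.d rfl (starPseudo g hp eHat₁)) * h4

end StokesDirac

end DualField

theorem mainTheorem9 {m : ℕ} {M : Type*} [TopologicalSpace M] [T2Space M] [CompactSpace M]
    [ChartedSpace (EuclideanHalfSpace (m + 1)) M] [IsManifold (𝓡∂ (m + 1)) ∞ M]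
    (g : Metric m M) {p p' q q' : ℕ}
    (hp : p + p' = m + 1) (hq : q + q' = m + 1) (hpq : p + q = m + 2)
    (f₁ : Form m M p') (fHat₂ : PseudoForm m M q') (eHat₁ : PseudoForm m M p) (e₂ : Form m M q)
    (fBdry : BdryForm m M p') (eHatBdry : BdryPseudoForm m M q') :
    (AdjointStokesDirac g hp hq hpq f₁ fHat₂ eHat₁ e₂ fBdry eHatBdry ↔
      CodiffStokesDirac g hp hq hpq f₁ fHat₂ eHat₁ e₂ fBdry eHatBdry) ∧
    (AdjointStokesDirac g hp hq hpq f₁ fHat₂ eHat₁ e₂ fBdry eHatBdry →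
      dualPseudoForm hp eHat₁ f₁ + dualFormPseudo hq e₂ fHat₂ +
        dualBdry (by omega) eHatBdry fBdry = 0) := by
  -- The relation `p + q = n + 1` forces `p = (n - q) + 1` and `q = (n - p) + 1`; both degrees are
  -- positive, and the codegrees serve as free parameters.
  obtain rfl : p = q' + 1 := by omega
  obtain rfl : q = p' + 1 := by omega
  exact ⟨⟨AdjointStokesDirac.codiff g hp hq hpq, CodiffStokesDirac.adjoint g hp hq hpq⟩,
    AdjointStokesDirac.power_balance g hp hq hpq (by omega)⟩
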